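/- Say that a set $A$ of positive integers has property P if there are no $x,y,z\in A$ (with $x=y$ allowed) such that $z<x$, $z<y$ and $z\mid x+y$. There is a natural number $N$ such that for every integer $n\geqslant N$ the following holds. If $A\subset\{1,2,\dots,n\}$ has property P, then $$|A|\leqslant\left\lceil\frac{n}{3}\right\rceil.$$ Moreover, this bound is tight for every such $n$: the set $\left\{\left\lfloor\frac{2n}{3}\right\rfloor+1,\dots,n\right\}$ is a subset of $\{1,\dots,n\}$ which has property P and has size $\left\lceil\frac{n}{3}\right\rceil$. -/

import Mathlib

/-- A set `A` of positive integers has property P if no element of `A` divides the sum of two larger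
elements of `A`. The two larger elements `x` and `y` are allowed to coincide. -/
def HasPropertyP (A : Set ℕ) : Prop :=
  ¬ ∃ x ∈ A, ∃ y ∈ A, ∃ z ∈ A, z < x ∧ z < y ∧ z ∣ x + y

/-! If all elements of A exceed n/2, reflection settles the matter: with m = min A, the map a ↦ 3m −
a sends A ∩ [3m − n, n] off A (`card_le_of_upper_half`). The difficulty is a set with an element z ≤
n/2. For such sets a positive proportion is gained, |A| ≤ (1/3 − 10⁻⁷)n + O(1)
(`exists_card_le_add_of_lower_half`), which is enough for large n.

Call the numbers 2^i a with a ∈ A multipliers. No multiple of a multiplier y is a sum of two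
elements of A above y, and twice a multiplier never lies in A. So doubling carries the lower half of
A injectively to the multipliers in the dyadic range just below the upper half.

An energy-increment argument (`exists_regularized`) discards few elements and makes A
equidistributed modulo 24 in cells: each dyadic range is cut into H cells, and cells with the same
number m at all levels form a place. Let f(m) be the density of A in the top cell and η(m) the
density of multipliers in the cell one level down. If w is the width of the top cells, |A| is about
w ∑ (f + η/2), so the target is ∑ (2f + η) ≤ (4/3 − c)H.

Locally, a multiplier y yields reflections r ↦ 4y − r of the top cell and r ↦ (2^k + 1)y − r between
levels. Moreover two elements of A at a short distance make A avoid two translates of four times the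
multipliers; a dense residue class of A is thereby forced into an arithmetic progression
(`exists_common_difference`, `Regular.concentrated`). A case analysis in classes modulo 24 gives 2f
+ η ≤ 4/3 up to a tiny error wherever η ≠ 0, with a definite gain unless η > 7/12 and all
multipliers there are elements of A (`LocalDensities.two_mul_sum_X_add_sum_Y_le`).

Where η = 0 this says nothing, and multiples of multipliers at other places must help: if such a
multiple meets the sum of two top cells, their densities add up to at most 1. Cutting f at heights
1/2 ± j turns this into sumset problems for the high and the low cells, solved by Cauchy–Davenport
bounds, ordinary and modular (`CellData.layer`). Summing over layers gives the global bound
(`CellData.excess_le`), in three ranges of the number of places with multipliers. If fewer than H/50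
places have multipliers, the lower half is negligible, and z alone already holds the upper half
below 0.3235n (`card_upper_half_le`). -/

theorem HasPropertyP.not_dvd {A : Set ℕ} (h : HasPropertyP A) {x y z : ℕ} (hx : x ∈ A)
    (hy : y ∈ A) (hz : z ∈ A) (hzx : z < x) (hzy : z < y) : ¬ z ∣ x + y :=
  fun hd => h ⟨x, hx, y, hy, z, hz, hzx, hzy, hd⟩

theorem HasPropertyP.mono {A B : Set ℕ} (h : HasPropertyP B) (hAB : A ⊆ B) : HasPropertyP A :=
  fun ⟨x, hx, y, hy, z, hz, hr⟩ => h ⟨x, hAB hx, y, hAB hy, z, hAB hz, hr⟩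

/-- No element of a set with property P divides a larger one. -/
theorem HasPropertyP.not_dvd_of_lt {A : Set ℕ} (h : HasPropertyP A) {x z : ℕ} (hx : x ∈ A)
    (hz : z ∈ A) (hzx : z < x) : ¬ z ∣ x :=
  fun hd => h.not_dvd hx hx hz hzx hzx (dvd_add hd hd)

/-- Sums of two elements above `z` avoid every multiple of every multiple of `z`. -/
theorem HasPropertyP.add_ne_mul {A : Set ℕ} (h : HasPropertyP A) {x x' z k : ℕ} (hx : x ∈ A)
    (hx' : x' ∈ A) (hz : z ∈ A) (hzx : z < x) (hzx' : z < x') : x + x' ≠ k * z :=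
  fun he => h.not_dvd hx hx' hz hzx hzx' (he ▸ dvd_mul_left z k)

/-! ### Rounding, the extremal interval, and sets above n/2 -/

theorem ceil_div_three (n : ℕ) : ⌈(n : ℝ) / 3⌉₊ = (n + 2) / 3 := by
  rcases Nat.eq_zero_or_pos n with rfl | hn
  · simp
  rw [Nat.ceil_eq_iff (by omega)]
  have h1 : (((n + 2) / 3 - 1 : ℕ) : ℝ) * 3 < n := by exact_mod_cast (by omega)
  have h2 : (n : ℝ) ≤ (((n + 2) / 3 : ℕ) : ℝ) * 3 := by exact_mod_cast (by omega)
  constructor <;> linarith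

theorem floor_two_mul_div_three (n : ℕ) : ⌊2 * (n : ℝ) / 3⌋₊ = 2 * n / 3 := by
  have h := Nat.floor_div_eq_div (K := ℝ) (2 * n) 3
  push_cast at h
  exact h

/-- The interval `(2n/3, n]` has property P. -/
theorem hasPropertyP_Icc_upper_third (n : ℕ) :
    HasPropertyP (Finset.Icc (2 * n / 3 + 1) n : Set ℕ) := by
  rintro ⟨x, hx, y, hy, z, hz, hzx, hzy, k, hk⟩
  simp only [Finset.coe_Icc, Set.mem_Icc] at hx hy hz
  have hk2 : 2 < k := by
    by_contra hc
    have : z * k ≤ z * 2 := Nat.mul_le_mul_left z (by omega)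
    omega
  have : z * 3 ≤ z * k := Nat.mul_le_mul_left z hk2
  omega

/-- The bound for sets that lie in the upper half of `{1, …, n}`. -/
theorem card_le_of_upper_half {n : ℕ} {A : Finset ℕ} (hA : A ⊆ Finset.Icc 1 n)
    (hP : HasPropertyP (A : Set ℕ)) (hhalf : ∀ a ∈ A, n < 2 * a) : A.card ≤ (n + 2) / 3 := by
  rcases A.eq_empty_or_nonempty with rfl | hne
  · simp
  set m := A.min' hne with hm
  have hmA : m ∈ A := A.min'_mem hne
  have hmin : ∀ a ∈ A, m ≤ a := fun a ha => A.min'_le a ha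
  have hle : ∀ a ∈ A, a ≤ n := fun a ha => (Finset.mem_Icc.1 (hA ha)).2
  have h2m := hhalf m hmA
  have hmn := hle m hmA
  by_cases h3 : 2 * n < 3 * m
  · have : A.card ≤ (Finset.Icc m n).card :=
      Finset.card_le_card fun a ha => Finset.mem_Icc.2 ⟨hmin a ha, hle a ha⟩
    rw [Nat.card_Icc] at this
    omega
  -- Below 3m − n lie at most 2m − n elements; above, reflection in 3m leaves at most half of 2n −
  -- 3m + 1 places. Together this is at most (m + 1)/2, and 3m ≤ 2n here. From n < 2m one has 3m − n
  -- > m, so m is strictly below both summands.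
  set B := A.filter (fun a => 3 * m - n ≤ a) with hB
  have hsplit := Finset.card_filter_add_card_filter_not (s := A) (fun a => 3 * m - n ≤ a)
  rw [← hB] at hsplit
  have hlow : (A.filter (fun a => ¬ 3 * m - n ≤ a)).card ≤ 2 * m - n := by
    have : A.filter (fun a => ¬ 3 * m - n ≤ a) ⊆ Finset.Ico m (3 * m - n) := by
      intro a ha
      rw [Finset.mem_filter] at ha
      exact Finset.mem_Ico.2 ⟨hmin a ha.1, by omega⟩
    have := Finset.card_le_card this
    rw [Nat.card_Ico] at this
    omega
  have hmem : ∀ a ∈ B, a ∈ A ∧ 3 * m - n ≤ a ∧ a ≤ n := fun a ha => by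
    rw [hB, Finset.mem_filter] at ha
    exact ⟨ha.1, ha.2, hle a ha.1⟩
  have hinj : (B.image (fun a => 3 * m - a)).card = B.card :=
    Finset.card_image_of_injOn fun a ha b hb hab => by
      have := hmem a ha; have := hmem b hb
      have hab : 3 * m - a = 3 * m - b := hab
      omega
  have hdisj : Disjoint B (B.image (fun a => 3 * m - a)) := by
    rw [Finset.disjoint_right]
    intro b hb hbB
    obtain ⟨a, ha, rfl⟩ := Finset.mem_image.1 hb
    have h1 := hmem a ha; have h2 := hmem _ hbB
    exact hP.add_ne_mul (k := 3) (Finset.mem_coe.2 h1.1) (Finset.mem_coe.2 h2.1)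
      (Finset.mem_coe.2 hmA) (by omega) (by omega) (by omega)
  have hunion : B ∪ B.image (fun a => 3 * m - a) ⊆ Finset.Icc (3 * m - n) n := by
    intro b hb
    rcases Finset.mem_union.1 hb with hb | hb
    · exact Finset.mem_Icc.2 (hmem b hb).2
    · obtain ⟨a, ha, rfl⟩ := Finset.mem_image.1 hb
      have := hmem a ha
      exact Finset.mem_Icc.2 ⟨by omega, by omega⟩
  have hcard := Finset.card_le_card hunion
  rw [Finset.card_union_of_disjoint hdisj, hinj, Nat.card_Icc] at hcard
  omega

/-- The exponent that brings `z` into `(n/4, n/2]` by repeated doubling. -/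
theorem exists_two_pow_mul_mem {n z : ℕ} (hz : 0 < z) (hzn : 2 * z ≤ n) :
    ∃ j, n < 4 * (2 ^ j * z) ∧ 2 * (2 ^ j * z) ≤ n := by
  classical
  have hex : ∃ j, n < 4 * (2 ^ j * z) := ⟨n, by
    have := Nat.lt_two_pow_self (n := n)
    nlinarith⟩
  refine ⟨Nat.find hex, Nat.find_spec hex, ?_⟩
  rcases Nat.eq_zero_or_pos (Nat.find hex) with h0 | h0
  · rw [h0]; simpa using hzn
  · have hlt := Nat.find_min hex (Nat.sub_lt h0 one_pos)
    have hs : 2 ^ Nat.find hex = 2 * 2 ^ (Nat.find hex - 1) := by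
      rw [← pow_succ']; congr 1; omega
    rw [hs]
    push Not at hlt
    nlinarith

/-- Reflection: if no sum of two elements of `X` equals `s`, then a window and its mirror image
under `x ↦ s - x` together hold at most as many elements of `X` as the window has places. -/
theorem card_window_add_card_reflected_le {X : Finset ℕ} {s x d : ℕ} (hs : x + d ≤ s + 1)
    (hX : ∀ a ∈ X, ∀ b ∈ X, a + b ≠ s) :
    (X ∩ Finset.Ico x (x + d)).card + (X ∩ Finset.Ico (s + 1 - (x + d)) (s + 1 - x)).card ≤ d := by
  classical
  set I := Finset.Ico x (x + d)
  have h1 : (X ∩ Finset.Ico (s + 1 - (x + d)) (s + 1 - x)).card ≤ (I \ X).card := by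
    refine Finset.card_le_card_of_injOn (fun a => s - a) (fun a ha => ?_) fun a ha b hb hab => ?_
    · rw [Finset.mem_coe, Finset.mem_inter, Finset.mem_Ico] at ha
      rw [Finset.mem_coe, Finset.mem_sdiff]
      have hsum : a + (s - a) = s := by omega
      have hl : x ≤ s - a ∧ s - a < x + d := by omega
      exact ⟨Finset.mem_Ico.2 hl, fun hc => hX a ha.1 (s - a) hc hsum⟩
    · rw [Finset.mem_coe, Finset.mem_inter, Finset.mem_Ico] at ha hb
      have hab : s - a = s - b := hab
      omega
  have h2 := Finset.card_inter_add_card_sdiff I X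
  have h3 : I.card = d := by simp [I]
  rw [Finset.inter_comm] at h2
  omega

/-! ### Sumset bounds with the summand {0, 1} -/

section
open scoped Pointwise

/-- A Cauchy–Davenport bound that holds in every cyclic group, thanks to the summand `{0, 1}`. -/
theorem ZMod.min_le_card_add_add_pair {m : ℕ} [NeZero m] (P Q : Finset (ZMod m))
    (hP : P.Nonempty) (hQ : Q.Nonempty) :
    min m (P.card + Q.card) ≤ (P + Q + {0, 1}).card := by
  classical
  have core : ∀ k : ℕ, ∀ P Q : Finset (ZMod m), Q.card = k → P.Nonempty → 0 ∈ Q →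
      min m (P.card + Q.card) ≤ (P + Q + {0, 1}).card := by
    intro k
    induction k using Nat.strong_induction_on with
    | _ k ih =>
    intro P Q hk hP h0
    -- The induction on |Q| uses the Dyson transform, which stalls only if P is invariant under
    -- translation by Q.
    by_cases hcl : ∀ p ∈ P, ∀ q ∈ Q, p + q ∈ P
    · have hsub : P ⊆ P + Q + {0, 1} := fun p hp => by
        have := Finset.add_mem_add (Finset.add_mem_add hp h0)
          (show (0 : ZMod m) ∈ ({0, 1} : Finset (ZMod m)) by simp)
        simpa using this
      by_cases h1 : ∀ p ∈ P, p + 1 ∈ P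
      · have hall : ∀ x : ZMod m, x ∈ P := by
          obtain ⟨p, hp⟩ := hP
          have : ∀ j : ℕ, p + j ∈ P := by
            intro j
            induction j with
            | zero => simpa using hp
            | succ j hj => have := h1 _ hj; push_cast; rwa [← add_assoc]
          intro x
          have := this (x - p).val
          rwa [ZMod.natCast_val, ZMod.cast_id, add_sub_cancel] at this
        have huniv : P = Finset.univ := Finset.eq_univ_of_forall hall
        have hPm : P.card = m := by rw [huniv, Finset.card_univ, ZMod.card]
        have := Finset.card_le_card hsub
        exact (min_le_left _ _).trans (hPm.ge.trans this)
      · push Not at h1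
        obtain ⟨p, hp, hp1⟩ := h1
        have hsub2 : Q.image (fun q => p + q + 1) ⊆ P + Q + {0, 1} := by
          intro x hx
          obtain ⟨q, hq, rfl⟩ := Finset.mem_image.1 hx
          exact Finset.add_mem_add (Finset.add_mem_add hp hq) (by simp)
        have hcard : (Q.image (fun q => p + q + 1)).card = Q.card :=
          Finset.card_image_of_injective _ fun a b hab => by simpa using hab
        have hdis : Disjoint P (Q.image (fun q => p + q + 1)) := by
          rw [Finset.disjoint_right]
          intro x hx hxP
          obtain ⟨q, hq, rfl⟩ := Finset.mem_image.1 hx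
          -- As P + q = P, having p + q + 1 in P would put p + 1 in P, against the choice of p.
          have himg : P.image (fun x => x + q) = P :=
            Finset.eq_of_subset_of_card_le
              (fun x hx => by
                obtain ⟨y, hy, rfl⟩ := Finset.mem_image.1 hx
                exact hcl y hy q hq)
              (Finset.card_image_of_injective _ (add_left_injective q)).ge
          rw [← himg] at hxP
          obtain ⟨y, hy, hye⟩ := Finset.mem_image.1 hxP
          have : y = p + 1 := by linear_combination hye
          exact hp1 (this ▸ hy)
        have := Finset.card_le_card (Finset.union_subset hsub hsub2)
        rw [Finset.card_union_of_disjoint hdis, hcard] at this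
        exact (min_le_right _ _).trans this
    · push Not at hcl
      obtain ⟨p, hp, q, hq, hpq⟩ := hcl
      -- The transform P ∪ (p + Q), Q ∩ (P − p): the total size is kept, the sumset does not grow, 0
      -- stays in the second set and q drops out of it.
      set P' := P ∪ Q.image (fun x => p + x) with hP'
      set Q' := Q.filter (fun x => p + x ∈ P) with hQ'
      have hQ'lt : Q'.card < Q.card := by
        refine Finset.card_lt_card ⟨Finset.filter_subset _ _, fun h => ?_⟩
        exact hpq (Finset.mem_filter.1 (h hq)).2
      have h0' : (0 : ZMod m) ∈ Q' := Finset.mem_filter.2 ⟨h0, by simpa using hp⟩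
      have hcards : P'.card + Q'.card = P.card + Q.card := by
        have h1 := Finset.card_union_add_card_inter P (Q.image (fun x => p + x))
        have h2 : (Q.image (fun x => p + x)).card = Q.card :=
          Finset.card_image_of_injective _ (add_right_injective p)
        have h3 : P ∩ Q.image (fun x => p + x) = Q'.image (fun x => p + x) := by
          ext x
          simp only [Finset.mem_inter, Finset.mem_image, hQ', Finset.mem_filter]
          constructor
          · rintro ⟨hx, y, hy, rfl⟩; exact ⟨y, ⟨hy, hx⟩, rfl⟩
          · rintro ⟨y, ⟨hy, hx⟩, rfl⟩; exact ⟨hx, y, hy, rfl⟩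
        have h4 : (Q'.image (fun x => p + x)).card = Q'.card :=
          Finset.card_image_of_injective _ (add_right_injective p)
        rw [h2, h3, h4] at h1
        exact h1
      have hsub : P' + Q' ⊆ P + Q := by
        intro x hx
        obtain ⟨a, ha, b, hb, rfl⟩ := Finset.mem_add.1 hx
        obtain ⟨hb1, hb2⟩ := Finset.mem_filter.1 hb
        rcases Finset.mem_union.1 ha with ha | ha
        · exact Finset.add_mem_add ha hb1
        · obtain ⟨y, hy, rfl⟩ := Finset.mem_image.1 ha
          have := Finset.add_mem_add hb2 hy
          rwa [add_right_comm] at this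
      have := ih Q'.card (hk ▸ hQ'lt) P' Q' rfl
        (hP.mono Finset.subset_union_left) h0'
      rw [hcards] at this
      exact this.trans (Finset.card_le_card (Finset.add_subset_add_right hsub))
  obtain ⟨q, hq⟩ := hQ
  have h := core _ P (Q.image (fun x => x - q)) rfl hP (Finset.mem_image.2 ⟨q, hq, sub_self q⟩)
  have hc : (Q.image (fun x => x - q)).card = Q.card :=
    Finset.card_image_of_injective _ (sub_left_injective)
  rw [hc] at h
  refine h.trans ?_
  have : P + Q.image (fun x => x - q) + {0, 1} ⊆ (P + Q + {0, 1}).image (fun x => x - q) := by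
    intro x hx
    obtain ⟨a, ha, b, hb, rfl⟩ := Finset.mem_add.1 hx
    obtain ⟨c, hc, d, hd, rfl⟩ := Finset.mem_add.1 ha
    obtain ⟨y, hy, rfl⟩ := Finset.mem_image.1 hd
    exact Finset.mem_image.2 ⟨c + y + b, Finset.add_mem_add (Finset.add_mem_add hc hy) hb, by ring⟩
  exact (Finset.card_le_card this).trans Finset.card_image_le

/-- Each of the two applications of Cauchy–Davenport loses one, and the summand {0, 1} gives back
two. -/
theorem Nat.card_add_card_le_card_add_add_pair {U N : Finset ℕ} (hU : U.Nonempty)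
    (hN : N.Nonempty) : U.card + N.card ≤ (U + N + {0, 1}).card := by
  have h1 := cauchy_davenport_add_of_linearOrder_isCancelAdd hU hN
  have h2 := cauchy_davenport_add_of_linearOrder_isCancelAdd (hU.add hN)
    (show ({0, 1} : Finset ℕ).Nonempty by simp)
  have h3 : ({0, 1} : Finset ℕ).card = 2 := by simp
  have := hU.card_pos
  omega

/-- A set in an interval of length `2m` meets every residue class modulo `m` at most twice. -/
theorem card_eq_card_image_cast_add {m a : ℕ} [NeZero m] {U : Finset ℕ}
    (hU : U ⊆ Finset.Ico a (a + 2 * m)) :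
    U.card = (U.image (Nat.cast : ℕ → ZMod m)).card +
      ((U.filter fun u => u + m ∈ U).image (Nat.cast : ℕ → ZMod m)).card := by
  classical
  have hm : 0 < m := Nat.pos_of_ne_zero (NeZero.ne m)
  have key : ∀ u v : ℕ, (u : ZMod m) = v → u ≤ v → v < u + 2 * m → v = u ∨ v = u + m := by
    intro u v h huv hlt
    obtain ⟨d, rfl⟩ := Nat.exists_eq_add_of_le huv
    have hd : m ∣ d := by
      rw [← ZMod.natCast_eq_zero_iff]
      push_cast at h
      linear_combination -h
    obtain ⟨c, rfl⟩ := hd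
    have : c < 2 := by by_contra hc; nlinarith
    interval_cases c <;> simp
  have hfil := Finset.card_filter_add_card_filter_not (s := U) (fun u => u + m ∈ U)
  have h1 : ((U.filter fun u => u + m ∈ U).image (Nat.cast : ℕ → ZMod m)).card =
      (U.filter fun u => u + m ∈ U).card := by
    refine Finset.card_image_of_injOn fun u hu v hv huv => ?_
    have h1 := Finset.mem_filter.1 (Finset.mem_coe.1 hu)
    have h2 := Finset.mem_filter.1 (Finset.mem_coe.1 hv)
    have a1 := Finset.mem_Ico.1 (hU h1.1); have a2 := Finset.mem_Ico.1 (hU h1.2)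
    have a3 := Finset.mem_Ico.1 (hU h2.1); have a4 := Finset.mem_Ico.1 (hU h2.2)
    rcases le_total u v with h | h
    · rcases key u v huv h (by omega) with h | h <;> omega
    · rcases key v u huv.symm h (by omega) with h | h <;> omega
  have h2 : (U.image (Nat.cast : ℕ → ZMod m)) =
      (U.filter fun u => ¬ u + m ∈ U).image (Nat.cast : ℕ → ZMod m) := by
    refine Finset.Subset.antisymm (fun x hx => ?_) (Finset.image_subset_image (Finset.filter_subset _ _))
    obtain ⟨u, hu, rfl⟩ := Finset.mem_image.1 hx
    by_cases hum : u + m ∈ U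
    · refine Finset.mem_image.2 ⟨u + m, Finset.mem_filter.2 ⟨hum, fun h => ?_⟩, by simp⟩
      have a1 := Finset.mem_Ico.1 (hU hu); have a2 := Finset.mem_Ico.1 (hU h)
      omega
    · exact Finset.mem_image.2 ⟨u, Finset.mem_filter.2 ⟨hu, hum⟩, rfl⟩
  have h3 : ((U.filter fun u => ¬ u + m ∈ U).image (Nat.cast : ℕ → ZMod m)).card =
      (U.filter fun u => ¬ u + m ∈ U).card := by
    refine Finset.card_image_of_injOn fun u hu v hv huv => ?_
    have h1 := Finset.mem_filter.1 (Finset.mem_coe.1 hu)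
    have h2 := Finset.mem_filter.1 (Finset.mem_coe.1 hv)
    have a1 := Finset.mem_Ico.1 (hU h1.1)
    have a3 := Finset.mem_Ico.1 (hU h2.1)
    rcases le_total u v with h | h
    · rcases key u v huv h (by omega) with h | h
      · exact h.symm
      · exact absurd (h ▸ h2.1) h1.2
    · rcases key v u huv.symm h (by omega) with h | h
      · exact h
      · exact absurd (h ▸ h1.1) h2.2
  rw [h1, h2, h3]
  omega

/-- If sums `u + n` and `u + n + 1` avoid the multiples of `m`, then either `N` has no two elements
at distance `m`, or the sumset is large. -/
theorem card_add_card_le_or_of_not_dvd {m a : ℕ} (hm : 0 < m) {U N : Finset ℕ} (hne : U.Nonempty)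
    (hUN : U ⊆ N) (hN : N ⊆ Finset.Ico a (a + 2 * m))
    (h0 : ∀ u ∈ U, ∀ v ∈ N, ¬ m ∣ u + v) (h1 : ∀ u ∈ U, ∀ v ∈ N, ¬ m ∣ u + v + 1) :
    U.card + N.card ≤ m ∨ 2 * U.card + N.card ≤ (U + N + {0, 1}).card := by
  classical
  have : NeZero m := ⟨hm.ne'⟩
  set c : ℕ → ZMod m := Nat.cast with hc
  set P := U.image c with hP
  set Q := N.image c with hQ
  set U2 := U.filter fun u => u + m ∈ U with hU2
  set N2 := N.filter fun u => u + m ∈ N with hN2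
  set P2 := U2.image c with hP2
  set Q2 := N2.image c with hQ2
  have hUc : U.card = P.card + P2.card := card_eq_card_image_cast_add (hUN.trans hN)
  have hNc : N.card = Q.card + Q2.card := card_eq_card_image_cast_add hN
  have hPne : P.Nonempty := hne.image c
  have hQne : Q.Nonempty := (hne.mono hUN).image c
  have hzero : (0 : ZMod m) ∉ P + Q + {0, 1} := by
    intro h
    obtain ⟨x, hx, y, hy, hxy⟩ := Finset.mem_add.1 h
    obtain ⟨p, hp, q, hq, rfl⟩ := Finset.mem_add.1 hx
    obtain ⟨u, hu, rfl⟩ := Finset.mem_image.1 hp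
    obtain ⟨v, hv, rfl⟩ := Finset.mem_image.1 hq
    rcases (by simpa using hy : y = 0 ∨ y = 1) with rfl | rfl
    · refine h0 u hu v hv ((ZMod.natCast_eq_zero_iff _ _).1 ?_)
      push_cast; simpa [hc] using hxy
    · refine h1 u hu v hv ((ZMod.natCast_eq_zero_iff _ _).1 ?_)
      push_cast; simpa [hc] using hxy
  have hlt : ∀ X Y : Finset (ZMod m), X ⊆ P → Y ⊆ Q → X.Nonempty → Y.Nonempty →
      X.card + Y.card ≤ (X + Y + {0, 1}).card := by
    intro X Y hX hY hXn hYn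
    have hs : X + Y + {0, 1} ⊆ P + Q + {0, 1} :=
      Finset.add_subset_add_right (Finset.add_subset_add hX hY)
    have h := ZMod.min_le_card_add_add_pair X Y hXn hYn
    have hlt : (X + Y + {0, 1}).card < m := by
      have : X + Y + {0, 1} ⊂ (Finset.univ : Finset (ZMod m)) :=
        ⟨Finset.subset_univ _, fun hc => hzero (hs (hc (Finset.mem_univ _)))⟩
      have := Finset.card_lt_card this
      rwa [Finset.card_univ, ZMod.card] at this
    omega
  have hltm : (P + Q + {0, 1}).card < m := by
    have : P + Q + {0, 1} ⊂ (Finset.univ : Finset (ZMod m)) :=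
      ⟨Finset.subset_univ _, fun hc => hzero (hc (Finset.mem_univ _))⟩
    have := Finset.card_lt_card this
    rwa [Finset.card_univ, ZMod.card] at this
  have hPQ := hlt P Q subset_rfl subset_rfl hPne hQne
  have hsubP2 : U2 ⊆ N2 := fun u hu => by
    rw [hU2, Finset.mem_filter] at hu
    exact Finset.mem_filter.2 ⟨hUN hu.1, hUN hu.2⟩
  -- If N2 is empty, reduction modulo m is injective on U and N, and the residues of U + N + {0, 1}
  -- miss 0: this is the first alternative.
  rcases N2.eq_empty_or_nonempty with hN2e | hN2ne
  · left
    have hU2e : U2 = ∅ := Finset.subset_empty.1 (hN2e ▸ hsubP2)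
    have e1 : P2.card = 0 := by simp [hP2, hU2e]
    have e2 : Q2.card = 0 := by simp [hQ2, hN2e]
    omega
  right
  have hQ2ne : Q2.Nonempty := hN2ne.image c
  have hQ2Q : Q2 ⊆ Q := Finset.image_subset_image (Finset.filter_subset _ _)
  have hP2P : P2 ⊆ P := Finset.image_subset_image (Finset.filter_subset _ _)
  have hP2Q2 : P2.card ≤ Q2.card := Finset.card_le_card (Finset.image_subset_image hsubP2)
  have hPQ2 := hlt P Q2 subset_rfl hQ2Q hPne hQ2ne
  have hP2Q2' : 2 * P2.card ≤ (P2 + Q2 + {0, 1}).card := by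
    rcases P2.eq_empty_or_nonempty with he | hne2
    · simp [he]
    · have := hlt P2 Q2 hP2P hQ2Q hne2 hQ2ne
      omega
  set T := U + N + {0, 1} with hT
  have hfib : T.card = ∑ r : ZMod m, (T.filter fun t => c t = r).card :=
    Finset.card_eq_sum_card_fiberwise fun t _ => Finset.mem_univ _
  have hind : ∀ X : Finset (ZMod m), X.card = ∑ r : ZMod m, if r ∈ X then 1 else 0 := by
    intro X; simp
  have hmemT : ∀ u ∈ U, ∀ v ∈ N, ∀ i ∈ ({0, 1} : Finset ℕ), u + v + i ∈ T := fun u hu v hv i hi =>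
    Finset.add_mem_add (Finset.add_mem_add hu hv) hi
  have hform : ∀ (U' N' : Finset ℕ) (r : ZMod m), r ∈ U'.image c + N'.image c + {0, 1} →
      ∃ u ∈ U', ∃ v ∈ N', ∃ i ∈ ({0, 1} : Finset ℕ), c (u + v + i) = r := by
    intro U' N' r hr
    obtain ⟨x, hx, y, hy, rfl⟩ := Finset.mem_add.1 hr
    obtain ⟨p, hp, q, hq, rfl⟩ := Finset.mem_add.1 hx
    obtain ⟨u, hu, rfl⟩ := Finset.mem_image.1 hp
    obtain ⟨v, hv, rfl⟩ := Finset.mem_image.1 hq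
    rcases (by simpa using hy : y = 0 ∨ y = 1) with rfl | rfl
    · exact ⟨u, hu, v, hv, 0, by simp, by simp [hc]⟩
    · exact ⟨u, hu, v, hv, 1, by simp, by simp [hc]⟩
  have hcm : ∀ t, c (t + m) = c t := fun t => by simp [hc]
  -- A residue is hit at least once if it lies in P + Q + {0, 1}, twice in P + Q2 + {0, 1} (through
  -- v and v + m), three times in P2 + Q2 + {0, 1}. The lower bounds |P| + |Q|, |P| + |Q2| and 2|P2|
  -- for these sets add up to 2|U| + |N|.
  have hpt : ∀ r : ZMod m, (if r ∈ P + Q + {0, 1} then 1 else 0) +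
      (if r ∈ P + Q2 + {0, 1} then 1 else 0) + (if r ∈ P2 + Q2 + {0, 1} then 1 else 0) ≤
      (T.filter fun t => c t = r).card := by
    intro r
    by_cases h3 : r ∈ P2 + Q2 + {0, 1}
    · obtain ⟨u, hu, v, hv, i, hi, hr⟩ := hform _ _ r h3
      rw [hU2, Finset.mem_filter] at hu
      rw [hN2, Finset.mem_filter] at hv
      have hs : ({u + v + i, u + v + i + m, u + v + i + m + m} : Finset ℕ) ⊆
          T.filter fun t => c t = r := by
        intro t ht
        simp only [Finset.mem_insert, Finset.mem_singleton] at ht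
        rcases ht with rfl | rfl | rfl
        · exact Finset.mem_filter.2 ⟨hmemT u hu.1 v hv.1 i hi, hr⟩
        · refine Finset.mem_filter.2 ⟨?_, by rw [hcm, hr]⟩
          have := hmemT u hu.1 _ hv.2 i hi
          rwa [show u + (v + m) + i = u + v + i + m by ring] at this
        · refine Finset.mem_filter.2 ⟨?_, by rw [hcm, hcm, hr]⟩
          have := hmemT _ hu.2 _ hv.2 i hi
          rwa [show u + m + (v + m) + i = u + v + i + m + m by ring] at this
      have h3' := Finset.card_le_card hs
      rw [Finset.card_eq_three.2 ⟨u + v + i, u + v + i + m, u + v + i + m + m, by omega, by omega,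
        by omega, rfl⟩] at h3'
      split_ifs <;> omega
    by_cases h2 : r ∈ P + Q2 + {0, 1}
    · obtain ⟨u, hu, v, hv, i, hi, hr⟩ := hform _ _ r h2
      rw [hN2, Finset.mem_filter] at hv
      have hs : ({u + v + i, u + v + i + m} : Finset ℕ) ⊆ T.filter fun t => c t = r := by
        intro t ht
        simp only [Finset.mem_insert, Finset.mem_singleton] at ht
        rcases ht with rfl | rfl
        · exact Finset.mem_filter.2 ⟨hmemT u hu v hv.1 i hi, hr⟩
        · refine Finset.mem_filter.2 ⟨?_, by rw [hcm, hr]⟩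
          have := hmemT u hu _ hv.2 i hi
          rwa [show u + (v + m) + i = u + v + i + m by ring] at this
      have h3' := Finset.card_le_card hs
      rw [Finset.card_pair (by omega)] at h3'
      split_ifs <;> omega
    by_cases h1 : r ∈ P + Q + {0, 1}
    · obtain ⟨u, hu, v, hv, i, hi, hr⟩ := hform _ _ r h1
      have : 0 < (T.filter fun t => c t = r).card :=
        Finset.card_pos.2 ⟨_, Finset.mem_filter.2 ⟨hmemT u hu v hv i hi, hr⟩⟩
      simp only [h1, h2, h3, if_true, if_false]
      omega
    · simp [h1, h2, h3]
  have hsum := Finset.sum_le_sum fun r (_ : r ∈ (Finset.univ : Finset (ZMod m))) => hpt r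
  rw [Finset.sum_add_distrib, Finset.sum_add_distrib, ← hind, ← hind, ← hind, ← hfib] at hsum
  omega

end

/-! ### Cells met by multiples of multipliers, and the two bounds for a single layer -/

section
open scoped Pointwise

open Classical in
/-- The cells in `[4H, 8H)` that meet a multiple of a point of a cell in `S`. -/
noncomputable def multCells (H : ℕ) (S : Finset ℕ) : Finset ℕ :=
  (Finset.Ico (4 * H) (8 * H)).filter fun c => ∃ m ∈ S, ∃ k, k * m ≤ c ∧ c < k * m + k

/-- For every cell in `S`, the cells that meet the least multiple beyond `6H`. -/
def nextCells (H : ℕ) (S : Finset ℕ) : Finset ℕ :=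
  (S.filter fun m => 3 * H ≤ 2 * m).biUnion (fun m => Finset.Ico (4 * m) (4 * m + 4)) ∪
  (S.filter fun m => 6 * H ≤ 5 * m ∧ 2 * m < 3 * H).biUnion
    (fun m => Finset.Ico (5 * m) (5 * m + 5)) ∪
  (S.filter fun m => 5 * m < 6 * H).biUnion (fun m => Finset.Ico (6 * m) (6 * m + 6))

/-- The k-fold multiples of points of [m, m + 1) fill the block [km, km + k), and blocks of distinct
m are disjoint. -/
theorem card_biUnion_Ico_mul (k : ℕ) (S : Finset ℕ) :
    (S.biUnion fun m => Finset.Ico (k * m) (k * m + k)).card = k * S.card := by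
  rw [Finset.card_biUnion]
  · simp [mul_comm]
  · intro m _ m' _ hne
    rw [Function.onFun, Finset.disjoint_left]
    intro c hc hc'
    rw [Finset.mem_Ico] at hc hc'
    rcases Nat.lt_or_gt_of_ne hne with h | h
    · have : k * (m + 1) ≤ k * m' := Nat.mul_le_mul_left k h
      rw [Nat.mul_succ] at this; omega
    · have : k * (m' + 1) ≤ k * m := Nat.mul_le_mul_left k h
      rw [Nat.mul_succ] at this; omega

theorem mem_multCells {H c : ℕ} {S : Finset ℕ} : c ∈ multCells H S ↔
    (4 * H ≤ c ∧ c < 8 * H) ∧ ∃ m ∈ S, ∃ k, k * m ≤ c ∧ c < k * m + k := by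
  classical
  simp [multCells]

/-- The factor 4 carries [H, 2H) into [4H, 8H) whatever S is. -/
theorem four_mul_card_le_card_multCells {H : ℕ} {S : Finset ℕ} (hS : S ⊆ Finset.Ico H (2 * H)) :
    4 * S.card ≤ (multCells H S).card := by
  rw [← card_biUnion_Ico_mul]
  refine Finset.card_le_card fun c hc => ?_
  obtain ⟨m, hm, hc⟩ := Finset.mem_biUnion.1 hc
  have := Finset.mem_Ico.1 (hS hm)
  rw [Finset.mem_Ico] at hc
  exact mem_multCells.2 ⟨by omega, m, hm, 4, hc⟩

/-- On each of the three ranges the factor is constant, 4, 5 or 6, so the blocks are disjoint there;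
and 1/4 + 1/5 + 1/6 = 37/60. -/
theorem sixty_mul_card_le_card_nextCells {H : ℕ} {S : Finset ℕ} :
    60 * S.card ≤ 37 * (nextCells H S).card := by
  set A := S.filter fun m => 3 * H ≤ 2 * m with hA
  set B := S.filter fun m => 6 * H ≤ 5 * m ∧ 2 * m < 3 * H with hB
  set C := S.filter fun m => 5 * m < 6 * H with hC
  have h1 : 4 * A.card ≤ (nextCells H S).card := by
    rw [← card_biUnion_Ico_mul]
    exact Finset.card_le_card (Finset.subset_union_left.trans Finset.subset_union_left)
  have h2 : 5 * B.card ≤ (nextCells H S).card := by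
    rw [← card_biUnion_Ico_mul]
    exact Finset.card_le_card (Finset.subset_union_right.trans Finset.subset_union_left)
  have h3 : 6 * C.card ≤ (nextCells H S).card := by
    rw [← card_biUnion_Ico_mul]
    exact Finset.card_le_card Finset.subset_union_right
  have h4 : S.card ≤ A.card + B.card + C.card := by
    refine (Finset.card_le_card (t := A ∪ B ∪ C) fun m hm => ?_).trans
      ((Finset.card_union_le _ _).trans (Nat.add_le_add_right (Finset.card_union_le _ _) _))
    simp only [Finset.mem_union, hA, hB, hC, Finset.mem_filter, hm, true_and]
    omega
  omega

/-- Cells `W` all of whose double cells avoid the triples of cells of `S`. -/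
def AvoidsTriples (S W : Finset ℕ) : Prop :=
  ∀ m₁ ∈ W, ∀ m ∈ S, (2 * m₁ < 3 * m ∨ 3 * m + 3 ≤ 2 * m₁) ∧
    (2 * m₁ + 1 < 3 * m ∨ 3 * m + 3 ≤ 2 * m₁ + 1)

/-- Fourfold and sixfold blocks are the doubles of the double and triple blocks that the hypothesis
keeps apart. -/
theorem disjoint_biUnion_four_six {S W : Finset ℕ} (hWS : W ⊆ S) (h : AvoidsTriples S W)
    {A C : Finset ℕ} (hA : A ⊆ W) (hC : C ⊆ W) :
    Disjoint (A.biUnion fun m => Finset.Ico (4 * m) (4 * m + 4))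
      (C.biUnion fun m => Finset.Ico (6 * m) (6 * m + 6)) := by
  rw [Finset.disjoint_left]
  intro c hc hc'
  obtain ⟨m₁, hm₁, hc⟩ := Finset.mem_biUnion.1 hc
  obtain ⟨m, hm, hc'⟩ := Finset.mem_biUnion.1 hc'
  rw [Finset.mem_Ico] at hc hc'
  have := h m₁ (hA hm₁) m (hWS (hC hm))
  omega

/-- Fourfold and sixfold blocks being disjoint, the outer two ranges together cost only 1/4, and 1/4
+ 1/5 = 9/20. -/
theorem twenty_mul_card_le_card_nextCells {H : ℕ} {S W : Finset ℕ} (hWS : W ⊆ S)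
    (h : AvoidsTriples S W) : 20 * W.card ≤ 9 * (nextCells H S).card := by
  set A := W.filter fun m => 3 * H ≤ 2 * m with hA
  set B := W.filter fun m => 6 * H ≤ 5 * m ∧ 2 * m < 3 * H with hB
  set C := W.filter fun m => 5 * m < 6 * H with hC
  have h2 : 5 * B.card ≤ (nextCells H S).card := by
    rw [← card_biUnion_Ico_mul]
    refine Finset.card_le_card ((Finset.biUnion_subset_biUnion_of_subset_left _
      (Finset.filter_subset_filter _ hWS)).trans
      (Finset.subset_union_right.trans Finset.subset_union_left))
  have h3 : 4 * A.card + 6 * C.card ≤ (nextCells H S).card := by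
    rw [← card_biUnion_Ico_mul, ← card_biUnion_Ico_mul, ← Finset.card_union_of_disjoint
      (disjoint_biUnion_four_six hWS h (Finset.filter_subset _ _) (Finset.filter_subset _ _))]
    refine Finset.card_le_card (Finset.union_subset ?_ ?_)
    · exact (Finset.biUnion_subset_biUnion_of_subset_left _
        (Finset.filter_subset_filter _ hWS)).trans
        (Finset.subset_union_left.trans Finset.subset_union_left)
    · exact (Finset.biUnion_subset_biUnion_of_subset_left _
        (Finset.filter_subset_filter _ hWS)).trans Finset.subset_union_right
  have h4 : W.card ≤ A.card + B.card + C.card := by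
    refine (Finset.card_le_card (t := A ∪ B ∪ C) fun m hm => ?_).trans
      ((Finset.card_union_le _ _).trans (Nat.add_le_add_right (Finset.card_union_le _ _) _))
    simp only [Finset.mem_union, hA, hB, hC, Finset.mem_filter, hm, true_and]
    omega
  omega

/-- Three packings: fourfold blocks of W with sixfold blocks of W1, threefold blocks of W4 with
fourfold blocks of W3, and the same with fivefold blocks of W2. In the last two the triples end by
6H, where the other blocks begin. These two give W4 at most 9/47 of the cells, and then the first
gives 101/470. The factor 30 in H makes the thresholds 4H/3, 3H/2 and 6H/5 integers. -/
theorem card_le_card_multCells_of_avoidsTriples {h : ℕ} {S W : Finset ℕ}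
    (hS : S ⊆ Finset.Ico (30 * h) (2 * (30 * h))) (hWS : W ⊆ S) (hW : AvoidsTriples S W) :
    470 * W.card ≤ 101 * (multCells (30 * h) S).card := by
  set H := 30 * h with hH
  set W1 := W.filter fun m => 3 * m < 4 * H with hW1
  set W2 := W.filter fun m => 4 * H ≤ 3 * m ∧ 2 * m < 3 * H with hW2
  set W3 := W.filter fun m => 3 * H ≤ 2 * m with hW3
  set W4 := W.filter fun m => 4 * H ≤ 3 * m with hW4
  have hmem : ∀ k, ∀ X ⊆ W, (∀ m ∈ X, 4 * H ≤ k * m ∧ k * m + k ≤ 8 * H) →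
      (X.biUnion fun m => Finset.Ico (k * m) (k * m + k)) ⊆ multCells H S := by
    intro k X hX hk c hc
    obtain ⟨m, hm, hc⟩ := Finset.mem_biUnion.1 hc
    rw [Finset.mem_Ico] at hc
    have := hk m hm
    exact mem_multCells.2 ⟨by omega, m, hWS (hX hm), k, hc⟩
  have hr : ∀ m ∈ W, H ≤ m ∧ m < 2 * H := fun m hm => Finset.mem_Ico.1 (hS (hWS hm))
  have h1 : 4 * W.card + 6 * W1.card ≤ (multCells H S).card := by
    rw [← card_biUnion_Ico_mul, ← card_biUnion_Ico_mul, ← Finset.card_union_of_disjoint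
      (disjoint_biUnion_four_six hWS hW subset_rfl (Finset.filter_subset _ _))]
    refine Finset.card_le_card (Finset.union_subset ?_ ?_)
    · exact hmem 4 W subset_rfl fun m hm => by have := hr m hm; omega
    · refine hmem 6 W1 (Finset.filter_subset _ _) fun m hm => ?_
      have := Finset.mem_filter.1 hm
      have := hr m this.1
      omega
  have low : ∀ X : Finset ℕ, X ⊆ multCells H S → (∀ c ∈ X, 6 * H ≤ c) →
      3 * W4.card + X.card ≤ (multCells H S).card := by
    intro X hX hXc
    have hdis : Disjoint (W4.biUnion fun m => Finset.Ico (3 * m) (3 * m + 3)) X := by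
      rw [Finset.disjoint_left]
      intro c hc hcX
      obtain ⟨m, hm, hc⟩ := Finset.mem_biUnion.1 hc
      rw [Finset.mem_Ico] at hc
      have := hr m (Finset.mem_filter.1 hm).1
      have := hXc c hcX
      omega
    rw [← card_biUnion_Ico_mul, ← Finset.card_union_of_disjoint hdis]
    refine Finset.card_le_card (Finset.union_subset ?_ hX)
    refine hmem 3 W4 (Finset.filter_subset _ _) fun m hm => ?_
    have := Finset.mem_filter.1 hm
    have := hr m this.1
    omega
  have h2 : 3 * W4.card + 4 * W3.card ≤ (multCells H S).card := by
    rw [← card_biUnion_Ico_mul 4]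
    refine low _ (hmem 4 W3 (Finset.filter_subset _ _) fun m hm => ?_) fun c hc => ?_
    · have := hr m (Finset.mem_filter.1 hm).1
      omega
    · obtain ⟨m, hm, hc⟩ := Finset.mem_biUnion.1 hc
      have := (Finset.mem_filter.1 hm).2
      rw [Finset.mem_Ico] at hc
      omega
  have h3 : 3 * W4.card + 5 * W2.card ≤ (multCells H S).card := by
    rw [← card_biUnion_Ico_mul 5]
    refine low _ (hmem 5 W2 (Finset.filter_subset _ _) fun m hm => ?_) fun c hc => ?_
    · have := (Finset.mem_filter.1 hm).2
      omega
    · obtain ⟨m, hm, hc⟩ := Finset.mem_biUnion.1 hc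
      have := (Finset.mem_filter.1 hm).2
      rw [Finset.mem_Ico] at hc
      omega
  have h4 : W.card ≤ W1.card + W4.card := by
    refine (Finset.card_le_card (t := W1 ∪ W4) fun m hm => ?_).trans (Finset.card_union_le _ _)
    simp only [Finset.mem_union, hW1, hW4, Finset.mem_filter, hm, true_and]
    omega
  have h5 : W4.card ≤ W2.card + W3.card := by
    refine (Finset.card_le_card (t := W2 ∪ W3) fun m hm => ?_).trans (Finset.card_union_le _ _)
    have := Finset.mem_filter.1 hm
    simp only [Finset.mem_union, hW2, hW3, Finset.mem_filter, this, true_and]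
    omega
  omega

section layer
variable {h : ℕ} {S U V : Finset ℕ}

/-- With N the complement of V, the set U + N + {0, 1} avoids `multCells`; the summand {0, 1}
appears because sums of points of cells a and b fall in cells a + b and a + b + 1. Cauchy–Davenport
gives the first bound, and its modular form, with a cell m of S as modulus, the alternative. -/
theorem card_add_card_multCells_le {H : ℕ} (hU : U ⊆ Finset.Ico (2 * H) (4 * H))
    (hV : V ⊆ Finset.Ico (2 * H) (4 * H)) (hdis : Disjoint U V) (hne : U.Nonempty)
    (hUV : ∀ a ∈ U, ∀ b ∈ Finset.Ico (2 * H) (4 * H),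
      (a + b ∈ multCells H S ∨ a + b + 1 ∈ multCells H S) → b ∈ V) :
    U.card + (multCells H S).card ≤ 2 * H + V.card ∧
    ∀ m ∈ S, H ≤ m → m < 2 * H →
      2 * U.card + (multCells H S).card ≤ 2 * H + V.card ∨ U.card + 2 * H ≤ m + V.card := by
  classical
  set N := Finset.Ico (2 * H) (4 * H) \ V with hN
  have hUN : U ⊆ N := fun u hu => Finset.mem_sdiff.2 ⟨hU hu, Finset.disjoint_left.1 hdis hu⟩
  have hNc : N.card + V.card = 2 * H := by
    have := Finset.card_sdiff_add_card_eq_card hV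
    rw [Nat.card_Ico] at this
    rw [hN]
    omega
  have hsum : (U + N + {0, 1}).card + (multCells H S).card ≤ 4 * H := by
    have hd : Disjoint (U + N + {0, 1}) (multCells H S) := by
      rw [Finset.disjoint_left]
      intro x hx hxK
      obtain ⟨y, hy, i, hi, rfl⟩ := Finset.mem_add.1 hx
      obtain ⟨a, ha, b, hb, rfl⟩ := Finset.mem_add.1 hy
      rw [hN, Finset.mem_sdiff] at hb
      rcases (by simpa using hi : i = 0 ∨ i = 1) with rfl | rfl
      · exact hb.2 (hUV a ha b hb.1 (Or.inl hxK))
      · exact hb.2 (hUV a ha b hb.1 (Or.inr hxK))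
    rw [← Finset.card_union_of_disjoint hd]
    have hs : U + N + {0, 1} ∪ multCells H S ⊆ Finset.Ico (4 * H) (8 * H) := by
      refine Finset.union_subset (fun x hx => ?_) fun x hx => ?_
      · obtain ⟨y, hy, i, hi, rfl⟩ := Finset.mem_add.1 hx
        obtain ⟨a, ha, b, hb, rfl⟩ := Finset.mem_add.1 hy
        have h1 := Finset.mem_Ico.1 (hU ha)
        have h2 := Finset.mem_Ico.1 (Finset.mem_sdiff.1 hb).1
        have h3 : i = 0 ∨ i = 1 := by simpa using hi
        exact Finset.mem_Ico.2 (by omega)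
      · exact Finset.mem_Ico.2 (mem_multCells.1 hx).1
    have := Finset.card_le_card hs
    rw [Nat.card_Ico] at this
    omega
  refine ⟨?_, fun m hm hHm hm2 => ?_⟩
  · have := Nat.card_add_card_le_card_add_add_pair hne (hne.mono hUN)
    omega
  have hnd : ∀ u ∈ U, ∀ v ∈ N, ∀ i, i = 0 ∨ i = 1 → ¬ m ∣ u + v + i := by
    intro u hu v hv i hi ⟨k, hk⟩
    rw [hN, Finset.mem_sdiff] at hv
    have h1 := Finset.mem_Ico.1 (hU hu)
    have h2 := Finset.mem_Ico.1 hv.1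
    have hk0 : 0 < k := by
      rcases Nat.eq_zero_or_pos k with rfl | h
      · omega
      · exact h
    have : u + v + i ∈ multCells H S :=
      mem_multCells.2 ⟨by omega, m, hm, k, by rw [hk, mul_comm], by rw [hk, mul_comm m]; omega⟩
    rcases hi with rfl | rfl
    · exact hv.2 (hUV u hu v hv.1 (Or.inl this))
    · exact hv.2 (hUV u hu v hv.1 (Or.inr this))
  have hNsub : N ⊆ Finset.Ico (2 * H) (2 * H + 2 * m) := fun x hx => by
    have := Finset.mem_Ico.1 (Finset.mem_sdiff.1 hx).1
    exact Finset.mem_Ico.2 (by omega)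
  have := card_add_card_le_or_of_not_dvd (by omega) hne hUN hNsub
    (fun u hu v hv => hnd u hu v hv 0 (Or.inl rfl)) (fun u hu v hv => hnd u hu v hv 1 (Or.inr rfl))
  omega

/-- Let p be the greatest end of a block of S that ends by 6H. Elements of U below p − 2H reflect in
p − 1 into V. For the other u, every c in `nextCells` has c − u and c − u − 1 in [2H, 4H), so V
contains a translate of a sumset to which Cauchy–Davenport applies. The three conclusions correspond
to which of the two parts of U is empty. -/
theorem card_le_or_add_card_nextCells_le (hS : S ⊆ Finset.Ico (30 * h) (2 * (30 * h)))
    (hSne : S.Nonempty)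
    (hU : U ⊆ Finset.Ico (2 * (30 * h)) (4 * (30 * h)))
    (hUV : ∀ a ∈ U, ∀ b ∈ Finset.Ico (2 * (30 * h)) (4 * (30 * h)),
      (a + b ∈ multCells (30 * h) S ∨ a + b + 1 ∈ multCells (30 * h) S) → b ∈ V) :
    U.card ≤ V.card ∨ U.card + (nextCells (30 * h) S).card ≤ V.card ∨
      U.card + (nextCells (30 * h) S).card ≤ 2 * V.card := by
  classical
  set H := 30 * h with hH
  -- The largest factor whose block ends by 6H; `nextCells` uses the factor one larger.
  set k : ℕ → ℕ := fun m => if 3 * H ≤ 2 * m then 3 else if 6 * H ≤ 5 * m then 4 else 5 with hk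
  have hkm : ∀ m ∈ S, 4 * H ≤ k m * m ∧ k m * m + k m ≤ 6 * H ∧ k m ≤ 5 ∧ 1 ≤ k m := by
    intro m hm
    have := Finset.mem_Ico.1 (hS hm)
    simp only [hk]
    split_ifs <;> omega
  obtain ⟨m₀, hm₀, hmax⟩ := Finset.exists_max_image S (fun m => k m * m + k m) hSne
  set p := k m₀ * m₀ + k m₀ with hp
  have hp0 := hkm m₀ hm₀
  have hpK : p - 1 ∈ multCells H S :=
    mem_multCells.2 ⟨by have := Finset.mem_Ico.1 (hS hm₀); omega, m₀, hm₀, k m₀, by omega, by omega⟩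
  have hnext : ∀ c ∈ nextCells H S, c ∈ multCells H S ∧ 6 * H ≤ c ∧ c < p + 2 * H := by
    intro c hc
    have gen : ∀ m ∈ S, ∀ j, j = k m + 1 → 6 * H ≤ j * m → j * m + j ≤ 8 * H →
        c ∈ Finset.Ico (j * m) (j * m + j) →
        c ∈ multCells H S ∧ 6 * H ≤ c ∧ c < p + 2 * H := by
      intro m hm j hj h6 h8 hc
      rw [Finset.mem_Ico] at hc
      have hmx := hmax m hm
      have hr := Finset.mem_Ico.1 (hS hm)
      refine ⟨mem_multCells.2 ⟨by omega, m, hm, j, hc⟩, by omega, ?_⟩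
      subst hj
      rw [add_mul, one_mul] at hc
      omega
    simp only [nextCells, Finset.mem_union, Finset.mem_biUnion, Finset.mem_filter] at hc
    rcases hc with (⟨m, ⟨hm, h1⟩, hc⟩ | ⟨m, ⟨hm, h1⟩, hc⟩) | ⟨m, ⟨hm, h1⟩, hc⟩
    · have hr := Finset.mem_Ico.1 (hS hm)
      exact gen m hm 4 (by simp [hk, h1]) (by omega) (by omega) hc
    · have hr := Finset.mem_Ico.1 (hS hm)
      exact gen m hm 5 (by simp only [hk]; split_ifs <;> omega) (by omega) (by omega) hc
    · have hr := Finset.mem_Ico.1 (hS hm)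
      exact gen m hm 6 (by simp only [hk]; split_ifs <;> omega) (by omega) (by omega) hc
  set Ul := U.filter fun u => u + 2 * H < p with hUl
  set Ur := U.filter fun u => ¬ u + 2 * H < p with hUr
  have hsplit : Ul.card + Ur.card = U.card := Finset.card_filter_add_card_filter_not _
  have hl : Ul.card ≤ V.card := by
    refine Finset.card_le_card_of_injOn (fun u => p - 1 - u) (fun u hu => ?_)
      fun a ha b hb hab => ?_
    · obtain ⟨hu1, hu2⟩ := Finset.mem_filter.1 (Finset.mem_coe.1 hu)
      have := Finset.mem_Ico.1 (hU hu1)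
      refine hUV u hu1 (p - 1 - u) (Finset.mem_Ico.2 (by omega)) (Or.inl ?_)
      rwa [Nat.add_sub_cancel' (by omega)]
    · have h1 := Finset.mem_filter.1 (Finset.mem_coe.1 ha)
      have h2 := Finset.mem_filter.1 (Finset.mem_coe.1 hb)
      have hab : p - 1 - a = p - 1 - b := hab
      omega
  rcases Ur.eq_empty_or_nonempty with he | hne
  · left; rw [he, Finset.card_empty] at hsplit; omega
  right
  have hRne : (nextCells H S).Nonempty := by
    have := sixty_mul_card_le_card_nextCells (H := H) (S := S)
    have h2 := hSne.card_pos
    exact Finset.card_pos.1 (by omega)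
  have hr : Ur.card + (nextCells H S).card ≤ V.card := by
    set X := Ur.image (fun u => 4 * H - 1 - u) with hX
    have hXc : X.card = Ur.card := Finset.card_image_of_injOn fun a ha b hb hab => by
      have h1 := Finset.mem_Ico.1 (hU (Finset.mem_filter.1 (Finset.mem_coe.1 ha)).1)
      have h2 := Finset.mem_Ico.1 (hU (Finset.mem_filter.1 (Finset.mem_coe.1 hb)).1)
      have hab : 4 * H - 1 - a = 4 * H - 1 - b := hab
      omega
    have h1 := Nat.card_add_card_le_card_add_add_pair (hne.image (fun u => 4 * H - 1 - u)) hRne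
    rw [← hX, hXc] at h1
    refine h1.trans (Finset.card_le_card_of_injOn (fun x => x - 4 * H) (fun x hx => ?_)
      fun a ha b hb hab => ?_)
    · obtain ⟨y, hy, i, hi, rfl⟩ := Finset.mem_add.1 (Finset.mem_coe.1 hx)
      obtain ⟨a, ha, c, hc, rfl⟩ := Finset.mem_add.1 hy
      obtain ⟨u, hu, rfl⟩ := Finset.mem_image.1 ha
      have hu1 := Finset.mem_filter.1 hu
      have h2 := Finset.mem_Ico.1 (hU hu1.1)
      have h3 := hnext c hc
      have h4 : i = 0 ∨ i = 1 := by simpa using hi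
      refine hUV u hu1.1 (4 * H - 1 - u + c + i - 4 * H) (Finset.mem_Ico.2 (by omega)) ?_
      rcases h4 with rfl | rfl
      · right
        have : u + (4 * H - 1 - u + c + 0 - 4 * H) + 1 = c := by omega
        rw [this]; exact h3.1
      · left
        have : u + (4 * H - 1 - u + c + 1 - 4 * H) = c := by omega
        rw [this]; exact h3.1
    · obtain ⟨y, hy, i, hi, rfl⟩ := Finset.mem_add.1 (Finset.mem_coe.1 ha)
      obtain ⟨a, ha, c, hc, rfl⟩ := Finset.mem_add.1 hy
      obtain ⟨y', hy', i', hi', rfl⟩ := Finset.mem_add.1 (Finset.mem_coe.1 hb)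
      obtain ⟨a', ha', c', hc', rfl⟩ := Finset.mem_add.1 hy'
      have h3 := hnext c hc
      have h3' := hnext c' hc'
      simp only at hab
      omega
  rcases Ul.eq_empty_or_nonempty with he | hne'
  · left; rw [he, Finset.card_empty] at hsplit; omega
  · right; omega

end layer
end

/-! ### Layer-cake sums and the global inequality -/

theorem Int.sum_Icc_ite_le (x : ℤ) (T : ℕ) :
    ∑ j ∈ Finset.Icc 1 T, (if (j : ℤ) ≤ x then (1 : ℤ) else 0) = max 0 (min x T) := by
  induction T with
  | zero => simp
  | succ T ih =>
    rw [Finset.sum_Icc_succ_top (by omega), ih]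
    push_cast
    split_ifs <;> omega

theorem Int.eq_sum_Icc_ite_sub {x : ℤ} {T : ℕ} (h1 : -T ≤ x) (h2 : x ≤ T) :
    x = ∑ j ∈ Finset.Icc 1 T, ((if (j : ℤ) ≤ x then (1 : ℤ) else 0) -
      if (j : ℤ) ≤ -x then 1 else 0) := by
  rw [Finset.sum_sub_distrib, Int.sum_Icc_ite_le, Int.sum_Icc_ite_le]
  omega

/-- The cells of `[2H, 4H)` whose half lies in a set of places given by a predicate. -/
def cellsOver (H : ℕ) (p : ℕ → Prop) [DecidablePred p] : Finset ℕ :=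
  (Finset.Ico (2 * H) (4 * H)).filter fun a => p (a / 2)

theorem card_cellsOver (H : ℕ) (p : ℕ → Prop) [DecidablePred p] :
    (cellsOver H p).card = 2 * ((Finset.Ico H (2 * H)).filter p).card := by
  rw [← card_biUnion_Ico_mul]
  congr 1
  ext a
  simp only [cellsOver, Finset.mem_filter, Finset.mem_Ico, Finset.mem_biUnion]
  constructor
  · rintro ⟨h1, h2⟩
    exact ⟨a / 2, ⟨by omega, h2⟩, by omega⟩
  · rintro ⟨m, ⟨h1, h2⟩, h3⟩
    have : a / 2 = m := by omega
    exact ⟨by omega, this ▸ h2⟩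

/-- The data of the discretised problem: heights `f` of the cells and `e` of the cells of
multipliers, in units of `1 / (2T)`. -/
structure CellData (h t : ℕ) (S W : Finset ℕ) (f e : ℕ → ℤ) : Prop where
  subset : S ⊆ Finset.Ico (30 * h) (2 * (30 * h))
  sub : W ⊆ S
  nonneg : ∀ m, 0 ≤ f m
  le : ∀ m, f m ≤ 6 * t
  add_le : ∀ a ∈ Finset.Ico (2 * (30 * h)) (4 * (30 * h)),
    ∀ b ∈ Finset.Ico (2 * (30 * h)) (4 * (30 * h)),
    (a + b ∈ multCells (30 * h) S ∨ a + b + 1 ∈ multCells (30 * h) S) →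
      f (a / 2) + f (b / 2) ≤ 6 * t
  add_mult_le : ∀ m ∈ S, f m + e m ≤ 6 * t
  two_mul_add_le : ∀ m ∈ S, 2 * f m + e m ≤ 8 * t
  gain : ∀ m ∈ S, m ∉ W → 2000 * (2 * f m + e m) ≤ 15997 * t
  le_of_not_mem : ∀ m ∈ S, m ∉ W → e m ≤ 4 * t
  avoids : AvoidsTriples S W

namespace CellData
variable {h t : ℕ} {S W : Finset ℕ} {f e : ℕ → ℤ}

/-- Number of cells of height at least `T + j`. -/
def upper (h t : ℕ) (f : ℕ → ℤ) (j : ℕ) : Finset ℕ :=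
  cellsOver (30 * h) fun m => (j : ℤ) ≤ f m - 3 * t

/-- Number of cells of height at most `T - j`. -/
def lower (h t : ℕ) (f : ℕ → ℤ) (j : ℕ) : Finset ℕ :=
  cellsOver (30 * h) fun m => (j : ℤ) ≤ -(f m - 3 * t)

/-- Multiplier cells of height at least `T + j`. -/
def high (t : ℕ) (S : Finset ℕ) (e : ℕ → ℤ) (j : ℕ) : Finset ℕ :=
  S.filter fun m => (j : ℤ) ≤ e m - 3 * t

/-- Layer-cake formula around the height 3t. The factor 2 is there because a place counts as two
cells of [2H, 4H). -/
theorem two_mul_sum_eq (d : CellData h t S W f e) :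
    2 * ∑ m ∈ Finset.Ico (30 * h) (2 * (30 * h)), (f m - 3 * t) =
      ∑ j ∈ Finset.Icc 1 (3 * t), (((upper h t f j).card : ℤ) - (lower h t f j).card) := by
  have : ∀ m, f m - 3 * t = ∑ j ∈ Finset.Icc 1 (3 * t),
      ((if (j : ℤ) ≤ f m - 3 * t then (1 : ℤ) else 0) -
      if (j : ℤ) ≤ -(f m - 3 * t) then 1 else 0) := fun m => by
    have h1 := d.nonneg m
    have h2 := d.le m
    exact Int.eq_sum_Icc_ite_sub (by push_cast; omega) (by push_cast; omega)
  rw [Finset.sum_congr rfl fun m _ => this m, Finset.sum_comm, Finset.mul_sum]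
  refine Finset.sum_congr rfl fun j _ => ?_
  rw [upper, lower, card_cellsOver, card_cellsOver, Finset.sum_sub_distrib]
  simp only [Finset.sum_boole]
  push_cast
  ring

/-- By f + e ≤ 6t, a high e sits above a low f, and each place again gives two cells. -/
theorem two_mul_card_high_le (d : CellData h t S W f e) (j : ℕ) :
    2 * (high t S e j).card ≤ (lower h t f j).card := by
  rw [lower, card_cellsOver]
  refine Nat.mul_le_mul_left 2 (Finset.card_le_card fun m hm => ?_)
  obtain ⟨h1, h2⟩ := Finset.mem_filter.1 hm
  have := d.add_mult_le m h1
  exact Finset.mem_filter.2 ⟨d.subset h1, by omega⟩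

theorem sum_mult_le (d : CellData h t S W f e) :
    ∑ m ∈ S, e m ≤ 3 * t * S.card + ∑ j ∈ Finset.Icc 1 (3 * t), ((high t S e j).card : ℤ) := by
  have h1 : ∀ j, ((high t S e j).card : ℤ) = ∑ m ∈ S, if (j : ℤ) ≤ e m - 3 * t then 1 else 0 := by
    intro j
    rw [high, Finset.sum_boole]
  rw [Finset.sum_congr rfl fun j _ => h1 j, Finset.sum_comm]
  have h2 : (3 * t * S.card : ℤ) = ∑ m ∈ S, (3 * t : ℤ) := by
    rw [Finset.sum_const, nsmul_eq_mul, mul_comm]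
  rw [h2, ← Finset.sum_add_distrib]
  refine Finset.sum_le_sum fun m hm => ?_
  rw [Int.sum_Icc_ite_le]
  have h3 := d.add_mult_le m hm
  have h4 := d.nonneg m
  push_cast
  omega

theorem disjoint_upper_lower {j : ℕ} (hj : 0 < j) :
    Disjoint (upper h t f j) (lower h t f j) := by
  rw [Finset.disjoint_left]
  intro a h1 h2
  have h1 := (Finset.mem_filter.1 h1).2
  have h2 := (Finset.mem_filter.1 h2).2
  omega

theorem mem_lower (d : CellData h t S W f e) (j : ℕ) :
    ∀ a ∈ upper h t f j, ∀ b ∈ Finset.Ico (2 * (30 * h)) (4 * (30 * h)),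
      (a + b ∈ multCells (30 * h) S ∨ a + b + 1 ∈ multCells (30 * h) S) → b ∈ lower h t f j := by
  intro a ha b hb hab
  obtain ⟨ha1, ha2⟩ := Finset.mem_filter.1 ha
  have := d.add_le a ha1 b hb hab
  exact Finset.mem_filter.2 ⟨hb, by omega⟩

/-- The possible shapes of a layer. -/
theorem layer (d : CellData h t S W f e) (hS : S.Nonempty) {j : ℕ} (hj : 0 < j) :
    (upper h t f j).card = 0 ∨
    ((upper h t f j).card + (multCells (30 * h) S).card ≤ 2 * (30 * h) + (lower h t f j).card ∧
      ((upper h t f j).card + S.card ≤ (lower h t f j).card ∨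
       2 * (upper h t f j).card + (multCells (30 * h) S).card ≤
          2 * (30 * h) + (lower h t f j).card ∧
        ((upper h t f j).card ≤ (lower h t f j).card ∨
         (upper h t f j).card + (nextCells (30 * h) S).card ≤ (lower h t f j).card ∨
         (upper h t f j).card + (nextCells (30 * h) S).card ≤ 2 * (lower h t f j).card))) := by
  rcases (upper h t f j).eq_empty_or_nonempty with he | hne
  · left; rw [he, Finset.card_empty]
  right
  have h1 := card_add_card_multCells_le (H := 30 * h) (U := upper h t f j)
    (V := lower h t f j) (Finset.filter_subset _ _)
    (Finset.filter_subset _ _) (disjoint_upper_lower hj) hne (d.mem_lower j)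
  have h2 := card_le_or_add_card_nextCells_le (U := upper h t f j)
    (V := lower h t f j) d.subset hS (Finset.filter_subset _ _)
    (d.mem_lower j)
  refine ⟨h1.1, ?_⟩
  obtain ⟨m, hm⟩ := hS
  set m₀ := S.min' ⟨m, hm⟩
  have hm₀ : m₀ ∈ S := S.min'_mem _
  have hr := Finset.mem_Ico.1 (d.subset hm₀)
  have hsub : S ⊆ Finset.Ico m₀ (2 * (30 * h)) := fun x hx =>
    Finset.mem_Ico.2 ⟨S.min'_le x hx, (Finset.mem_Ico.1 (d.subset hx)).2⟩
  have hc := Finset.card_le_card hsub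
  rw [Nat.card_Ico] at hc
  have := h1.2 m₀ hm₀ hr.1 hr.2
  omega

/-- Outside W the excess e − 3t is at most t; this is why layers below and above t are estimated
differently. -/
theorem high_subset (d : CellData h t S W f e) {j : ℕ} (hj : t < j) : high t S e j ⊆ W := by
  intro m hm
  obtain ⟨h1, h2⟩ := Finset.mem_filter.1 hm
  by_contra hW
  have := d.le_of_not_mem m h1 hW
  omega

theorem card_le (d : CellData h t S W f e) : S.card ≤ 30 * h := by
  have := Finset.card_le_card d.subset
  rw [Nat.card_Ico] at this
  omega

theorem card_high_le (j : ℕ) : (high t S e j).card ≤ S.card :=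
  Finset.card_le_card (Finset.filter_subset _ _)

/-- Total excess over the trivial height. -/
def excess (h t : ℕ) (S : Finset ℕ) (f e : ℕ → ℤ) : ℤ :=
  2 * ∑ m ∈ Finset.Ico (30 * h) (2 * (30 * h)), (f m - 3 * t) + ∑ m ∈ S, e m

theorem excess_le_sum (d : CellData h t S W f e) :
    excess h t S f e ≤ 3 * t * S.card + ∑ j ∈ Finset.Icc 1 (3 * t),
      (((upper h t f j).card : ℤ) - (lower h t f j).card + (high t S e j).card) := by
  rw [Finset.sum_add_distrib, ← d.two_mul_sum_eq, excess]
  have := d.sum_mult_le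
  linarith

theorem sum_Icc_le {g : ℕ → ℤ} {t : ℕ} {a b : ℤ} (h1 : ∀ j ∈ Finset.Icc 1 t, g j ≤ a)
    (h2 : ∀ j ∈ Finset.Icc (t + 1) (3 * t), g j ≤ b) :
    ∑ j ∈ Finset.Icc 1 (3 * t), g j ≤ t * a + 2 * t * b := by
  have hs : ∑ j ∈ Finset.Icc 1 (3 * t), g j =
      ∑ j ∈ Finset.Icc 1 t, g j + ∑ j ∈ Finset.Icc (t + 1) (3 * t), g j := by
    rw [← Finset.sum_union]
    · congr 1
      ext j
      simp only [Finset.mem_union, Finset.mem_Icc]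
      omega
    · rw [Finset.disjoint_left]
      intro j hj hj'
      rw [Finset.mem_Icc] at hj hj'
      omega
  have ha := Finset.sum_le_card_nsmul _ _ _ h1
  have hb := Finset.sum_le_card_nsmul _ _ _ h2
  rw [Nat.card_Icc, nsmul_eq_mul] at ha hb
  have e1 : ((t + 1 - 1 : ℕ) : ℤ) = t := by push_cast [Nat.add_sub_cancel]; rfl
  have e2 : ((3 * t + 1 - (t + 1) : ℕ) : ℤ) = 2 * t := by omega
  rw [e1] at ha
  rw [e2] at hb
  rw [hs]
  linarith

/-- Few multiplier cells. -/
theorem excess_le_of_card_le (d : CellData h t S W f e) (hlow : 30 * h ≤ 50 * S.card)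
    (hup : 1000 * S.card ≤ 336 * (30 * h)) (hS : S.Nonempty) :
    5000 * excess h t S f e ≤ 5000 * (2 * t * (30 * h)) - 109 * t * S.card := by
  have hK := four_mul_card_le_card_multCells d.subset
  have hR := sixty_mul_card_le_card_nextCells (H := 30 * h) (S := S)
  -- Write U, V, K, R for the sizes of the high cells, the low cells, `multCells` and `nextCells`.
  -- The decisive shape has 2U + K ≤ 2H + V and U + R ≤ 2V, so U − V ≤ (2H − K − R)/3. With K ≥ 4|S|
  -- and R ≥ 60|S|/37 this is at most 2H/3 − 1.8738|S|, and the multiplier cells add at most |S|.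
  have h1 : ∀ j ∈ Finset.Icc 1 t, 5000 * (((upper h t f j).card : ℤ) - (lower h t f j).card +
      (high t S e j).card) ≤ 100000 * h - 4369 * S.card := by
    intro j hj
    rw [Finset.mem_Icc] at hj
    have a1 := d.layer hS hj.1
    have a2 := d.two_mul_card_high_le j
    have a3 := card_high_le (t := t) (S := S) (e := e) j
    omega
  -- Above t the high multiplier cells lie in W, and the stronger bounds for W apply. Weighted with
  -- t and 2t the two estimates give 2tH − 3.0218 t|S|, against the term 3t|S| in `excess_le_sum`.
  have h2 : ∀ j ∈ Finset.Icc (t + 1) (3 * t), 5000 * (((upper h t f j).card : ℤ) -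
      (lower h t f j).card + (high t S e j).card) ≤ 100000 * h - 5370 * S.card := by
    intro j hj
    rw [Finset.mem_Icc] at hj
    have a1 := d.layer hS (j := j) (by omega)
    have a2 := d.two_mul_card_high_le j
    have a3 := card_high_le (t := t) (S := S) (e := e) j
    have hsub := d.high_subset (j := j) (by omega)
    have hav : AvoidsTriples S (high t S e j) := fun m hm => d.avoids m (hsub hm)
    have a4 := twenty_mul_card_le_card_nextCells (H := 30 * h) (hsub.trans d.sub) hav
    have a5 := card_le_card_multCells_of_avoidsTriples d.subset (hsub.trans d.sub) hav
    omega
  have h3 := sum_Icc_le h1 h2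
  rw [← Finset.mul_sum] at h3
  have h4 := d.excess_le_sum
  nlinarith

/-- A middling number of multiplier cells. -/
theorem excess_le_of_le_card (d : CellData h t S W f e) (hS : S.Nonempty) :
    excess h t S f e ≤ 3 * t * max (30 * (h : ℤ) - S.card) S.card := by
  have hK := four_mul_card_le_card_multCells d.subset
  -- Half of 2U + K ≤ 2H + V, using K ≥ 4|S| and that V is at least twice the number of high
  -- multiplier cells.
  have h1 : ∀ j ∈ Finset.Icc 1 (3 * t), (((upper h t f j).card : ℤ) - (lower h t f j).card +
      (high t S e j).card) ≤ max (30 * (h : ℤ) - 2 * S.card) 0 := by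
    intro j hj
    rw [Finset.mem_Icc] at hj
    have a1 := d.layer hS hj.1
    have a2 := d.two_mul_card_high_le j
    have a3 := card_high_le (t := t) (S := S) (e := e) j
    omega
  have h2 := Finset.sum_le_card_nsmul _ _ _ h1
  rw [Nat.card_Icc, nsmul_eq_mul, Nat.add_sub_cancel] at h2
  have h4 := d.excess_le_sum
  have h5 : max (30 * (h : ℤ) - S.card) S.card = S.card + max (30 * (h : ℤ) - 2 * S.card) 0 := by omega
  rw [h5]
  push_cast at h2
  linarith

theorem upper_eq_empty {j₀ j : ℕ} (h0 : (upper h t f (j₀ + 1)).card = 0) (hj : j₀ < j) :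
    (upper h t f j).card = 0 := by
  rw [Finset.card_eq_zero] at h0 ⊢
  refine Finset.subset_empty.1 (h0 ▸ fun a ha => ?_)
  obtain ⟨h1, h2⟩ := Finset.mem_filter.1 ha
  exact Finset.mem_filter.2 ⟨h1, by push_cast; omega⟩

/-- Layer-cake for the low cells beyond layer j₀, keeping only the places of S. -/
theorem sum_Ioc_card_lower_ge (d : CellData h t S W f e) {j₀ : ℕ} (hj : j₀ ≤ 3 * t) :
    2 * ∑ m ∈ S, max 0 (3 * t - f m - j₀) ≤
      ∑ j ∈ Finset.Icc 1 (3 * t - j₀), ((lower h t f (j₀ + j)).card : ℤ) := by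
  have h1 : ∀ m ∈ S, max 0 (3 * t - f m - j₀) = ∑ j ∈ Finset.Icc 1 (3 * t - j₀),
      if (j : ℤ) ≤ 3 * t - f m - j₀ then (1 : ℤ) else 0 := by
    intro m _
    have := d.nonneg m
    rw [Int.sum_Icc_ite_le]
    omega
  rw [Finset.sum_congr rfl h1, Finset.sum_comm, Finset.mul_sum]
  refine Finset.sum_le_sum fun j _ => ?_
  rw [lower, card_cellsOver, Finset.sum_boole]
  have : (S.filter fun m => (j : ℤ) ≤ 3 * t - f m - j₀).card ≤
      ((Finset.Ico (30 * h) (2 * (30 * h))).filter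
        fun m => ((j₀ + j : ℕ) : ℤ) ≤ -(f m - 3 * t)).card := by
    refine Finset.card_le_card fun m hm => ?_
    obtain ⟨h1, h2⟩ := Finset.mem_filter.1 hm
    exact Finset.mem_filter.2 ⟨d.subset h1, by push_cast; omega⟩
  push_cast
  have : ((S.filter fun m => (j : ℤ) ≤ 3 * t - f m - j₀).card : ℤ) ≤
      ((Finset.Ico (30 * h) (2 * (30 * h))).filter
        fun m => ((j₀ + j : ℕ) : ℤ) ≤ -(f m - 3 * t)).card := by exact_mod_cast this
  push_cast at this
  linarith

/-- Take for j₀ the last layer with a high cell; layers are nested. Up to j₀ each layer contributes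
at most 2H − K, beyond it only the low cells remain, with negative sign. -/
theorem exists_excess_le (d : CellData h t S W f e) (hS : S.Nonempty) :
    ∃ j₀ : ℕ, j₀ ≤ 3 * t ∧ excess h t S f e ≤ j₀ * (2 * (30 * h) - (multCells (30 * h) S).card) +
      ∑ m ∈ S, (e m - 2 * max 0 (3 * t - f m - j₀)) := by
  have hex : ∃ j, j ≤ 3 * t ∧ (upper h t f (j + 1)).card = 0 := by
    refine ⟨3 * t, le_rfl, Finset.card_eq_zero.2 (Finset.eq_empty_of_forall_notMem fun a ha => ?_)⟩
    have h2 := (Finset.mem_filter.1 ha).2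
    have := d.le (a / 2)
    push_cast at h2
    omega
  set j₀ := Nat.find hex with hj₀
  obtain ⟨hj, h0⟩ := Nat.find_spec hex
  rw [← hj₀] at hj h0
  refine ⟨j₀, hj, ?_⟩
  have hne : ∀ j ∈ Finset.Icc 1 j₀, ((upper h t f j).card : ℤ) - (lower h t f j).card ≤
      2 * (30 * h) - (multCells (30 * h) S).card := by
    intro j hjm
    rw [Finset.mem_Icc] at hjm
    have h1 : (upper h t f j).card ≠ 0 := by
      intro hc
      have := Nat.find_min hex (m := j - 1) (by omega)
      exact this ⟨by omega, by rwa [Nat.sub_add_cancel hjm.1]⟩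
    have := d.layer hS hjm.1
    omega
  have hsplit : ∑ j ∈ Finset.Icc 1 (3 * t), (((upper h t f j).card : ℤ) - (lower h t f j).card) =
      ∑ j ∈ Finset.Icc 1 j₀, (((upper h t f j).card : ℤ) - (lower h t f j).card) +
      ∑ j ∈ Finset.Icc 1 (3 * t - j₀),
        (((upper h t f (j₀ + j)).card : ℤ) - (lower h t f (j₀ + j)).card) := by
    have him : Finset.Icc (j₀ + 1) (3 * t) = (Finset.Icc 1 (3 * t - j₀)).image (fun j => j₀ + j) := by
      ext x
      simp only [Finset.mem_Icc, Finset.mem_image]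
      exact ⟨fun hx => ⟨x - j₀, by omega, by omega⟩, fun ⟨y, hy, hxy⟩ => by omega⟩
    rw [← Finset.sum_image (f := fun j => ((upper h t f j).card : ℤ) - (lower h t f j).card)
      (g := fun j => j₀ + j) (fun a _ b _ hab => by simpa using hab), ← him, ← Finset.sum_union]
    · congr 1
      ext j
      simp only [Finset.mem_union, Finset.mem_Icc]
      omega
    · rw [Finset.disjoint_left]
      intro j hj hj'
      rw [Finset.mem_Icc] at hj hj'
      omega
  have hA := Finset.sum_le_card_nsmul _ _ _ hne
  rw [Nat.card_Icc, nsmul_eq_mul, Nat.add_sub_cancel] at hA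
  have hB : ∑ j ∈ Finset.Icc 1 (3 * t - j₀),
        (((upper h t f (j₀ + j)).card : ℤ) - (lower h t f (j₀ + j)).card) =
      - ∑ j ∈ Finset.Icc 1 (3 * t - j₀), ((lower h t f (j₀ + j)).card : ℤ) := by
    rw [← Finset.sum_neg_distrib]
    refine Finset.sum_congr rfl fun j hjm => ?_
    rw [Finset.mem_Icc] at hjm
    rw [upper_eq_empty (j := j₀ + j) h0 (by omega)]
    simp
  have hC := d.sum_Ioc_card_lower_ge hj
  have hD : ∑ m ∈ S, (e m - 2 * max 0 (3 * t - f m - j₀)) =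
      ∑ m ∈ S, e m - 2 * ∑ m ∈ S, max 0 (3 * t - f m - j₀) := by
    rw [Finset.sum_sub_distrib, Finset.mul_sum]
  rw [excess, d.two_mul_sum_eq, hsplit, hB, hD]
  linarith

/-- The bound 2t + 2j₀ comes from 2f + e ≤ 8t, and 3t + j₀ from f + e ≤ 6t. Off W the first improves
by 3t/2000; averaging it with e ≤ 4t improves the second by half as much, whence 3t/4000. -/
theorem sum_reduced_le (d : CellData h t S W f e) (j₀ : ℕ) :
    4000 * ∑ m ∈ S, (e m - 2 * max 0 (3 * t - f m - j₀)) ≤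
      S.card * (4000 * min (2 * t + 2 * j₀ : ℤ) (3 * t + j₀)) - 3 * t * ((S.card : ℤ) - W.card) := by
  have hW : ((S.card : ℤ) - W.card) = ∑ m ∈ S, if m ∈ W then (0 : ℤ) else 1 := by
    have : S.card = (S \ W).card + W.card := (Finset.card_sdiff_add_card_eq_card d.sub).symm
    rw [this]
    push_cast
    rw [add_sub_cancel_right, ← Finset.sum_filter_add_sum_filter_not S (· ∈ W)]
    rw [Finset.sum_congr rfl (g := fun _ => (0 : ℤ))
      (fun m hm => if_pos (Finset.mem_filter.1 hm).2), Finset.sum_const_zero, zero_add,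
      Finset.sum_congr rfl (g := fun _ => (1 : ℤ))
      (fun m hm => if_neg (Finset.mem_filter.1 hm).2), Finset.sum_const, nsmul_eq_mul, mul_one]
    congr 2
    ext m
    simp
  have hc : (S.card * (4000 * min (2 * t + 2 * j₀ : ℤ) (3 * t + j₀))) =
      ∑ m ∈ S, (4000 * min (2 * t + 2 * j₀ : ℤ) (3 * t + j₀)) := by
    rw [Finset.sum_const, nsmul_eq_mul]
  rw [hW, hc, Finset.mul_sum, Finset.mul_sum, ← Finset.sum_sub_distrib]
  refine Finset.sum_le_sum fun m hm => ?_
  have h1 := d.add_mult_le m hm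
  have h2 := d.two_mul_add_le m hm
  by_cases hmW : m ∈ W
  · rw [if_pos hmW]
    omega
  · have h3 := d.gain m hm hmW
    have h4 := d.le_of_not_mem m hm hmW
    rw [if_neg hmW]
    omega

theorem card_multCells_le {H : ℕ} : (multCells H S).card ≤ 4 * H := by
  have : multCells H S ⊆ Finset.Ico (4 * H) (8 * H) :=
    fun c hc => Finset.mem_Ico.2 (mem_multCells.1 hc).1
  have := Finset.card_le_card this
  rw [Nat.card_Ico] at this
  omega

/-- Many multiplier cells. -/
theorem excess_le_of_large_card (d : CellData h t S W f e) (hS : S.Nonempty)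
    (hlarge : (2 / 3 - 1 / 200000 : ℝ) * (30 * h) ≤ S.card) :
    (excess h t S f e : ℝ) ≤ (2 / 3 - 1 / 200000) * (3 * t) * (30 * h) := by
  obtain ⟨j₀, hj, hex⟩ := d.exists_excess_le hS
  have hred := d.sum_reduced_le j₀
  have hK := four_mul_card_le_card_multCells d.subset
  have hKW := card_le_card_multCells_of_avoidsTriples d.subset d.sub d.avoids
  have hKH := card_multCells_le (H := 30 * h) (S := S)
  have hSH := d.card_le
  have hWS := Finset.card_le_card d.sub
  have hex' : (excess h t S f e : ℝ) ≤ j₀ * (2 * (30 * h) - (multCells (30 * h) S).card) +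
      ((∑ m ∈ S, (e m - 2 * max 0 (3 * t - f m - j₀)) : ℤ) : ℝ) := by exact_mod_cast hex
  have hred' : 4000 * ((∑ m ∈ S, (e m - 2 * max 0 (3 * t - f m - j₀)) : ℤ) : ℝ) ≤
      S.card * (4000 * min (2 * t + 2 * j₀ : ℝ) (3 * t + j₀)) - 3 * t * ((S.card : ℝ) - W.card) := by
    exact_mod_cast hred
  have hmin1 := min_le_left (2 * t + 2 * j₀ : ℝ) (3 * t + j₀)
  have hmin2 := min_le_right (2 * t + 2 * j₀ : ℝ) (3 * t + j₀)
  have hj' : (j₀ : ℝ) ≤ 3 * t := by exact_mod_cast hj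
  have hK' : (4 : ℝ) * S.card ≤ (multCells (30 * h) S).card := by exact_mod_cast hK
  have hKW' : (470 : ℝ) * W.card ≤ 101 * (multCells (30 * h) S).card := by exact_mod_cast hKW
  have hKH' : ((multCells (30 * h) S).card : ℝ) ≤ 4 * (30 * h) := by exact_mod_cast hKH
  have hSH' : (S.card : ℝ) ≤ 30 * h := by exact_mod_cast hSH
  have hWS' : (W.card : ℝ) ≤ S.card := by exact_mod_cast hWS
  have ht : (0 : ℝ) ≤ t := Nat.cast_nonneg t
  have hx : (0 : ℝ) ≤ j₀ := Nat.cast_nonneg _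
  generalize ((∑ m ∈ S, (e m - 2 * max 0 (3 * t - f m - j₀)) : ℤ) : ℝ) = q at hex' hred'
  generalize ((multCells (30 * h) S).card : ℝ) = K at *
  generalize (S.card : ℝ) = s at *
  generalize (W.card : ℝ) = w at *
  generalize (30 * (h : ℝ)) = H at *
  generalize (excess h t S f e : ℝ) = E at *
  generalize (j₀ : ℝ) = x at *
  generalize (t : ℝ) = T at *
  generalize min (2 * T + 2 * x) (3 * T + x) = M at *
  have hH : 0 ≤ H := by nlinarith
  have hs : 0 ≤ s := by nlinarith
  have hsM1 := mul_le_mul_of_nonneg_left hmin1 hs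
  have hsM2 := mul_le_mul_of_nonneg_left hmin2 hs
  have hTs := mul_nonneg ht (sub_nonneg.2 hWS')
  -- If a tenth of S lies off W, the saving 3T/4000 at each such place decides, the other terms
  -- amounting to hardly more than 2TH. Otherwise 470w ≤ 101K raises K from 4s to 4.188s.
  by_cases hw : w ≤ 9 / 10 * s
  · have hxK := mul_le_mul_of_nonneg_left hK' hx
    have hTw := mul_le_mul_of_nonneg_left hw ht
    have hTl := mul_le_mul_of_nonneg_left hlarge ht
    by_cases hxT : x ≤ T
    · have := mul_nonneg (sub_nonneg.2 hxT) (sub_nonneg.2 hSH')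
      nlinarith
    · push Not at hxT
      by_cases h3 : 2 * H ≤ 3 * s
      · have := mul_nonneg (sub_nonneg.2 hxT.le) (sub_nonneg.2 h3)
        nlinarith
      · push Not at h3
        have := mul_nonneg (sub_nonneg.2 hj') (sub_nonneg.2 h3.le)
        nlinarith
  · push Not at hw
    have hKs : 4188 / 1000 * s ≤ K := by linarith
    have hxK := mul_le_mul_of_nonneg_left hKs hx
    have hTl := mul_le_mul_of_nonneg_left hlarge ht
    have hsu : s ≤ 956 / 1000 * H := by linarith
    have hTu := mul_le_mul_of_nonneg_left hsu ht
    by_cases hxT : x ≤ T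
    · have h1 := mul_nonneg (sub_nonneg.2 hxT) (sub_nonneg.2 hsu)
      have h2 := mul_nonneg hx (sub_nonneg.2 hlarge)
      have h3 := mul_nonneg (sub_nonneg.2 hxT) hH
      have h4 := mul_nonneg hx hH
      have h5 := mul_nonneg ht hH
      nlinarith
    · push Not at hxT
      have h1 := mul_nonneg (sub_nonneg.2 hxT.le) (sub_nonneg.2 hlarge)
      have h3 := mul_nonneg (sub_nonneg.2 hxT.le) hH
      have h5 := mul_nonneg ht hH
      nlinarith

/-- The global bound: the average height is below two thirds by a definite amount. -/
theorem excess_le (d : CellData h t S W f e) (hh : 0 < h) (hlow : 30 * h ≤ 50 * S.card) :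
    (excess h t S f e : ℝ) ≤ (2 / 3 - 1 / 200000) * (3 * t) * (30 * h) := by
  have hS : S.Nonempty := Finset.card_pos.1 (by omega)
  have ht : (0 : ℝ) ≤ t := Nat.cast_nonneg t
  have hh' : (0 : ℝ) ≤ h := Nat.cast_nonneg h
  have hth := mul_nonneg ht hh'
  -- The easy bound 3t·max(H − |S|, |S|) suffices between 0.336H and (2/3 − 1/200000)H; only the two
  -- ends need finer arguments.
  by_cases h1 : 1000 * S.card ≤ 336 * (30 * h)
  · have h2 : (5000 : ℝ) * excess h t S f e ≤ 5000 * (2 * t * (30 * h)) - 109 * t * S.card := by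
      exact_mod_cast d.excess_le_of_card_le hlow h1 hS
    have h3 : (30 : ℝ) * h ≤ 50 * S.card := by exact_mod_cast hlow
    have := mul_le_mul_of_nonneg_left h3 ht
    nlinarith
  · push Not at h1
    by_cases h2 : (2 / 3 - 1 / 200000 : ℝ) * (30 * h) ≤ S.card
    · exact d.excess_le_of_large_card hS h2
    · push Not at h2
      have h3 : (excess h t S f e : ℝ) ≤ 3 * t * max (30 * (h : ℝ) - S.card) S.card := by
        exact_mod_cast d.excess_le_of_le_card hS
      have h4 : (336 : ℝ) * (30 * h) < 1000 * S.card := by exact_mod_cast h1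
      have h5 : max (30 * (h : ℝ) - S.card) S.card ≤ (2 / 3 - 1 / 200000) * (30 * h) :=
        max_le (by linarith) h2.le
      have := mul_le_mul_of_nonneg_left h5 (mul_nonneg (by norm_num : (0 : ℝ) ≤ 3) ht)
      linarith

end CellData

/-! ### Residue classes modulo 24 and the local inequality -/

/-- The residue classes modulo 24 that are `i` modulo `m`. -/
def cls (m i : ℕ) : Finset (ZMod 24) := Finset.univ.filter fun r => r.val % m = i

/-- The total of `F` on the residue class `i` modulo `m`. -/
noncomputable def csum (F : ZMod 24 → ℝ) (m i : ℕ) : ℝ := ∑ r ∈ cls m i, F r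

theorem csum_eq_sum_ite (F : ZMod 24 → ℝ) (m i : ℕ) :
    csum F m i = ∑ r, if r.val % m = i then F r else 0 := by
  rw [csum, cls, Finset.sum_filter]

theorem sum_eq_csum_four (F : ZMod 24 → ℝ) :
    ∑ r, F r = csum F 4 0 + csum F 4 1 + csum F 4 2 + csum F 4 3 := by
  simp only [csum_eq_sum_ite, ← Finset.sum_add_distrib]
  refine Finset.sum_congr rfl fun r _ => ?_
  have : r.val % 4 = 0 ∨ r.val % 4 = 1 ∨ r.val % 4 = 2 ∨ r.val % 4 = 3 := by omega
  rcases this with h | h | h | h <;> simp [h]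

theorem sum_eq_csum_six (F : ZMod 24 → ℝ) :
    ∑ r, F r = csum F 6 0 + csum F 6 1 + csum F 6 2 + csum F 6 3 + csum F 6 4 + csum F 6 5 := by
  simp only [csum_eq_sum_ite, ← Finset.sum_add_distrib]
  refine Finset.sum_congr rfl fun r _ => ?_
  have : r.val % 6 = 0 ∨ r.val % 6 = 1 ∨ r.val % 6 = 2 ∨ r.val % 6 = 3 ∨ r.val % 6 = 4 ∨
    r.val % 6 = 5 := by omega
  rcases this with h | h | h | h | h | h <;> simp [h]

theorem csum_four_eq_add {F : ZMod 24 → ℝ} {i : ℕ} (hi : i < 4) :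
    csum F 4 i = csum F 8 i + csum F 8 (i + 4) := by
  simp only [csum_eq_sum_ite, ← Finset.sum_add_distrib]
  refine Finset.sum_congr rfl fun r _ => ?_
  by_cases h : r.val % 4 = i
  · have : r.val % 8 = i ∨ r.val % 8 = i + 4 := by omega
    rcases this with h' | h' <;> simp [h, h']
  · have h1 : ¬ r.val % 8 = i := by omega
    have h2 : ¬ r.val % 8 = i + 4 := by omega
    simp [h, h1, h2]

theorem csum_nonneg {F : ZMod 24 → ℝ} (hF : ∀ r, 0 ≤ F r) (m i : ℕ) : 0 ≤ csum F m i :=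
  Finset.sum_nonneg fun r _ => hF r

theorem csum_mono {F G : ZMod 24 → ℝ} (h : ∀ r, F r ≤ G r) (m i : ℕ) : csum F m i ≤ csum G m i :=
  Finset.sum_le_sum fun r _ => h r

theorem csum_eq_zero {F : ZMod 24 → ℝ} {m i : ℕ} (h : ∀ r, r.val % m = i → F r = 0) :
    csum F m i = 0 :=
  Finset.sum_eq_zero fun r hr => h r (Finset.mem_filter.1 hr).2

theorem exists_ne_zero_of_csum {F : ZMod 24 → ℝ} {m i : ℕ} (h : csum F m i ≠ 0) :
    ∃ r, r.val % m = i ∧ F r ≠ 0 := by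
  by_contra hc
  push Not at hc
  exact h (csum_eq_zero hc)

theorem csum_eq_of_subset {F : ZMod 24 → ℝ} {m i m' i' : ℕ} (hm : m ∣ m') (hi : i' % m = i)
    (h : ∀ r, r.val % m = i → F r ≠ 0 → r.val % m' = i') : csum F m i = csum F m' i' := by
  simp only [csum_eq_sum_ite]
  refine Finset.sum_congr rfl fun r _ => ?_
  have hmod : r.val % m' % m = r.val % m := Nat.mod_mod_of_dvd _ hm
  split_ifs with h1 h2 h2
  · rfl
  · by_contra hF
    exact h2 (h r h1 hF)
  · exact absurd (by rw [← hmod, h2, hi]) h1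
  · rfl

theorem card_cls {m i : ℕ} (hm : m ∈ Nat.divisors 24) (hi : i < m) : (cls m i).card = 24 / m := by
  have : ∀ m ∈ Nat.divisors 24, ∀ i ∈ Finset.range m, (cls m i).card = 24 / m := by decide
  exact this m hm i (Finset.mem_range.2 hi)

theorem val_sub_mod {m i j : ℕ} (hm : m ∣ 24) (hi : i < m) (hj : j < m) (s r : ZMod 24)
    (hij : (i + j) % m = s.val % m) : (s - r).val % m = j ↔ r.val % m = i := by
  have h1 : ∀ (x : ZMod 24) (k : ℕ), k < m → (x.val % m = k ↔ ZMod.castHom hm (ZMod m) x = k) := by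
    intro x k hk
    have : ZMod.castHom hm (ZMod m) x = ((x.val : ℕ) : ZMod m) := by
      conv_lhs => rw [← ZMod.natCast_zmod_val x]
      rw [map_natCast]
    rw [this, ZMod.natCast_eq_natCast_iff', Nat.mod_eq_of_lt hk]
  have hs : ZMod.castHom hm (ZMod m) s = i + j := by
    have h2 := (h1 s (s.val % m) (Nat.mod_lt _ (by omega))).1 rfl
    rw [h2, ← hij]
    push_cast [ZMod.natCast_mod]
    rfl
  rw [h1 _ _ hj, h1 _ _ hi, map_sub, hs]
  constructor
  · intro h; linear_combination -h
  · intro h; linear_combination -h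

theorem sum_csum_le {F : ZMod 24 → ℝ} {κ : ℝ} {m i : ℕ} (hm : m ∈ Nat.divisors 24) (hi : i < m)
    (h : ∀ r, F r ≤ κ) : csum F m i ≤ (24 / m : ℕ) * κ := by
  have := Finset.sum_le_card_nsmul (cls m i) F κ fun r _ => h r
  rwa [card_cls hm hi, nsmul_eq_mul] at this

/-- Summing a reflection inequality over a residue class. -/
theorem csum_add_csum_le {F G : ZMod 24 → ℝ} {s : ZMod 24} {κ : ℝ} (m i j : ℕ)
    (h : ∀ r, F r + G (s - r) ≤ κ) (hm : m ∈ Nat.divisors 24) (hi : i < m) (hj : j < m)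
    (hij : (i + j) % m = s.val % m) : csum F m i + csum G m j ≤ (24 / m : ℕ) * κ := by
  have hd : m ∣ 24 := (Nat.mem_divisors.1 hm).1
  have hG : csum G m j = ∑ r ∈ cls m i, G (s - r) := by
    symm
    refine Finset.sum_equiv (Equiv.subLeft s) (fun r => ?_) fun r _ => rfl
    simp only [cls, Finset.mem_filter, Finset.mem_univ, true_and, Equiv.subLeft_apply]
    exact (val_sub_mod hd hi hj s r hij).symm
  rw [hG, csum, ← Finset.sum_add_distrib]
  exact sum_csum_le hm hi (F := fun r => F r + G (s - r)) h

/-- Summing a translation inequality over a residue class that takes in all of `4Y - x`. -/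
theorem csum_add_quarter_le {X Y : ZMod 24 → ℝ} {x : ZMod 24} {κ : ℝ} (m i : ℕ)
    (h : ∀ r, X r + 1 / 4 * ∑ y, (if 4 * y = r + x then Y y else 0) ≤ κ)
    (hm : m ∈ Nat.divisors 24) (hi : i < m) (hY : ∀ y, Y y ≠ 0 → (4 * y - x).val % m = i) :
    csum X m i + 1 / 4 * ∑ y, Y y ≤ (24 / m : ℕ) * κ := by
  have h1 : ∑ y, Y y = ∑ r ∈ cls m i, ∑ y, (if 4 * y = r + x then Y y else 0) := by
    rw [Finset.sum_comm]
    refine Finset.sum_congr rfl fun y _ => ?_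
    by_cases hy : Y y = 0
    · simp [hy]
    · rw [Finset.sum_eq_single (4 * y - x)]
      · simp
      · intro r _ hr
        rw [if_neg]
        intro hc
        exact hr (by rw [hc]; ring)
      · intro hn
        exact absurd (show 4 * y - x ∈ cls m i by simpa [cls] using hY y hy) hn
  rw [h1, csum, Finset.mul_sum, ← Finset.sum_add_distrib]
  exact sum_csum_le hm hi (F := fun r => X r + 1 / 4 * ∑ y, (if 4 * y = r + x then Y y else 0)) h

/-- The class `c` modulo 4 of `X` is concentrated in one class modulo `g`. -/
def Concentrated (X : ZMod 24 → ℝ) (c : ℕ) (κ e : ℝ) : Prop :=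
  ∃ g : ℕ, 0 < g ∧ 4 ∣ g ∧ κ ≤ g * csum X 4 c ∧ g * csum X 4 c ≤ 1 + g * e ∧
    ∀ r r' : ZMod 24, r.val % 4 = c → r'.val % 4 = c → X r ≠ 0 → X r' ≠ 0 →
      r.val % Nat.gcd g 24 = r'.val % Nat.gcd g 24

/-- The densities at a place, in residue classes modulo 24, of the set `X`, of the lower levels `B`
and of their unions `Y` brought to the same scale, with the constraints between them. -/
structure LocalDensities (e : ℝ) (X : ZMod 24 → ℝ) (B Y : ℕ → ZMod 24 → ℝ) : Prop where
  X_nonneg : ∀ r, 0 ≤ X r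
  B_nonneg : ∀ k r, 0 ≤ B k r
  Y_nonneg : ∀ k r, 0 ≤ Y k r
  Y_eq : ∀ k r, 1 ≤ k → Y k r = B k r + 1 / 2 * ∑ r', (if 2 * r' = r then Y (k + 1) r' else 0)
  Y_le : ∀ k r, 1 ≤ k → k ≤ 3 → Y k r ≤ 1 / 24 + e
  XX : ∀ y, Y 1 y ≠ 0 → ∀ r, X r + X (4 * y - r) ≤ 1 / 24 + e
  BX : ∀ k, 1 ≤ k → k ≤ 3 → ∀ y, Y k y ≠ 0 → ∀ r, B k r + X ((2 ^ k + 1) * y - r) ≤ 1 / 24 + e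
  BB : ∀ y, Y 2 y ≠ 0 → ∀ r, B 1 r + B 1 (4 * y - r) ≤ 1 / 24 + e
  XY : ∀ x, X x ≠ 0 → ∀ r, X r + 1 / 4 * ∑ y, (if 4 * y = r + x then Y 1 y else 0) ≤ 1 / 24 + e
  even_concentrated : ∀ c, c = 0 ∨ c = 2 →
    csum X 4 c ≤ (1 - ∑ r, Y 1 r) / 6 + 1 / 10 ^ 8 ∨
      Concentrated X c (1 / 2 + 1 / (2 * 10 ^ 8)) e
  odd_concentrated : csum X 4 1 ≠ 0 → csum X 4 3 ≠ 0 → ∑ r, Y 1 r ≤ 7 / 12 + 1 / 1000 →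
    (1 - ∑ r, Y 1 r) / 2 - 2 / 1000 ≤ csum X 4 1 + csum X 4 3 →
      Concentrated X 1 (97 / 100) e ∧ Concentrated X 3 (97 / 100) e

namespace LocalDensities
variable {e : ℝ} {X : ZMod 24 → ℝ} {B Y : ℕ → ZMod 24 → ℝ}

theorem sum_Y_eq (d : LocalDensities e X B Y) {k : ℕ} (hk : 1 ≤ k) :
    ∑ r, Y k r = ∑ r, B k r + 1 / 2 * ∑ r, Y (k + 1) r := by
  have : ∑ r, Y (k + 1) r = ∑ r : ZMod 24, ∑ r', (if 2 * r' = r then Y (k + 1) r' else 0) := by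
    rw [Finset.sum_comm]
    simp
  rw [Finset.sum_congr rfl fun r _ => d.Y_eq k r hk, Finset.sum_add_distrib, ← Finset.mul_sum, this]

theorem B_le_Y (d : LocalDensities e X B Y) {k : ℕ} (hk : 1 ≤ k) (r : ZMod 24) :
    B k r ≤ Y k r := by
  rw [d.Y_eq k r hk]
  have : 0 ≤ ∑ r', (if 2 * r' = r then Y (k + 1) r' else 0) :=
    Finset.sum_nonneg fun r' _ => by split_ifs; exacts [d.Y_nonneg _ _, le_rfl]
  linarith

theorem Y_eq_B_of_odd (d : LocalDensities e X B Y) {k : ℕ} (hk : 1 ≤ k) {r : ZMod 24}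
    (hr : r.val % 2 = 1) : Y k r = B k r := by
  rw [d.Y_eq k r hk]
  have : ∑ r', (if 2 * r' = r then Y (k + 1) r' else 0) = 0 :=
    Finset.sum_eq_zero fun r' _ => by
      rw [if_neg]
      have : ∀ r r' : ZMod 24, r.val % 2 = 1 → 2 * r' ≠ r := by decide
      exact this r r' hr
  rw [this]; ring

theorem double_mem (d : LocalDensities e X B Y) {k : ℕ} (hk : 1 ≤ k) {y : ZMod 24}
    (hy : Y (k + 1) y ≠ 0) : Y k (2 * y) ≠ 0 := by
  have h1 := d.B_nonneg k (2 * y)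
  have h2 : Y (k + 1) y ≤ ∑ r', (if 2 * r' = 2 * y then Y (k + 1) r' else 0) := by
    have := Finset.single_le_sum (f := fun r' => if 2 * r' = 2 * y then Y (k + 1) r' else 0)
      (fun r' _ => by
        have := d.Y_nonneg (k + 1) r'
        show 0 ≤ (if 2 * r' = 2 * y then Y (k + 1) r' else 0)
        split_ifs <;> simp [this]) (Finset.mem_univ y)
    simpa using this
  have h3 := lt_of_le_of_ne (d.Y_nonneg (k + 1) y) (Ne.symm hy)
  rw [d.Y_eq k _ hk]
  linarith

theorem val_four_mul (y : ZMod 24) : (4 * y).val % 4 = 0 ∧ (4 * y).val % 8 = 4 * (y.val % 2) ∧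
    (4 * y).val % 3 = y.val % 3 ∧ (4 * y).val % 2 = 0 := by
  revert y; decide

/-- Reflection bounds for `X` modulo 4. -/
theorem X_le (d : LocalDensities e X B Y) {y : ZMod 24} (hy : Y 1 y ≠ 0) :
    csum X 4 0 ≤ 1 / 8 + 3 * e ∧ csum X 4 2 ≤ 1 / 8 + 3 * e ∧
      csum X 4 1 + csum X 4 3 ≤ 1 / 4 + 6 * e := by
  have hv := val_four_mul y
  have h0 := csum_add_csum_le 4 0 0 (d.XX y hy) (by decide) (by norm_num) (by norm_num) (by omega)
  have h1 := csum_add_csum_le 4 1 3 (d.XX y hy) (by decide) (by norm_num) (by norm_num) (by omega)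
  have h2 := csum_add_csum_le 4 2 2 (d.XX y hy) (by decide) (by norm_num) (by norm_num) (by omega)
  norm_num at h0 h1 h2
  refine ⟨?_, ?_, ?_⟩ <;> linarith

theorem val_four_mul_sub (y x : ZMod 24) : (4 * y - x).val % 4 = (4 - x.val % 4) % 4 ∧
    (4 * y - x).val % 8 = (4 * (y.val % 2) + (8 - x.val % 8)) % 8 := by
  revert y x; decide

/-- If all multipliers have the same parity, one even class of `X` is small. -/
theorem X_le_of_single_parity (d : LocalDensities e X B Y) {p : ℕ} (hp : p < 2)
    (hY : ∀ y, Y 1 y ≠ 0 → y.val % 2 = p) (hη : ∑ r, Y 1 r ≤ 1 / 2 + 12 * e) :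
    csum X 4 (2 * p) ≤ 1 / 4 - (∑ r, Y 1 r) / 2 + 6 * e := by
  -- If all y have parity p, then 4y − x lies in the class of x modulo 8, so all of η/4 is to be
  -- subtracted within a single class modulo 8.
  have key : ∀ i, i < 8 → i % 4 = 2 * p →
      csum X 8 i ≤ 1 / 8 - (∑ r, Y 1 r) / 4 + 3 * e := by
    intro i hi hip
    by_cases h0 : csum X 8 i = 0
    · rw [h0]; linarith
    · obtain ⟨x, hx, hxX⟩ := exists_ne_zero_of_csum h0
      have := csum_add_quarter_le 8 i (d.XY x hxX) (by decide) hi (fun y hy => by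
        have h1 := hY y hy
        have h2 := (val_four_mul_sub y x).2
        omega)
      norm_num at this
      linarith
  have h1 := key (2 * p) (by omega) (by omega)
  have h2 := key (2 * p + 4) (by omega) (by omega)
  rw [csum_four_eq_add (by omega)]
  linarith

/-- Modulo 4 the numbers 4y − x all lie in the class of −x: an element in one odd class lets all
multipliers bear on the other. -/
theorem X_odd_le (d : LocalDensities e X B Y) :
    (csum X 4 1 ≠ 0 → csum X 4 3 ≤ 1 / 4 - (∑ r, Y 1 r) / 4 + 6 * e) ∧
    (csum X 4 3 ≠ 0 → csum X 4 1 ≤ 1 / 4 - (∑ r, Y 1 r) / 4 + 6 * e) := by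
  refine ⟨fun h => ?_, fun h => ?_⟩ <;> obtain ⟨x, hx, hxX⟩ := exists_ne_zero_of_csum h
  · have := csum_add_quarter_le 4 3 (d.XY x hxX) (by decide) (by norm_num) (fun y _ => by
      have h2 := (val_four_mul_sub y x).1
      omega)
    norm_num at this
    linarith
  · have := csum_add_quarter_le 4 1 (d.XY x hxX) (by decide) (by norm_num) (fun y _ => by
      have h2 := (val_four_mul_sub y x).1
      omega)
    norm_num at this
    linarith

theorem val_two_mul (y : ZMod 24) : (2 * y).val % 3 = (2 * (y.val % 3)) % 3 := by
  revert y; decide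

/-- If the multipliers miss a class modulo 3 and there are multipliers one level down, then there
are not too many multipliers. -/
theorem sum_Y_le_of_miss (d : LocalDensities e X B Y) (he : 0 ≤ e) {v : ℕ} (hv : v < 3)
    (hY : ∀ y, y.val % 3 = v → Y 1 y = 0) {y' : ZMod 24} (hy' : Y 2 y' ≠ 0) :
    ∑ r, Y 1 r ≤ 7 / 12 + 24 * e := by
  have h2 : (2 * y'.val) % 3 ≠ v := by
    intro hc
    exact d.double_mem le_rfl hy' (hY _ (by rw [val_two_mul]; omega))
  have hb : ∀ i, i < 6 → csum (Y 1) 6 i ≤ 1 / 6 + 4 * e := fun i hi => by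
    have := sum_csum_le (m := 6) (i := i) (by decide) hi fun r => d.Y_le 1 r le_rfl (by norm_num)
    norm_num at this; linarith
  have hz : ∀ i, i < 6 → i % 3 = v → csum (Y 1) 6 i = 0 := fun i hi hiv =>
    csum_eq_zero fun r hr => hY r (by omega)
  have ho : ∀ i, i < 6 → i % 2 = 1 → csum (Y 1) 6 i = csum (B 1) 6 i := fun i hi hio =>
    Finset.sum_congr rfl fun r hr => d.Y_eq_B_of_odd le_rfl (by
      have := (Finset.mem_filter.1 hr).2
      omega)
  -- An odd class contains no doubles, so Y = B there, and r ↦ 4y' − r maps this class modulo 6 to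
  -- itself. With one class modulo 3 missed, what remains is 3/6 + 1/12.
  have hr : ∀ i, i < 6 → i % 2 = 1 → i % 3 = (2 * y'.val) % 3 → csum (Y 1) 6 i ≤ 1 / 12 + 2 * e := by
    intro i hi hio hi3
    have hv4 := val_four_mul y'
    have := csum_add_csum_le 6 i i (d.BB y' hy') (by decide) hi hi (by omega)
    rw [ho i hi hio]
    norm_num at this; linarith
  rw [sum_eq_csum_six]
  have b0 := hb 0 (by norm_num); have b1 := hb 1 (by norm_num); have b2 := hb 2 (by norm_num)
  have b3 := hb 3 (by norm_num); have b4 := hb 4 (by norm_num); have b5 := hb 5 (by norm_num)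
  have z0 := hz 0 (by norm_num); have z1 := hz 1 (by norm_num); have z2 := hz 2 (by norm_num)
  have z3 := hz 3 (by norm_num); have z4 := hz 4 (by norm_num); have z5 := hz 5 (by norm_num)
  have r1 := hr 1 (by norm_num) rfl; have r3 := hr 3 (by norm_num) rfl
  have r5 := hr 5 (by norm_num) rfl
  norm_num at z0 z1 z2 z3 z4 z5 r1 r3 r5
  have hcase : y'.val % 3 = 0 ∨ y'.val % 3 = 1 ∨ y'.val % 3 = 2 := by omega
  rcases hcase with h | h | h
  · have r := r3 (by omega)
    have hv' : v = 1 ∨ v = 2 := by omega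
    rcases hv' with h' | h'
    · have := z1 h'.symm; have := z4 h'.symm; linarith
    · have := z2 h'.symm; have := z5 h'.symm; linarith
  · have r := r5 (by omega)
    have hv' : v = 0 ∨ v = 1 := by omega
    rcases hv' with h' | h'
    · have := z0 h'.symm; have := z3 h'.symm; linarith
    · have := z1 h'.symm; have := z4 h'.symm; linarith
  · have r := r1 (by omega)
    have hv' : v = 0 ∨ v = 2 := by omega
    rcases hv' with h' | h'
    · have := z0 h'.symm; have := z3 h'.symm; linarith
    · have := z2 h'.symm; have := z5 h'.symm; linarith

/-- Bounds for the even classes of `X` when multipliers of both parities occur. -/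
theorem X_even_le (d : LocalDensities e X B Y) (he : 0 ≤ e) (he' : e ≤ 1 / 10 ^ 11)
    (hpar : ∀ p, p < 2 → ∃ y, Y 1 y ≠ 0 ∧ y.val % 2 = p) {c : ℕ} (hc : c = 0 ∨ c = 2) :
    csum X 4 c ≤ (1 - ∑ r, Y 1 r) / 6 + 1 / 10 ^ 8 ∨ csum X 4 c ≤ 1 / 16 + 2 * e ∨
      (csum X 4 c ≤ 1 / 12 + 2 * e ∧
        ((∃ y, Y 2 y ≠ 0) → ∑ r, Y 1 r ≤ 7 / 12 + 24 * e)) := by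
  rcases d.even_concentrated c hc with h | ⟨g, hg, ⟨q, rfl⟩, hlow, hup, hsupp⟩
  · exact Or.inl h
  right
  by_cases h0 : csum X 4 c = 0
  · left; rw [h0]; linarith
  obtain ⟨x, hx, hxX⟩ := exists_ne_zero_of_csum h0
  have hq : 0 < q := by omega
  obtain ⟨y₀, hy₀, -⟩ := hpar 0 (by norm_num)
  have hX := d.X_le hy₀
  -- With g = 4q: q = 1 contradicts the reflection bound 1/8; for q = 2, 3 the class of X lies in
  -- one class modulo 8 or 12, both divisors of 24, where reflection can be applied; for q ≥ 4 the
  -- class is thin.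
  rcases (by omega : q = 1 ∨ q = 2 ∨ q = 3 ∨ 4 ≤ q) with rfl | rfl | rfl | hq4
  · exfalso
    norm_num at hlow
    rcases hc with rfl | rfl <;> linarith
  · left
    have hgcd : Nat.gcd (4 * 2) 24 = 8 := by decide
    rw [hgcd] at hsupp
    have heq : csum X 4 c = csum X 8 (x.val % 8) :=
      csum_eq_of_subset (by norm_num) (by omega) fun r hr hrX => hsupp r x hr hx hrX hxX
    obtain ⟨y, hy, hyp⟩ := hpar (c / 2) (by omega)
    have hv := val_four_mul y
    have := csum_add_csum_le 8 (x.val % 8) (x.val % 8) (d.XX y hy) (by decide) (by omega)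
      (by omega) (by omega)
    rw [heq]
    norm_num at this
    linarith
  · have hgcd : Nat.gcd (4 * 3) 24 = 12 := by decide
    rw [hgcd] at hsupp
    have heq : csum X 4 c = csum X 12 (x.val % 12) :=
      csum_eq_of_subset (by norm_num) (by omega) fun r hr hrX => hsupp r x hr hx hrX hxX
    -- This says 4y ≡ 2x modulo 12, so that reflection preserves the class of x. Without such a y
    -- the multipliers miss a class modulo 3.
    by_cases hex : ∃ y, Y 1 y ≠ 0 ∧ y.val % 3 = (2 * x.val) % 3
    · left
      obtain ⟨y, hy, hy3⟩ := hex
      have hv := val_four_mul y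
      have := csum_add_csum_le 12 (x.val % 12) (x.val % 12) (d.XX y hy) (by decide) (by omega)
        (by omega) (by omega)
      rw [heq]
      norm_num at this
      linarith
    · right
      push Not at hex
      refine ⟨by norm_num at hup; linarith, fun ⟨y', hy'⟩ => ?_⟩
      exact d.sum_Y_le_of_miss he (v := (2 * x.val) % 3) (by omega)
        (fun y hy => by by_contra hne; exact hex y hne hy) hy'
  · left
    have hq4' : (4 : ℝ) ≤ q := by exact_mod_cast hq4
    push_cast at hup
    have := csum_nonneg d.X_nonneg 4 c
    by_contra hcon
    push Not at hcon
    have : (4 * q : ℝ) * (1 / 16 + 2 * e) < 4 * q * csum X 4 c :=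
      mul_lt_mul_of_pos_left hcon (by linarith)
    nlinarith

/-- Both odd classes of `X` cannot be near their bounds. -/
theorem X_odd_not_large (d : LocalDensities e X B Y) (he' : e ≤ 1 / 10 ^ 11)
    (hpar : ∀ p, p < 2 → ∃ y, Y 1 y ≠ 0 ∧ y.val % 2 = p) (h1 : csum X 4 1 ≠ 0)
    (h3 : csum X 4 3 ≠ 0) (hη : ∑ r, Y 1 r ≤ 7 / 12 + 1 / 1000)
    (hη' : 1 / 2 - 1 / 1000 ≤ ∑ r, Y 1 r) :
    csum X 4 1 + csum X 4 3 < (1 - ∑ r, Y 1 r) / 2 - 2 / 1000 := by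
  by_contra hcon
  push Not at hcon
  have hb := d.X_odd_le
  have hb1 := hb.2 h3
  have hb3 := hb.1 h1
  obtain ⟨c1, c3⟩ := d.odd_concentrated h1 h3 hη hcon
  have key : ∀ c, c = 1 ∨ c = 3 → csum X 4 c ≤ 1 / 4 - (∑ r, Y 1 r) / 4 + 6 * e →
      (1 - ∑ r, Y 1 r) / 4 - 3 / 1000 ≤ csum X 4 c → Concentrated X c (97 / 100) e →
      csum X 4 c ≠ 0 → ∃ i, i < 8 ∧ i % 4 = c ∧ csum X 4 c = csum X 8 i := by
    rintro c hc hcu hcl ⟨g, hg, ⟨q, rfl⟩, hlow, hup, hsupp⟩ hne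
    obtain ⟨x, hx, hxX⟩ := exists_ne_zero_of_csum hne
    -- The class has density between 0.1 and 0.126, while 4q times it lies between 0.97 and 1 up to
    -- errors.
    have hq2 : q = 2 := by
      push_cast at hlow hup
      have hq1 : 2 ≤ q := by
        by_contra hq
        have : (q : ℝ) ≤ 1 := by exact_mod_cast (by omega : q ≤ 1)
        nlinarith [csum_nonneg d.X_nonneg 4 c]
      have hq3 : q < 3 := by
        by_contra hq
        have : (3 : ℝ) ≤ q := by exact_mod_cast (by omega : 3 ≤ q)
        nlinarith [csum_nonneg d.X_nonneg 4 c]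
      omega
    subst hq2
    have hgcd : Nat.gcd (4 * 2) 24 = 8 := by decide
    rw [hgcd] at hsupp
    exact ⟨x.val % 8, by omega, by omega, csum_eq_of_subset (by norm_num) (by omega)
      fun r hr hrX => hsupp r x hr hx hrX hxX⟩
  obtain ⟨i, hi, hi4, hie⟩ := key 1 (Or.inl rfl) hb1 (by linarith) c1 h1
  obtain ⟨j, hj, hj4, hje⟩ := key 3 (Or.inr rfl) hb3 (by linarith) c3 h3
  -- A multiplier of this parity has 4y ≡ i + j modulo 8, so the two odd classes reflect into each
  -- other and hold at most about 1/8 together.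
  obtain ⟨y, hy, hyp⟩ := hpar ((i + j) / 4 % 2) (by omega)
  have hv := val_four_mul y
  have := csum_add_csum_le 8 i j (d.XX y hy) (by decide) hi hj (by omega)
  norm_num at this
  linarith

end LocalDensities

namespace LocalDensities
variable {e : ℝ} {X : ZMod 24 → ℝ} {B Y : ℕ → ZMod 24 → ℝ}

/-- The level `b` is small when the multipliers hit at least three classes modulo 4. -/
theorem sum_level_le {A μ xa : ℝ} {x b y : ℕ → ℝ} {p a : ℕ} (hp : p = 1 ∨ p = 3)
    (ha : a = 1 ∨ a = 3) (hxa : x a = xa) (h0 : μ ≤ x 0) (h2 : μ ≤ x 2)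
    (hb : ∀ i, y i = 0 → b i = 0)
    (hT : ∀ i < 4, ∀ j < i, y i = 0 → y j ≠ 0)
    (h : ∀ j < 4, y j ≠ 0 → ∀ i < 4, b i + x ((p * j + 4 - i) % 4) ≤ A) :
    b 0 + b 1 + b 2 + b 3 ≤ A - μ + 2 * (A - xa) ∨ b 0 + b 1 + b 2 + b 3 ≤ 4 * (A - xa) := by
  subst hxa
  have H : ∀ j < 4, y j ≠ 0 → (b 0 + x ((p * j + 4 - 0) % 4) ≤ A ∧ b 1 + x ((p * j + 4 - 1) % 4) ≤ A ∧
      b 2 + x ((p * j + 4 - 2) % 4) ≤ A ∧ b 3 + x ((p * j + 4 - 3) % 4) ≤ A) := fun j hj hy =>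
    ⟨h j hj hy 0 (by norm_num), h j hj hy 1 (by norm_num), h j hj hy 2 (by norm_num),
      h j hj hy 3 (by norm_num)⟩
  have H0 := H 0 (by norm_num); have H1 := H 1 (by norm_num)
  have H2 := H 2 (by norm_num); have H3 := H 3 (by norm_num)
  clear H h
  -- At most one class of y is empty. Class i of b is paired with class a of x through the j with pj
  -- ≡ a + i; if that j is empty, class i is paired with an even class of x instead, and b vanishes
  -- on class j.
  by_cases y0 : y 0 = 0
  · have n1 := mt (hT 1 (by norm_num) 0 (by norm_num)) (not_not.2 y0)
    have n2 := mt (hT 2 (by norm_num) 0 (by norm_num)) (not_not.2 y0)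
    have n3 := mt (hT 3 (by norm_num) 0 (by norm_num)) (not_not.2 y0)
    have := hb 0 y0
    have H1 := H1 n1; have H2 := H2 n2; have H3 := H3 n3
    left
    rcases hp with rfl | rfl <;> rcases ha with rfl | rfl <;> norm_num at H1 H2 H3 <;> linarith
  by_cases y1 : y 1 = 0
  · have n2 := mt (hT 2 (by norm_num) 1 (by norm_num)) (not_not.2 y1)
    have n3 := mt (hT 3 (by norm_num) 1 (by norm_num)) (not_not.2 y1)
    have := hb 1 y1
    have H0 := H0 y0; have H2 := H2 n2; have H3 := H3 n3
    left
    rcases hp with rfl | rfl <;> rcases ha with rfl | rfl <;> norm_num at H0 H2 H3 <;> linarith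
  by_cases y2 : y 2 = 0
  · have n3 := mt (hT 3 (by norm_num) 2 (by norm_num)) (not_not.2 y2)
    have := hb 2 y2
    have H0 := H0 y0; have H1 := H1 y1; have H3 := H3 n3
    left
    rcases hp with rfl | rfl <;> rcases ha with rfl | rfl <;> norm_num at H0 H1 H3 <;> linarith
  have H0 := H0 y0; have H1 := H1 y1; have H2 := H2 y2
  by_cases y3 : y 3 = 0
  · have := hb 3 y3
    left
    rcases hp with rfl | rfl <;> rcases ha with rfl | rfl <;> norm_num at H0 H1 H2 <;> linarith
  · have H3 := H3 y3
    right
    rcases hp with rfl | rfl <;> rcases ha with rfl | rfl <;> norm_num at H0 H1 H2 H3 <;> linarith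

theorem val_pow_mul (y : ZMod 24) : ((2 ^ 1 + 1) * y).val % 4 = (3 * (y.val % 4)) % 4 ∧
    ((2 ^ 2 + 1) * y).val % 4 = y.val % 4 ∧ ((2 ^ 3 + 1) * y).val % 4 = y.val % 4 := by
  revert y; decide

/-- Modulo 4 the factor 2^k + 1 is 3 for k = 1 and 1 for k = 2, 3; this is p. -/
theorem BX_csum (d : LocalDensities e X B Y) {k p : ℕ} (hk : 1 ≤ k) (hk3 : k ≤ 3)
    (hp : p = if k = 1 then 3 else 1) :
    ∀ j < 4, csum (Y k) 4 j ≠ 0 → ∀ i < 4,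
      csum (B k) 4 i + csum X 4 ((p * j + 4 - i) % 4) ≤ 1 / 4 + 6 * e := by
  intro j hj hy i hi
  obtain ⟨y, hyj, hyY⟩ := exists_ne_zero_of_csum hy
  have hv := val_pow_mul y
  have hmod : (i + (p * j + 4 - i) % 4) % 4 = ((2 ^ k + 1) * y).val % 4 := by
    interval_cases k
    · norm_num at hp; subst hp; omega
    · norm_num at hp; subst hp; omega
    · norm_num at hp; subst hp; omega
  have := csum_add_csum_le 4 i ((p * j + 4 - i) % 4) (d.BX k hk hk3 y hyY) (by decide) hi
    (Nat.mod_lt _ (by norm_num)) hmod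
  norm_num at this
  linarith

theorem csum_Y_le (d : LocalDensities e X B Y) {k : ℕ} (hk : 1 ≤ k) (hk3 : k ≤ 3) {i : ℕ}
    (hi : i < 4) : csum (Y k) 4 i ≤ 1 / 4 + 6 * e := by
  have := sum_csum_le (m := 4) (i := i) (by decide) hi fun r => d.Y_le k r hk hk3
  norm_num at this; linarith

theorem csum_B_eq_zero (d : LocalDensities e X B Y) {k : ℕ} (hk : 1 ≤ k) {i : ℕ}
    (h : csum (Y k) 4 i = 0) : csum (B k) 4 i = 0 :=
  le_antisymm (h ▸ csum_mono (d.B_le_Y hk) 4 i) (csum_nonneg (d.B_nonneg k) 4 i)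

theorem sum_B_le_of_sum_Y (d : LocalDensities e X B Y) {k a : ℕ} (hk : 1 ≤ k) (hk3 : k ≤ 3)
    (ha : a = 1 ∨ a = 3) {μ : ℝ} (h0 : μ ≤ csum X 4 0) (h2 : μ ≤ csum X 4 2)
    (hT : ∀ i < 4, ∀ j < i, csum (Y k) 4 i = 0 → csum (Y k) 4 j ≠ 0) :
    ∑ r, B k r ≤ 1 / 4 + 6 * e - μ + 2 * (1 / 4 + 6 * e - csum X 4 a) ∨
      ∑ r, B k r ≤ 4 * (1 / 4 + 6 * e - csum X 4 a) := by
  rw [sum_eq_csum_four]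
  exact sum_level_le (p := if k = 1 then 3 else 1) (by split_ifs <;> simp) ha rfl h0 h2
    (fun i h => d.csum_B_eq_zero hk h) hT (d.BX_csum hk hk3 rfl)

/-- A class modulo 4 has density at most 1/4, so more than 1/2 needs three of them. -/
theorem ne_zero_of_lt_sum (d : LocalDensities e X B Y) {k : ℕ} (hk : 1 ≤ k) (hk3 : k ≤ 3)
    (h : 1 / 2 + 12 * e < ∑ r, Y k r) :
    ∀ i < 4, ∀ j < i, csum (Y k) 4 i = 0 → csum (Y k) 4 j ≠ 0 := by
  intro i hi j hj hi0 hj0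
  rw [sum_eq_csum_four] at h
  have c0 := d.csum_Y_le hk hk3 (i := 0) (by norm_num)
  have c1 := d.csum_Y_le hk hk3 (i := 1) (by norm_num)
  have c2 := d.csum_Y_le hk hk3 (i := 2) (by norm_num)
  have c3 := d.csum_Y_le hk hk3 (i := 3) (by norm_num)
  interval_cases i <;> interval_cases j <;> linarith

theorem sum_B_eq (d : LocalDensities e X B Y) {k : ℕ} (hk : 1 ≤ k)
    (h : ¬ ∃ y, Y (k + 1) y ≠ 0) : ∑ r, Y k r = ∑ r, B k r := by
  push Not at h
  rw [d.sum_Y_eq hk, Finset.sum_eq_zero fun r _ => h r]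
  ring

/-- If `X` meets only one odd class modulo 4, then the bound holds with room to spare. -/
theorem not_single_odd_class (d : LocalDensities e X B Y) (he : 0 ≤ e) (he' : e ≤ 1 / 10 ^ 11)
    (hpar : ∀ p, p < 2 → ∃ y, Y 1 y ≠ 0 ∧ y.val % 2 = p) {a : ℕ} (ha : a = 1 ∨ a = 3)
    (h0 : csum X 4 (4 - a) = 0)
    (hη : 1 / 2 - 1 / 1000 ≤ ∑ r, Y 1 r) (hη' : ∑ r, Y 1 r ≤ 2 / 3 + 3 / 10 ^ 8)
    (hY3 : (∃ y, Y 3 y ≠ 0) → ∑ r, Y 2 r ≤ 2 / 3 + 3 / 10 ^ 8)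
    (hY4 : (∃ y, Y 4 y ≠ 0) → ∑ r, Y 3 r ≤ 2 / 3 + 3 / 10 ^ 8) :
    2 * ∑ r, X r + ∑ r, Y 1 r ≤ 4 / 3 - 1 / 3900 := by
  by_contra hcon
  push Not at hcon
  obtain ⟨y₀, hy₀, -⟩ := hpar 0 (by norm_num)
  have hX := d.X_le hy₀
  have hf : ∑ r, X r = csum X 4 0 + csum X 4 2 + csum X 4 a := by
    rw [sum_eq_csum_four]
    rcases ha with rfl | rfl <;> norm_num at h0 <;> rw [h0] <;> ring
  have hxa : csum X 4 a ≤ 1 / 4 + 6 * e := by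
    rcases ha with rfl | rfl <;> norm_num at h0 <;> linarith
  have e0 := d.X_even_le he he' hpar (Or.inl rfl)
  have e2 := d.X_even_le he he' hpar (Or.inr rfl)
  have g0 : csum X 4 0 ≤ 1 / 12 + 1 / 5000 := by rcases e0 with h | h | ⟨h, -⟩ <;> linarith
  have g2 : csum X 4 2 ≤ 1 / 12 + 1 / 5000 := by rcases e2 with h | h | ⟨h, -⟩ <;> linarith
  obtain ⟨μ, hμ0, hμ2, hμ⟩ : ∃ μ, μ ≤ csum X 4 0 ∧ μ ≤ csum X 4 2 ∧
      (μ = csum X 4 0 ∨ μ = csum X 4 2) := by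
    rcases le_total (csum X 4 0) (csum X 4 2) with h | h
    · exact ⟨_, le_rfl, h, Or.inl rfl⟩
    · exact ⟨_, h, le_rfl, Or.inr rfl⟩
  -- Both parities occur, so two empty classes would be one even and one odd. The remaining odd
  -- class consists of elements of level 1 only and is thinned by reflection against class 2 of X,
  -- which makes η too small.
  have hT1 : ∀ i < 4, ∀ j < i, csum (Y 1) 4 i = 0 → csum (Y 1) 4 j ≠ 0 := by
    intro i hi j hj hi0 hj0
    have hpz : ∀ p, p < 2 → csum (Y 1) 4 p = 0 → csum (Y 1) 4 (p + 2) = 0 → False := by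
      intro p hp hz hz'
      obtain ⟨y, hy, hyp⟩ := hpar p hp
      have hz1 := (Finset.sum_eq_zero_iff_of_nonneg fun r _ => d.Y_nonneg 1 r).1 hz
      have hz2 := (Finset.sum_eq_zero_iff_of_nonneg fun r _ => d.Y_nonneg 1 r).1 hz'
      have : y.val % 4 = p ∨ y.val % 4 = p + 2 := by omega
      rcases this with h | h
      · exact hy (hz1 y (by simpa [cls] using h))
      · exact hy (hz2 y (by simpa [cls] using h))
    have hodd : ∀ j, j = 1 ∨ j = 3 → csum (Y 1) 4 j ≤ 1 / 4 + 6 * e - csum X 4 2 ∨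
        csum (Y 1) 4 j = 0 := by
      intro j hj
      by_cases hz : csum (Y 1) 4 j = 0
      · exact Or.inr hz
      left
      have hYB : csum (Y 1) 4 j = csum (B 1) 4 j :=
        Finset.sum_congr rfl fun r hr => d.Y_eq_B_of_odd le_rfl (by
          have := (Finset.mem_filter.1 hr).2
          omega)
      have := d.BX_csum (p := 3) le_rfl (by norm_num) rfl j (by omega) hz j (by omega)
      rw [hYB]
      rcases hj with rfl | rfl <;> norm_num at this <;> linarith
    have o1 := hodd 1 (Or.inl rfl)
    have o3 := hodd 3 (Or.inr rfl)
    have c0 := d.csum_Y_le (k := 1) le_rfl (by norm_num) (i := 0) (by norm_num)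
    have c2 := d.csum_Y_le (k := 1) le_rfl (by norm_num) (i := 2) (by norm_num)
    have p0 := hpz 0 (by norm_num)
    have p1 := hpz 1 (by norm_num)
    rw [sum_eq_csum_four (Y 1)] at hη hη' hcon
    interval_cases i <;> interval_cases j
    · rcases o3 with o | o
      · linarith
      · exact p1 hi0 o
    · exact p0 hj0 hi0
    · rcases o3 with o | o
      · linarith
      · exact p1 hj0 o
    · rcases o1 with o | o
      · linarith
      · exact p1 o hi0
    · exact p1 hj0 hi0
    · rcases o1 with o | o
      · linarith
      · exact p1 o hi0
  have b1 := d.sum_B_le_of_sum_Y le_rfl (by norm_num) ha hμ0 hμ2 hT1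
  by_cases hY2 : ∃ y, Y 2 y ≠ 0
  swap
  · have := d.sum_B_eq le_rfl hY2
    rcases b1 with b1 | b1 <;> rcases hμ with h | h <;> linarith
  have s1 := d.sum_Y_eq (k := 1) le_rfl
  norm_num at s1
  -- Level 1 is thin, so most of η must come from doubled multipliers. For η up to about 7/12 the
  -- same step at level 2 makes level 3 too dense, whether or not level 4 is empty; for larger η the
  -- sharper bounds for the even classes contradict level 1 at once.
  have big2 : 66 / 100 ≤ ∑ r, Y 2 r := by
    rcases b1 with b1 | b1 <;> rcases hμ with h | h <;> linarith
  have b2 := d.sum_B_le_of_sum_Y (k := 2) (by norm_num) (by norm_num) ha hμ0 hμ2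
    (d.ne_zero_of_lt_sum (by norm_num) (by norm_num) (by linarith))
  by_cases hY3' : ∃ y, Y 3 y ≠ 0
  swap
  · have := d.sum_B_eq (k := 2) (by norm_num) hY3'
    rcases b2 with b2 | b2 <;> rcases hμ with h | h <;> linarith
  have u2 := hY3 hY3'
  by_cases hu : ∑ r, Y 1 r ≤ 7 / 12 + 1 / 1000
  · have s2 := d.sum_Y_eq (k := 2) (by norm_num)
    norm_num at s2
    have big3 : 7 / 10 ≤ ∑ r, Y 3 r := by
      rcases b1 with b1 | b1 <;> rcases b2 with b2 | b2 <;> rcases hμ with h | h <;> linarith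
    have b3 := d.sum_B_le_of_sum_Y (k := 3) (by norm_num) (by norm_num) ha hμ0 hμ2
      (d.ne_zero_of_lt_sum (by norm_num) (by norm_num) (by linarith))
    by_cases hY4' : ∃ y, Y 4 y ≠ 0
    · have := hY4 hY4'
      linarith
    · have := d.sum_B_eq (k := 3) (by norm_num) hY4'
      rcases b3 with b3 | b3 <;> rcases hμ with h | h <;> linarith
  · have g0 : csum X 4 0 ≤ 5 / 72 + 2 / 10 ^ 8 := by
      rcases e0 with h | h | ⟨-, h⟩
      · linarith
      · linarith
      · have := h hY2; linarith
    have g2 : csum X 4 2 ≤ 5 / 72 + 2 / 10 ^ 8 := by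
      rcases e2 with h | h | ⟨-, h⟩
      · linarith
      · linarith
      · have := h hY2; linarith
    rcases b1 with b1 | b1 <;> rcases hμ with h | h <;> linarith

/-- Without a second level Y 1 and B 1 have the same total, and reflection in 3y pairs B 1 with X.
-/
theorem sum_X_add_sum_Y_le (d : LocalDensities e X B Y) {y : ZMod 24} (hy : Y 1 y ≠ 0)
    (h2 : ¬ ∃ y, Y 2 y ≠ 0) : ∑ r, X r + ∑ r, Y 1 r ≤ 1 + 24 * e := by
  rw [d.sum_B_eq le_rfl h2]
  have h := d.BX 1 le_rfl (by norm_num) y hy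
  have hX : ∑ r, X r = ∑ r, X ((2 ^ 1 + 1) * y - r) :=
    (Equiv.sum_comp (Equiv.subLeft ((2 ^ 1 + 1) * y)) X).symm
  rw [hX, add_comm, ← Finset.sum_add_distrib]
  have := Finset.sum_le_card_nsmul Finset.univ _ _ fun r _ => h r
  refine this.trans ?_
  rw [Finset.card_univ, ZMod.card, nsmul_eq_mul]
  push_cast
  linarith

/-- The local bound. -/
theorem two_mul_sum_X_add_sum_Y_le (d : LocalDensities e X B Y) (he : 0 ≤ e)
    (he' : e ≤ 1 / 10 ^ 11) (hne : ∃ y, Y 1 y ≠ 0)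
    (hY2 : (∃ y, Y 2 y ≠ 0) → ∑ r, Y 1 r ≤ 2 / 3 + 3 / 10 ^ 8)
    (hY3 : (∃ y, Y 3 y ≠ 0) → ∑ r, Y 2 r ≤ 2 / 3 + 3 / 10 ^ 8)
    (hY4 : (∃ y, Y 4 y ≠ 0) → ∑ r, Y 3 r ≤ 2 / 3 + 3 / 10 ^ 8) :
    2 * ∑ r, X r + ∑ r, Y 1 r ≤ 4 / 3 + 5 / 10 ^ 8 ∧
    ((∃ y, Y 2 y ≠ 0) ∨ ∑ r, Y 1 r ≤ 7 / 12 →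
      2 * ∑ r, X r + ∑ r, Y 1 r ≤ 4 / 3 - 1 / 3900) := by
  -- Here f + η ≤ 1 suffices, since 2f + η ≤ 2 − η.
  by_cases hηbig : ¬ (∃ y, Y 2 y ≠ 0) ∧ 2 / 3 < ∑ r, Y 1 r
  · obtain ⟨y, hy⟩ := hne
    have := d.sum_X_add_sum_Y_le hy hηbig.1
    refine ⟨by linarith, fun h => ?_⟩
    rcases h with h | h
    · exact absurd h hηbig.1
    · linarith
  have hη : ∑ r, Y 1 r ≤ 2 / 3 + 3 / 10 ^ 8 := by
    by_cases h : ∃ y, Y 2 y ≠ 0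
    · exact hY2 h
    · have : ¬ 2 / 3 < ∑ r, Y 1 r := fun hc => hηbig ⟨h, hc⟩
      linarith
  have weaken : 2 * ∑ r, X r + ∑ r, Y 1 r ≤ 4 / 3 - 1 / 3900 →
      2 * ∑ r, X r + ∑ r, Y 1 r ≤ 4 / 3 + 5 / 10 ^ 8 ∧
    ((∃ y, Y 2 y ≠ 0) ∨ ∑ r, Y 1 r ≤ 7 / 12 →
      2 * ∑ r, X r + ∑ r, Y 1 r ≤ 4 / 3 - 1 / 3900) := fun h => ⟨by linarith, fun _ => h⟩
  obtain ⟨y₀, hy₀⟩ := hne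
  have hX := d.X_le hy₀
  have hf := sum_eq_csum_four X
  by_cases hpar : ∀ p, p < 2 → ∃ y, Y 1 y ≠ 0 ∧ y.val % 2 = p
  swap
  · push Not at hpar
    obtain ⟨p, hp, hpY⟩ := hpar
    have hq : ∀ y, Y 1 y ≠ 0 → y.val % 2 = 1 - p := fun y hy => by
      have := hpY y hy
      omega
    have hhalf : ∑ r, Y 1 r ≤ 1 / 2 + 12 * e := by
      rw [sum_eq_csum_four]
      have hz : ∀ i, i % 2 = p → csum (Y 1) 4 i = 0 := fun i hi => csum_eq_zero fun r hr => by
        by_contra h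
        have := hq r h
        omega
      have c0 := d.csum_Y_le (k := 1) le_rfl (by norm_num) (i := 0) (by norm_num)
      have c1 := d.csum_Y_le (k := 1) le_rfl (by norm_num) (i := 1) (by norm_num)
      have c2 := d.csum_Y_le (k := 1) le_rfl (by norm_num) (i := 2) (by norm_num)
      have c3 := d.csum_Y_le (k := 1) le_rfl (by norm_num) (i := 3) (by norm_num)
      have hp01 : p = 0 ∨ p = 1 := by omega
      rcases hp01 with rfl | rfl
      · have := hz 0 rfl; have := hz 2 rfl; linarith
      · have := hz 1 rfl; have := hz 3 rfl; linarith
    -- The even classes are at most 1/4 − η/2 and 1/8, the odd ones 1/4 together, so 2f + η is about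
    -- 5/4 at most.
    have hs := d.X_le_of_single_parity (p := 1 - p) (by omega) hq hhalf
    apply weaken
    have hp01 : p = 0 ∨ p = 1 := by omega
    rcases hp01 with rfl | rfl
    · norm_num at hs; linarith
    · norm_num at hs; linarith
  have e0 := d.X_even_le he he' hpar (Or.inl rfl)
  have e2 := d.X_even_le he he' hpar (Or.inr rfl)
  -- Even classes of (1 − η)/6 and odd ones of 1/4 together give 7/6 + η/3.
  by_cases hlow : ∑ r, Y 1 r < 1 / 2 - 1 / 1000
  · apply weaken
    have g0 : csum X 4 0 ≤ (1 - ∑ r, Y 1 r) / 6 + 1 / 10 ^ 8 := by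
      rcases e0 with h | h | ⟨h, -⟩ <;> linarith
    have g2 : csum X 4 2 ≤ (1 - ∑ r, Y 1 r) / 6 + 1 / 10 ^ 8 := by
      rcases e2 with h | h | ⟨h, -⟩ <;> linarith
    linarith
  push Not at hlow
  by_cases h1 : csum X 4 1 = 0
  · exact weaken (d.not_single_odd_class he he' hpar (Or.inr rfl) h1 hlow hη hY3 hY4)
  by_cases h3 : csum X 4 3 = 0
  · exact weaken (d.not_single_odd_class he he' hpar (Or.inl rfl) h3 hlow hη hY3 hY4)
  by_cases hmid : ∑ r, Y 1 r ≤ 7 / 12 + 1 / 1000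
  · apply weaken
    have hodd := d.X_odd_not_large he' hpar h1 h3 hmid hlow
    have g0 : csum X 4 0 ≤ 1 / 12 + 1 / 5000 := by rcases e0 with h | h | ⟨h, -⟩ <;> linarith
    have g2 : csum X 4 2 ≤ 1 / 12 + 1 / 5000 := by rcases e2 with h | h | ⟨h, -⟩ <;> linarith
    linarith
  push Not at hmid
  -- The tight case: odd classes of (1 − η)/4 and even ones of 1/12 give exactly 4/3. A second level
  -- of multipliers lowers 1/12 to 5/72 = (1 − 7/12)/6.
  have hb := d.X_odd_le
  have hb1 := hb.2 h3
  have hb3 := hb.1 h1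
  refine ⟨?_, fun h => ?_⟩
  · have g0 : csum X 4 0 ≤ 1 / 12 + 1 / 10 ^ 8 := by rcases e0 with h | h | ⟨h, -⟩ <;> linarith
    have g2 : csum X 4 2 ≤ 1 / 12 + 1 / 10 ^ 8 := by rcases e2 with h | h | ⟨h, -⟩ <;> linarith
    linarith
  · have hY2' : ∃ y, Y 2 y ≠ 0 := by
      rcases h with h | h
      · exact h
      · linarith
    have g0 : csum X 4 0 ≤ 5 / 72 + 2 / 10 ^ 8 := by
      rcases e0 with h | h | ⟨-, h⟩
      · linarith
      · linarith
      · have := h hY2'; linarith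
    have g2 : csum X 4 2 ≤ 5 / 72 + 2 / 10 ^ 8 := by
      rcases e2 with h | h | ⟨-, h⟩
      · linarith
      · linarith
      · have := h hY2'; linarith
    linarith

end LocalDensities

/-! ### Counting in residue classes and equidistributed cells -/

open Classical in
/-- The elements of `S` in `[a, b)`. -/
noncomputable def elts (S : Set ℕ) (a b : ℕ) : Finset ℕ := (Finset.Ico a b).filter (· ∈ S)

theorem mem_elts {S : Set ℕ} {a b x : ℕ} : x ∈ elts S a b ↔ (a ≤ x ∧ x < b) ∧ x ∈ S := by
  classical
  simp [elts]

/-- The number of elements of `S` in `[a, b)`. -/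
noncomputable def cnt (S : Set ℕ) (a b : ℕ) : ℕ := (elts S a b).card

/-- The elements of `S` in a residue class modulo 24. -/
def resCls (S : Set ℕ) (r : ZMod 24) : Set ℕ := {s | s ∈ S ∧ (s : ZMod 24) = r}

theorem cnt_le {S : Set ℕ} {a b : ℕ} : cnt S a b ≤ b - a := by
  classical
  rw [cnt, ← Nat.card_Ico]
  exact Finset.card_le_card (Finset.filter_subset _ _)

theorem cnt_mono {S T : Set ℕ} {a b : ℕ} (h : ∀ s, a ≤ s → s < b → s ∈ S → s ∈ T) :
    cnt S a b ≤ cnt T a b := by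
  refine Finset.card_le_card fun s hs => ?_
  obtain ⟨h1, h2⟩ := mem_elts.1 hs
  exact mem_elts.2 ⟨h1, h s h1.1 h1.2 h2⟩

theorem exists_mem_of_cnt_pos {S : Set ℕ} {a b : ℕ} (h : 0 < cnt S a b) :
    ∃ s ∈ S, a ≤ s ∧ s < b := by
  classical
  obtain ⟨s, hs⟩ := Finset.card_pos.1 h
  obtain ⟨h1, h2⟩ := mem_elts.1 hs
  exact ⟨s, h2, h1⟩

/-- A residue class has at most `ℓ / g + 1` elements in an interval of length `ℓ`. -/
theorem cnt_le_of_modEq {S : Set ℕ} {a b g v : ℕ} (hg : 0 < g) (hab : a ≤ b)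
    (h : ∀ s ∈ S, a ≤ s → s < b → s ≡ v [MOD g]) : (cnt S a b : ℝ) ≤ (b - a : ℝ) / g + 1 := by
  classical
  have h1 : cnt S a b ≤ ((Finset.Ico a b).filter fun x => x ≡ v [MOD g]).card := by
    refine Finset.card_le_card fun s hs => ?_
    obtain ⟨h1, h2⟩ := mem_elts.1 hs
    exact Finset.mem_filter.2 ⟨Finset.mem_Ico.2 h1, h s h2 h1.1 h1.2⟩
  have h2 := Nat.Ico_filter_modEq_card a b hg v
  have h3 : ((cnt S a b : ℤ) : ℝ) ≤ ((max (⌈((b : ℚ) - v) / g⌉ - ⌈((a : ℚ) - v) / g⌉) 0 : ℤ) : ℝ) := by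
    rw [← h2]; exact_mod_cast h1
  have hg' : (0 : ℝ) < g := by exact_mod_cast hg
  have hab' : (0 : ℝ) ≤ (b - a : ℝ) / g := div_nonneg (by
    have : (a : ℝ) ≤ b := by exact_mod_cast hab
    linarith) hg'.le
  have h4 : ((⌈((b : ℚ) - v) / g⌉ : ℤ) : ℝ) < ((b : ℝ) - v) / g + 1 := by
    have := Int.ceil_lt_add_one (((b : ℚ) - v) / g)
    exact_mod_cast this
  have h5 : ((a : ℝ) - v) / g ≤ ((⌈((a : ℚ) - v) / g⌉ : ℤ) : ℝ) := by
    have := Int.le_ceil (((a : ℚ) - v) / g)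
    exact_mod_cast this
  have h6 : ((b : ℝ) - v) / g - ((a : ℝ) - v) / g = (b - a : ℝ) / g := by ring
  push_cast at h3
  refine h3.trans (max_le ?_ ?_) <;> linarith

/-- The counted elements u and the reflections s − v lie in one class modulo 24 and are distinct. -/
theorem cnt_add_cnt_reflect_le {U V : Set ℕ} {a l s : ℕ} {r : ZMod 24} (hs : a + l ≤ s + 1)
    (h : ∀ u ∈ U, ∀ v ∈ V, a ≤ u → u < a + l → u + v ≠ s) :
    (cnt (resCls U r) a (a + l) : ℝ) + cnt (resCls V (s - r)) (s + 1 - (a + l)) (s + 1 - a) ≤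
      (l : ℝ) / 24 + 1 := by
  classical
  set V' : Set ℕ := {u | u ≤ s ∧ s - u ∈ resCls V (s - r)} with hV'
  have h1 : cnt (resCls V (s - r)) (s + 1 - (a + l)) (s + 1 - a) ≤ cnt V' a (a + l) := by
    refine Finset.card_le_card_of_injOn (fun v => s - v) (fun v hv => ?_) fun v hv v' hv' hvv => ?_
    · obtain ⟨h1, h2⟩ := mem_elts.1 (Finset.mem_coe.1 hv)
      have hvs : v ≤ s := by omega
      refine Finset.mem_coe.2 (mem_elts.2 ⟨⟨?_, ?_⟩, ?_, ?_⟩)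
      · show a ≤ s - v; omega
      · show s - v < a + l; omega
      · exact Nat.sub_le _ _
      · show s - (s - v) ∈ _
        rwa [Nat.sub_sub_self hvs]
    · have h1 := (mem_elts.1 (Finset.mem_coe.1 hv)).1
      have h2 := (mem_elts.1 (Finset.mem_coe.1 hv')).1
      have hvv : s - v = s - v' := hvv
      omega
  have h2 : cnt (resCls U r) a (a + l) + cnt V' a (a + l) = cnt (resCls U r ∪ V') a (a + l) := by
    rw [cnt, cnt, cnt, ← Finset.card_union_of_disjoint]
    · congr 1
      ext x
      simp only [Finset.mem_union, mem_elts, Set.mem_union]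
      tauto
    · rw [Finset.disjoint_left]
      intro x hx hx'
      obtain ⟨hx1, hx2⟩ := mem_elts.1 hx
      obtain ⟨-, hx3⟩ := mem_elts.1 hx'
      exact h x hx2.1 _ hx3.2.1 hx1.1 hx1.2 (by have := hx3.1; omega)
  have h3 : (cnt (resCls U r ∪ V') a (a + l) : ℝ) ≤ ((a + l : ℕ) - a : ℝ) / (24 : ℕ) + 1 := by
    refine cnt_le_of_modEq (v := r.val) (by norm_num) (by omega) fun x hx _ _ => ?_
    rw [← ZMod.natCast_eq_natCast_iff, ZMod.natCast_zmod_val]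
    rcases hx with hx | hx
    · exact hx.2
    · have := hx.2.2
      rw [Nat.cast_sub hx.1] at this
      linear_combination -this
  push_cast at h3
  have h4 : (cnt (resCls U r) a (a + l) : ℝ) +
      cnt (resCls V (s - r)) (s + 1 - (a + l)) (s + 1 - a) ≤ cnt (resCls U r ∪ V') a (a + l) := by
    exact_mod_cast (by omega)
  have h5 : ((a : ℝ) + l - a) / 24 = l / 24 := by ring
  linarith

/-- `S` is equidistributed in residue classes modulo 24 on the cell `[p, p + L)`. -/
structure Regular (S : Set ℕ) (p L : ℕ) (ρ : ZMod 24 → ℝ) (E ε : ℝ) : Prop where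
  count : ∀ r a b, p ≤ a → a ≤ b → b ≤ p + L →
    |(cnt (resCls S r) a b : ℝ) - ρ r * (b - a)| ≤ E
  dich : ∀ r, ρ r = 0 ∨ ε ≤ ρ r
  empty : ∀ r s, ρ r = 0 → s ∈ S → p ≤ s → s < p + L → (s : ZMod 24) ≠ r

namespace Regular
variable {S U V : Set ℕ} {p L p' L' : ℕ} {ρ ρ' : ZMod 24 → ℝ} {E ε : ℝ}

theorem nonneg (h : Regular S p L ρ E ε) (hε : 0 ≤ ε) (r : ZMod 24) : 0 ≤ ρ r := by
  rcases h.dich r with h | h <;> linarith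

theorem ge (h : Regular S p L ρ E ε) {r : ZMod 24} (hr : ρ r ≠ 0) : ε ≤ ρ r :=
  (h.dich r).resolve_left hr

theorem le_cnt (h : Regular S p L ρ E ε) (r : ZMod 24) {a b : ℕ} (h1 : p ≤ a) (h2 : a ≤ b)
    (h3 : b ≤ p + L) : ρ r * (b - a) - E ≤ cnt (resCls S r) a b := by
  have := (abs_le.1 (h.count r a b h1 h2 h3)).1
  linarith

theorem cnt_le (h : Regular S p L ρ E ε) (r : ZMod 24) {a b : ℕ} (h1 : p ≤ a) (h2 : a ≤ b)
    (h3 : b ≤ p + L) : (cnt (resCls S r) a b : ℝ) ≤ ρ r * (b - a) + E := by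
  have := (abs_le.1 (h.count r a b h1 h2 h3)).2
  linarith

theorem le_inv (h : Regular S p L ρ E ε) (hL : 0 < L) (r : ZMod 24) :
    ρ r ≤ 1 / 24 + (1 + E) / L := by
  have h1 := h.le_cnt r le_rfl (Nat.le_add_right p L) le_rfl
  have h2 := cnt_le_of_modEq (S := resCls S r) (v := r.val) (g := 24) (by norm_num)
    (Nat.le_add_right p L) fun s hs _ _ => by
      rw [← ZMod.natCast_eq_natCast_iff, ZMod.natCast_zmod_val]; exact hs.2
  push_cast at h1 h2
  have hL' : (0 : ℝ) < L := by exact_mod_cast hL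
  have : ρ r * L ≤ L / 24 + 1 + E := by linarith
  calc ρ r = ρ r * L / L := by field_simp
    _ ≤ (L / 24 + 1 + E) / L := by gcongr
    _ = _ := by field_simp; ring

theorem exists_mem (h : Regular S p L ρ E ε) {r : ZMod 24} (hr : ρ r ≠ 0) {a b : ℕ} (h1 : p ≤ a)
    (h2 : a ≤ b) (h3 : b ≤ p + L) (hE : E < ε * (b - a)) :
    ∃ s ∈ S, (s : ZMod 24) = r ∧ a ≤ s ∧ s < b := by
  have h4 := h.le_cnt r h1 h2 h3
  have h5 : (0 : ℝ) ≤ b - a := by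
    have : (a : ℝ) ≤ b := by exact_mod_cast h2
    linarith
  have h6 := mul_le_mul_of_nonneg_right (h.ge hr) h5
  have : (0 : ℝ) < cnt (resCls S r) a b := by linarith
  obtain ⟨s, hs, hs'⟩ := exists_mem_of_cnt_pos (Nat.cast_pos.1 this)
  exact ⟨s, hs.1, hs.2, hs'⟩

theorem ne_zero_of_mem (h : Regular S p L ρ E ε) {s : ℕ} (hs : s ∈ S) (h1 : p ≤ s)
    (h2 : s < p + L) : ρ s ≠ 0 := fun h0 => h.empty _ s h0 hs h1 h2 rfl

/-- Reflection inequality for densities. -/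
theorem add_le (hU : Regular U p L ρ E ε) (hV : Regular V p' L' ρ' E ε) {a l s : ℕ} (hl : 0 < l)
    (ha : p ≤ a) (ha' : a + l ≤ p + L) (hs : p' + (a + l) ≤ s + 1) (hs' : s + 1 ≤ p' + L' + a)
    (h : ∀ u ∈ U, ∀ v ∈ V, a ≤ u → u < a + l → u + v ≠ s) (r : ZMod 24) :
    ρ r + ρ' (s - r) ≤ 1 / 24 + (1 + 2 * E) / l := by
  have h1 := cnt_add_cnt_reflect_le (r := r) (by omega) h
  have h2 := hU.le_cnt r ha (Nat.le_add_right a l) ha'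
  have h3 := hV.le_cnt (s - r) (a := s + 1 - (a + l)) (b := s + 1 - a) (by omega) (by omega)
    (by omega)
  have h4 : ((s + 1 - a : ℕ) : ℝ) - ((s + 1 - (a + l) : ℕ) : ℝ) = l := by
    rw [Nat.cast_sub (by omega), Nat.cast_sub (by omega)]
    push_cast; ring
  rw [h4] at h3
  push_cast at h2
  have hl' : (0 : ℝ) < l := by exact_mod_cast hl
  have : (ρ r + ρ' (s - r)) * l ≤ l / 24 + (1 + 2 * E) := by linarith
  calc ρ r + ρ' (s - r) = (ρ r + ρ' (s - r)) * l / l := by field_simp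
    _ ≤ (l / 24 + (1 + 2 * E)) / l := by gcongr
    _ = _ := by field_simp

end Regular

/-! ### Common differences, translates, and concentration -/

/-- A finite set in which every realised short difference is realised by more than half of the
elements lies in a residue class. -/
theorem exists_common_difference {Q : Finset ℕ} {D : ℕ} {κ : ℝ} (hκ : 1 / 2 < κ)
    (h1 : ∀ x ∈ Q, ∀ d, 0 < d → d ≤ D → x + d ∈ Q →
      κ * Q.card ≤ (Q.filter fun v => v + d ∈ Q).card)
    (h2 : ∀ x ∈ Q, ∀ z ∈ Q, x < z → ∃ x' ∈ Q, x < x' ∧ x' ≤ x + D)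
    (hne : ∃ x ∈ Q, ∃ z ∈ Q, x < z) :
    ∃ g, 0 < g ∧ g ≤ D ∧ (∃ x ∈ Q, x + g ∈ Q) ∧ (∀ x ∈ Q, ∀ z ∈ Q, x ≡ z [MOD g]) ∧
      ∀ j, 0 < j → j * g ≤ D → κ * Q.card ≤ (Q.filter fun v => v + j * g ∈ Q).card := by
  classical
  set F : ℕ → Finset ℕ := fun d => Q.filter fun v => v + d ∈ Q with hF
  have hQ : 0 < (Q.card : ℝ) := by
    obtain ⟨x, hx, -⟩ := hne
    exact_mod_cast Finset.card_pos.2 ⟨x, hx⟩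
  have inter : ∀ X Y : Finset ℕ, X ⊆ Q → Y ⊆ Q → κ * Q.card ≤ X.card → κ * Q.card ≤ Y.card →
      (X ∩ Y).Nonempty := by
    intro X Y hX hY hXc hYc
    rw [← Finset.card_pos]
    by_contra hc
    have h0 : (X ∩ Y).card = 0 := by omega
    have h3 := Finset.card_union_add_card_inter X Y
    have h4 := Finset.card_le_card (Finset.union_subset hX hY)
    have h5 : ((X.card + Y.card : ℕ) : ℝ) ≤ Q.card := by exact_mod_cast (by omega)
    push_cast at h5
    nlinarith
  have big : ∀ d, 0 < d → d ≤ D → (∃ x ∈ Q, x + d ∈ Q) → κ * Q.card ≤ (F d).card :=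
    fun d hd hdD ⟨x, hx, hxd⟩ => h1 x hx d hd hdD hxd
  -- Both differences start from more than half of the points, hence from a common point v; then v +
  -- d' and v + d differ by d − d'.
  have hsub : ∀ d d', 0 < d' → d' < d → d ≤ D → (∃ x ∈ Q, x + d ∈ Q) → (∃ x ∈ Q, x + d' ∈ Q) →
      ∃ x ∈ Q, x + (d - d') ∈ Q := by
    intro d d' hd' hdd hdD hx hx'
    obtain ⟨v, hv⟩ := inter (F d) (F d') (Finset.filter_subset _ _) (Finset.filter_subset _ _)
      (big d (by omega) hdD hx) (big d' hd' (by omega) hx')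
    obtain ⟨hv1, hv2⟩ := Finset.mem_inter.1 hv
    refine ⟨v + d', (Finset.mem_filter.1 hv2).2, ?_⟩
    rw [show v + d' + (d - d') = v + d by omega]
    exact (Finset.mem_filter.1 hv1).2
  have hadd : ∀ d d', 0 < d → 0 < d' → d ≤ D → d' ≤ D → (∃ x ∈ Q, x + d ∈ Q) →
      (∃ x ∈ Q, x + d' ∈ Q) → ∃ x ∈ Q, x + (d + d') ∈ Q := by
    intro d d' hd hd' hdD hd'D hx hx'
    have hGc : ((F d).image fun v => v + d).card = (F d).card :=
      Finset.card_image_of_injective _ (add_left_injective d)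
    obtain ⟨v, hv⟩ := inter ((F d).image fun v => v + d) (F d')
      (fun v hv => by
        obtain ⟨u, hu, rfl⟩ := Finset.mem_image.1 hv
        exact (Finset.mem_filter.1 hu).2) (Finset.filter_subset _ _)
      (by rw [hGc]; exact big d hd hdD hx) (big d' hd' hd'D hx')
    obtain ⟨hv1, hv2⟩ := Finset.mem_inter.1 hv
    obtain ⟨u, hu, rfl⟩ := Finset.mem_image.1 hv1
    refine ⟨u, (Finset.mem_filter.1 hu).1, ?_⟩
    rw [← add_assoc]
    exact (Finset.mem_filter.1 hv2).2
  have hex : ∃ d, 0 < d ∧ d ≤ D ∧ ∃ x ∈ Q, x + d ∈ Q := by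
    obtain ⟨x, hx, z, hz, hxz⟩ := hne
    obtain ⟨x', hx', hlt, hle⟩ := h2 x hx z hz hxz
    exact ⟨x' - x, by omega, by omega, x, hx, by rwa [Nat.add_sub_cancel' hlt.le]⟩
  obtain ⟨hg0, hgD, hgx⟩ := Nat.find_spec hex
  set g := Nat.find hex with hg
  have hmin : ∀ d, 0 < d → d < g → ¬ ∃ x ∈ Q, x + d ∈ Q := fun d hd hdg hx =>
    Nat.find_min hex hdg ⟨hd, by omega, hx⟩
  have hdvd : ∀ d, d ≤ D → 0 < d → (∃ x ∈ Q, x + d ∈ Q) → g ∣ d := by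
    intro d
    induction d using Nat.strong_induction_on with
    | _ d ih =>
    intro hdD hd hx
    rcases lt_trichotomy d g with h | h | h
    · exact absurd hx (hmin d hd h)
    · exact h ▸ dvd_rfl
    · have := ih (d - g) (by omega) (by omega) (by omega) (hsub d g hg0 h hdD hx hgx)
      exact (Nat.dvd_sub_iff_left h.le dvd_rfl).1 this
  refine ⟨g, hg0, hgD, hgx, ?_, ?_⟩
  · have key : ∀ k, ∀ x ∈ Q, ∀ z ∈ Q, x < z → z - x ≤ k → x ≡ z [MOD g] := by
      intro k
      induction k with
      | zero => intro x _ z _ h1 h2; omega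
      | succ k ih =>
        intro x hx z hz hxz hk
        have short : ∀ z ∈ Q, x < z → z ≤ x + D → x ≡ z [MOD g] := fun z hz hxz hzD =>
          (Nat.modEq_iff_dvd' hxz.le).2 (hdvd (z - x) (by omega) (by omega)
            ⟨x, hx, by rwa [Nat.add_sub_cancel' hxz.le]⟩)
        by_cases hzD : z ≤ x + D
        · exact short z hz hxz hzD
        · obtain ⟨x', hx', hlt, hle⟩ := h2 x hx z hz hxz
          exact (short x' hx' hlt hle).trans (ih x' hx' z hz (by omega) (by omega))
    intro x hx z hz
    rcases lt_trichotomy x z with h | h | h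
    · exact key _ x hx z hz h le_rfl
    · rw [h]
    · exact (key _ z hz x hx h le_rfl).symm
  · intro j hj hjD
    have : ∀ j, 0 < j → j * g ≤ D → ∃ x ∈ Q, x + j * g ∈ Q := by
      intro j
      induction j with
      | zero => intro h; omega
      | succ j ih =>
        intro _ hD
        rcases Nat.eq_zero_or_pos j with rfl | hj
        · simpa using hgx
        · rw [Nat.succ_mul] at hD ⊢
          exact hadd (j * g) g (Nat.mul_pos hj hg0) hg0 (by omega) hgD (ih hj (by omega)) hgx
    exact big _ (Nat.mul_pos hj hg0) hjD (this j hj hjD)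

/-- The elements of `S` whose residue modulo 24 lies in `C`. -/
def inClasses (S : Set ℕ) (C : Finset (ZMod 24)) : Set ℕ := {s | s ∈ S ∧ (s : ZMod 24) ∈ C}

theorem cnt_inClasses (S : Set ℕ) (C : Finset (ZMod 24)) (a b : ℕ) :
    cnt (inClasses S C) a b = ∑ r ∈ C, cnt (resCls S r) a b := by
  classical
  have := Finset.card_eq_sum_card_fiberwise (f := fun s : ℕ => (s : ZMod 24))
    (s := elts (inClasses S C) a b) (t := C) fun s hs => (mem_elts.1 hs).2.2
  rw [cnt, this]
  refine Finset.sum_congr rfl fun r hr => ?_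
  rw [cnt]
  congr 1
  ext s
  simp only [Finset.mem_filter, mem_elts, inClasses, resCls, Set.mem_ofPred_eq]
  constructor
  · rintro ⟨⟨h1, h2, h3⟩, h4⟩; exact ⟨h1, h2, h4⟩
  · rintro ⟨h1, h2, h3⟩; exact ⟨⟨h1, h2, h3 ▸ hr⟩, h3⟩

namespace Regular
variable {S : Set ℕ} {p L : ℕ} {ρ : ZMod 24 → ℝ} {E ε : ℝ}

theorem le_cnt_inClasses (h : Regular S p L ρ E ε) (C : Finset (ZMod 24)) {a b : ℕ} (h1 : p ≤ a)
    (h2 : a ≤ b) (h3 : b ≤ p + L) :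
    (∑ r ∈ C, ρ r) * (b - a) - C.card * E ≤ cnt (inClasses S C) a b := by
  rw [cnt_inClasses]
  push_cast
  have := Finset.sum_le_sum fun r (_ : r ∈ C) => h.le_cnt r h1 h2 h3
  rw [Finset.sum_sub_distrib, Finset.sum_const, nsmul_eq_mul, ← Finset.sum_mul] at this
  exact this

theorem cnt_inClasses_le (h : Regular S p L ρ E ε) (C : Finset (ZMod 24)) {a b : ℕ} (h1 : p ≤ a)
    (h2 : a ≤ b) (h3 : b ≤ p + L) :
    (cnt (inClasses S C) a b : ℝ) ≤ (∑ r ∈ C, ρ r) * (b - a) + C.card * E := by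
  rw [cnt_inClasses]
  push_cast
  have := Finset.sum_le_sum fun r (_ : r ∈ C) => h.cnt_le r h1 h2 h3
  rw [Finset.sum_add_distrib, Finset.sum_const, nsmul_eq_mul, ← Finset.sum_mul] at this
  exact this

end Regular

/-- The translates of quadruples. -/
def quadShift (T : Set ℕ) (x : ℕ) : Set ℕ := {v | ∃ y ∈ T, 4 * y = v + x}

theorem cnt_le_cnt_quadShift (T : Set ℕ) (x a l : ℕ) :
    cnt T ((a + x + 3) / 4) ((a + l + x + 3) / 4) ≤ cnt (quadShift T x) a (a + l) := by
  refine Finset.card_le_card_of_injOn (fun y => 4 * y - x) (fun y hy => ?_) fun y hy z hz hyz => ?_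
  · obtain ⟨h1, h2⟩ := mem_elts.1 (Finset.mem_coe.1 hy)
    refine Finset.mem_coe.2 (mem_elts.2 ⟨⟨?_, ?_⟩, y, h2, ?_⟩)
    · show a ≤ 4 * y - x; omega
    · show 4 * y - x < a + l; omega
    · show 4 * y = 4 * y - x + x; omega
  · have h1 := (mem_elts.1 (Finset.mem_coe.1 hy)).1
    have h2 := (mem_elts.1 (Finset.mem_coe.1 hz)).1
    have hyz : 4 * y - x = 4 * z - x := hyz
    omega

theorem cnt_add_cnt_le_of_disjoint {S T : Set ℕ} {a b g v : ℕ} (hg : 0 < g) (hab : a ≤ b)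
    (hS : ∀ s ∈ S, a ≤ s → s < b → s ≡ v [MOD g]) (hT : ∀ s ∈ T, a ≤ s → s < b → s ≡ v [MOD g])
    (hST : ∀ s ∈ S, a ≤ s → s < b → s ∉ T) : (cnt S a b : ℝ) + cnt T a b ≤ (b - a : ℝ) / g + 1 := by
  classical
  have h2 : cnt S a b + cnt T a b = cnt (S ∪ T) a b := by
    rw [cnt, cnt, cnt, ← Finset.card_union_of_disjoint]
    · congr 1
      ext x
      simp only [Finset.mem_union, mem_elts, Set.mem_union]
      tauto
    · rw [Finset.disjoint_left]
      intro x hx hx'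
      obtain ⟨h1, h2⟩ := mem_elts.1 hx
      exact hST x h2 h1.1 h1.2 (mem_elts.1 hx').2
  have h3 := cnt_le_of_modEq (S := S ∪ T) hg hab fun s hs h1 h2 => hs.elim (hS s · h1 h2) (hT s · h1 h2)
  rw [← h2] at h3
  push_cast at h3
  exact h3

section shift
variable {A D : Set ℕ} {p q : ℕ} {ρ σ : ZMod 24 → ℝ} {E ε : ℝ}

/-- For x near the centre of the cell of A and u in its middle quarter, (u + x)/4 stays inside the
cell [p, p + 8q) of multipliers. -/
theorem half_window (q : ℕ) {p x : ℕ} (hx : 2 * p + 6 * q ≤ x) (hx' : x < 2 * p + 10 * q) :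
    p ≤ (2 * p + 6 * q + x + 3) / 4 ∧
    (2 * p + 6 * q + x + 3) / 4 ≤ (2 * p + 6 * q + 4 * q + x + 3) / 4 ∧
    (2 * p + 6 * q + 4 * q + x + 3) / 4 ≤ p + 8 * q ∧
    (q : ℝ) - 1 ≤ ((2 * p + 6 * q + 4 * q + x + 3) / 4 : ℕ) - ((2 * p + 6 * q + x + 3) / 4 : ℕ) := by
  refine ⟨by omega, by omega, by omega, ?_⟩
  have : (q : ℝ) + ((2 * p + 6 * q + x + 3) / 4 : ℕ) ≤ ((2 * p + 6 * q + 4 * q + x + 3) / 4 : ℕ) + 1 := by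
    exact_mod_cast (by omega)
  linarith

/-- Translation inequality: `A + x` misses `4D`. -/
theorem Regular.add_quarter_le (hA : Regular A (2 * p) (16 * q) ρ E ε)
    (hD : Regular D p (8 * q) σ E ε) (hE : 1 ≤ E) (hε : 0 ≤ ε) (hq : E ≤ q)
    (hσ : ∀ r, σ r ≤ 1) {x : ℕ} (hx : 2 * p + 6 * q ≤ x) (hx' : x < 2 * p + 10 * q)
    (h : ∀ u ∈ A, ∀ y ∈ D, 2 * p ≤ u → y < p + 8 * q → u + x ≠ 4 * y) (r : ZMod 24) :
    ρ r + 1 / 4 * ∑ y, (if 4 * y = r + x then σ y else 0) ≤ 1 / 24 + 16 * E / q := by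
  set C : Finset (ZMod 24) := Finset.univ.filter fun y => 4 * y = r + x with hC
  obtain ⟨w1, w2, w3, w4⟩ := half_window q hx hx'
  have hcard : C.card ≤ 4 := by
    have : ∀ t : ZMod 24, (Finset.univ.filter fun y : ZMod 24 => 4 * y = t).card ≤ 4 := by decide
    exact this _
  have hcardR : (C.card : ℝ) ≤ 4 := by exact_mod_cast hcard
  have h1 := hA.le_cnt r (a := 2 * p + 6 * q) (b := 2 * p + 6 * q + 4 * q) (by omega) (by omega)
    (by omega)
  have h2 := hD.le_cnt_inClasses C w1 w2 w3
  have h3 : (cnt (inClasses D C) ((2 * p + 6 * q + x + 3) / 4)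
      ((2 * p + 6 * q + 4 * q + x + 3) / 4) : ℝ) ≤
      cnt (quadShift (inClasses D C) x) (2 * p + 6 * q) (2 * p + 6 * q + 4 * q) := by
    exact_mod_cast cnt_le_cnt_quadShift (inClasses D C) x (2 * p + 6 * q) (4 * q)
  have h6 := cnt_add_cnt_le_of_disjoint (S := resCls A r)
    (T := quadShift (inClasses D C) x) (g := 24) (v := r.val)
    (a := 2 * p + 6 * q) (b := 2 * p + 6 * q + 4 * q)
    (by norm_num) (by omega)
    (fun s hs _ _ => by
      rw [← ZMod.natCast_eq_natCast_iff, ZMod.natCast_zmod_val]; exact hs.2)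
    (fun s hs _ _ => by
      obtain ⟨y, hy, hys⟩ := hs
      rw [← ZMod.natCast_eq_natCast_iff, ZMod.natCast_zmod_val]
      have h7 := (Finset.mem_filter.1 hy.2).2
      have h8 : ((4 * y : ℕ) : ZMod 24) = ((s + x : ℕ) : ZMod 24) := by rw [hys]
      push_cast at h8
      linear_combination h7 - h8)
    (by
      rintro s hs hs1 hs2 ⟨y, hy, hys⟩
      exact h s hs.1 y hy.1 (by omega) (by omega) hys.symm)
  have hsum : ∑ y, (if 4 * y = r + x then σ y else 0) = ∑ y ∈ C, σ y := by
    rw [hC, Finset.sum_filter]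
  have h7 : ∑ y ∈ C, σ y ≤ 4 := by
    have := Finset.sum_le_card_nsmul C σ 1 fun y _ => hσ y
    rw [nsmul_eq_mul, mul_one] at this
    linarith
  have h8 : 0 ≤ ∑ y ∈ C, σ y := Finset.sum_nonneg fun y _ => hD.nonneg hε y
  have h9 := mul_le_mul_of_nonneg_left w4 h8
  rw [hsum]
  push_cast at h1 h6
  have h10 : (C.card : ℝ) * E ≤ 4 * E := mul_le_mul_of_nonneg_right hcardR (by linarith)
  have hq' : (0 : ℝ) < q := by linarith
  have h11 : (ρ r + 1 / 4 * ∑ y ∈ C, σ y) * q ≤ q / 24 + 16 * E := by linarith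
  calc ρ r + 1 / 4 * ∑ y ∈ C, σ y = (ρ r + 1 / 4 * ∑ y ∈ C, σ y) * q / q := by field_simp
    _ ≤ (q / 24 + 16 * E) / q := by gcongr
    _ = _ := by field_simp

theorem natCast_mem_cls {s m i : ℕ} (hm : m ∣ 24) : (s : ZMod 24) ∈ cls m i ↔ s % m = i := by
  simp only [cls, Finset.mem_filter, Finset.mem_univ, true_and, ZMod.val_natCast]
  rw [Nat.mod_mod_of_dvd _ hm]

/-- A set and its translate cover a lot unless they overlap. -/
theorem exists_cover_translate {Q : Finset ℕ} {a b d : ℕ} (hQ : ∀ v ∈ Q, a ≤ v ∧ v < b) :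
    ∃ V : Finset ℕ, (∀ v ∈ V, a ≤ v ∧ v < b) ∧ (∀ v ∈ V, v ∈ Q ∨ ∃ u ∈ Q, v = u + d) ∧
      2 * Q.card ≤ V.card + d + (Q.filter fun v => v + d ∈ Q).card := by
  classical
  set R := (Q.image fun v => v + d).filter (· < b) with hR
  have hRc : Q.card ≤ R.card + d := by
    have h1 : R.card + ((Q.image fun v => v + d).filter fun v => ¬ v < b).card =
        (Q.image fun v => v + d).card := Finset.card_filter_add_card_filter_not _
    rw [Finset.card_image_of_injective _ (add_left_injective d)] at h1
    have h2 : ((Q.image fun v => v + d).filter fun v => ¬ v < b) ⊆ Finset.Ico b (b + d) := by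
      intro v hv
      obtain ⟨hv1, hv2⟩ := Finset.mem_filter.1 hv
      obtain ⟨u, hu, rfl⟩ := Finset.mem_image.1 hv1
      have := hQ u hu
      exact Finset.mem_Ico.2 (by omega)
    have h3 := Finset.card_le_card h2
    rw [Nat.card_Ico] at h3
    omega
  have hQR : (Q ∩ R).card ≤ (Q.filter fun v => v + d ∈ Q).card := by
    rw [← Finset.card_image_of_injective (Q.filter fun v => v + d ∈ Q) (add_left_injective d)]
    refine Finset.card_le_card fun v hv => ?_
    obtain ⟨hv1, hv2⟩ := Finset.mem_inter.1 hv
    obtain ⟨u, hu, rfl⟩ := Finset.mem_image.1 (Finset.mem_filter.1 hv2).1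
    exact Finset.mem_image.2 ⟨u, Finset.mem_filter.2 ⟨hu, hv1⟩, rfl⟩
  have hcard := Finset.card_union_add_card_inter Q R
  refine ⟨Q ∪ R, fun v hv => ?_, fun v hv => ?_, by omega⟩
  · rcases Finset.mem_union.1 hv with hv | hv
    · exact hQ v hv
    · obtain ⟨hv1, hv2⟩ := Finset.mem_filter.1 hv
      obtain ⟨u, hu, rfl⟩ := Finset.mem_image.1 hv1
      have := hQ u hu
      omega
  · rcases Finset.mem_union.1 hv with hv | hv
    · exact Or.inl hv
    · obtain ⟨u, hu, rfl⟩ := Finset.mem_image.1 (Finset.mem_filter.1 hv).1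
      exact Or.inr ⟨u, hu, rfl⟩

/-- If two elements of a class of `A` have difference `d`, then the complementary class of `A`
overlaps with its translate by `d`. -/
theorem Regular.overlap_ge (hD : Regular D p (8 * q) σ E ε) (hE : 1 ≤ E) {i j : ℕ} (hi : i < 4)
    (hij : (i + j) % 4 = 0) (hη0 : 0 ≤ ∑ r, σ r) (hη : ∑ r, σ r ≤ 2) {Q : Finset ℕ}
    (hQ : Q = elts (inClasses A (cls 4 i)) (2 * p + 6 * q) (2 * p + 6 * q + 4 * q))
    {x d : ℕ} (hxj : x % 4 = j) (hdj : (x + d) % 4 = j) (hx : 2 * p + 6 * q ≤ x)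
    (hx' : x < 2 * p + 10 * q)
    (h : ∀ u ∈ A, ∀ y ∈ D, 2 * p ≤ u → y < p + 8 * q → u + x ≠ 4 * y)
    (h' : ∀ u ∈ A, ∀ y ∈ D, 2 * p ≤ u → y < p + 8 * q → u + (x + d) ≠ 4 * y) :
    2 * (Q.card : ℝ) - d - 30 * E - (1 - ∑ r, σ r) * q ≤ (Q.filter fun v => v + d ∈ Q).card := by
  have hmem : ∀ v ∈ Q, (2 * p + 6 * q ≤ v ∧ v < 2 * p + 6 * q + 4 * q) ∧ v ∈ A ∧ v % 4 = i :=
    fun v hv => by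
      rwa [hQ, mem_elts, inClasses, Set.mem_ofPred_eq, natCast_mem_cls (by norm_num)] at hv
  obtain ⟨V, hV1, hV2, hV3⟩ := exists_cover_translate (d := d) fun v hv => (hmem v hv).1
  have hVc : V.card ≤ cnt (↑V) (2 * p + 6 * q) (2 * p + 6 * q + 4 * q) :=
    Finset.card_le_card fun v hv => mem_elts.2 ⟨hV1 v hv, hv⟩
  -- V, the part of Q ∪ (Q + d) in the window, avoids 4D − x: the points of Q because of x, those of
  -- Q + d because of x + d. All this happens in one class modulo 4, with q places in the window, of
  -- which 4D − x takes about ηq.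
  have h6 := cnt_add_cnt_le_of_disjoint (S := ↑V) (T := quadShift D x) (g := 4) (v := i)
    (a := 2 * p + 6 * q) (b := 2 * p + 6 * q + 4 * q) (by norm_num) (Nat.le_add_right _ _)
    (fun s hs _ _ => by
      rw [Nat.ModEq, Nat.mod_eq_of_lt hi]
      rcases hV2 s hs with hs | ⟨u, hu, rfl⟩
      · exact (hmem s hs).2.2
      · have := (hmem u hu).2.2
        clear hV1 hV2 hV3 hVc
        omega)
    (fun s hs _ _ => by
      obtain ⟨y, hy, hys⟩ := hs
      rw [Nat.ModEq, Nat.mod_eq_of_lt hi]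
      clear hV1 hV2 hV3 hVc
      omega)
    (by
      rintro s hs hs1 hs2 ⟨y, hy, hys⟩
      have hyb : y < p + 8 * q := by clear hV3 hVc; omega
      rcases hV2 s hs with hs | ⟨u, hu, rfl⟩
      · have := hmem s hs
        exact h s this.2.1 y hy ((Nat.le_add_right _ _).trans this.1.1) hyb hys.symm
      · have := hmem u hu
        exact h' u this.2.1 y hy ((Nat.le_add_right _ _).trans this.1.1) hyb
          (by rw [hys]; ring))
  obtain ⟨w1, w2, w3, w4⟩ := half_window q hx hx'
  have h2 := hD.le_cnt_inClasses Finset.univ w1 w2 w3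
  have h3 : cnt (inClasses D Finset.univ) ((2 * p + 6 * q + x + 3) / 4)
      ((2 * p + 6 * q + 4 * q + x + 3) / 4) ≤
      cnt (quadShift D x) (2 * p + 6 * q) (2 * p + 6 * q + 4 * q) :=
    (cnt_mono (T := D) fun s _ _ hs => hs.1).trans (cnt_le_cnt_quadShift D x _ (4 * q))
  have h3' : (cnt (inClasses D Finset.univ) ((2 * p + 6 * q + x + 3) / 4)
      ((2 * p + 6 * q + 4 * q + x + 3) / 4) : ℝ) ≤
      cnt (quadShift D x) (2 * p + 6 * q) (2 * p + 6 * q + 4 * q) := by exact_mod_cast h3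
  have hVc' : (V.card : ℝ) ≤ cnt (↑V) (2 * p + 6 * q) (2 * p + 6 * q + 4 * q) := by
    exact_mod_cast hVc
  have hV3' : 2 * (Q.card : ℝ) ≤ V.card + d + (Q.filter fun v => v + d ∈ Q).card := by
    exact_mod_cast hV3
  have h9 := mul_le_mul_of_nonneg_left w4 hη0
  rw [Finset.card_univ, ZMod.card] at h2
  push_cast at h6 h2
  linarith

end shift

section
variable {A D : Set ℕ} {p q : ℕ} {ρ σ : ZMod 24 → ℝ} {E ε : ℝ}

/-- Overlaps beyond one half yield a common difference g. Lying in one class modulo g bounds the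
density by about 1/g from above; counting pairs at distances jg in two ways bounds it by about κ/g
from below. Occurring residues occur inside the window, so they agree modulo gcd(g, 24). -/
theorem Regular.concentrated (hA : Regular A (2 * p) (16 * q) ρ E ε) (hE : 1 ≤ E) (hε : 0 < ε)
    (hε1 : ε ≤ 1) (hEq : 10 ^ 24 * E ≤ ε * q) {i : ℕ} (hi : i < 4) (hne : csum ρ 4 i ≠ 0)
    {Q : Finset ℕ}
    (hQ : Q = elts (inClasses A (cls 4 i)) (2 * p + 6 * q) (2 * p + 6 * q + 4 * q))
    {κ : ℝ} (hκ : 1 / 2 < κ) (hκ1 : κ ≤ 1)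
    (hov : ∀ x ∈ Q, ∀ d, 0 < d → d ≤ q / 10 ^ 10 → x + d ∈ Q →
      κ * Q.card ≤ (Q.filter fun v => v + d ∈ Q).card) :
    Concentrated ρ i (κ - 1 / 10 ^ 9) (1 / 10 ^ 11) := by
  set D₀ := q / 10 ^ 10 with hD₀
  have hmem : ∀ v, v ∈ Q ↔ (2 * p + 6 * q ≤ v ∧ v < 2 * p + 6 * q + 4 * q) ∧ v ∈ A ∧ v % 4 = i :=
    fun v => by
      rw [hQ, mem_elts, inClasses, Set.mem_ofPred_eq, natCast_mem_cls (by norm_num)]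
  have hqbig : (10 : ℝ) ^ 20 ≤ q := by nlinarith [Nat.cast_nonneg (α := ℝ) q]
  have hqE : 10 ^ 24 * E ≤ q := by nlinarith [Nat.cast_nonneg (α := ℝ) q]
  have hDq : (q : ℝ) / 10 ^ 11 ≤ D₀ := by
    have h1 : q < 10 ^ 10 * (D₀ + 1) := by omega
    have h2 : (q : ℝ) < 10 ^ 10 * (D₀ + 1) := by exact_mod_cast h1
    linarith
  have hDpos : (0 : ℝ) < D₀ := by linarith
  have hD₀q : D₀ ≤ q := Nat.div_le_self _ _
  have hED : 10 ^ 12 * E ≤ ε * D₀ := by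
    have := mul_le_mul_of_nonneg_left hDq hε.le
    linarith
  set X := csum ρ 4 i with hX
  have hρ := hA.nonneg hε.le
  have hcls : ∀ r, r ∈ cls 4 i ↔ r.val % 4 = i := fun r => by simp [cls]
  obtain ⟨r₀, hr₀, hr₀'⟩ := exists_ne_zero_of_csum hne
  have hXε : ε ≤ X := (hA.ge hr₀').trans
    (Finset.single_le_sum (f := ρ) (fun r _ => hρ r) ((hcls r₀).2 hr₀))
  have hcard6 : ((cls 4 i).card : ℝ) = 6 := by
    rw [card_cls (by decide) hi]; norm_num
  have hcnt : ∀ a b, 2 * p ≤ a → a ≤ b → b ≤ 2 * p + 16 * q →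
      X * (b - a) - 6 * E ≤ cnt (inClasses A (cls 4 i)) a b ∧
      (cnt (inClasses A (cls 4 i)) a b : ℝ) ≤ X * (b - a) + 6 * E := by
    intro a b h1 h2 h3
    have := hA.le_cnt_inClasses (cls 4 i) h1 h2 h3
    have h4 := hA.cnt_inClasses_le (cls 4 i) h1 h2 h3
    rw [hcard6] at this h4
    exact ⟨this, h4⟩
  have hQc : (Q.card : ℝ) = cnt (inClasses A (cls 4 i)) (2 * p + 6 * q) (2 * p + 6 * q + 4 * q) := by
    rw [hQ, cnt]
  have hQl : X * (4 * q) - 6 * E ≤ Q.card := by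
    have := (hcnt (2 * p + 6 * q) (2 * p + 6 * q + 4 * q) (by omega) (by omega) (by omega)).1
    rw [hQc]; push_cast at this; linarith
  have hexist : ∀ r, r.val % 4 = i → ρ r ≠ 0 → ∀ a, 2 * p + 6 * q ≤ a →
      a + D₀ ≤ 2 * p + 6 * q + 4 * q → ∃ s ∈ Q, (s : ZMod 24) = r ∧ a ≤ s ∧ s < a + D₀ := by
    intro r hr hr' a h1 h2
    obtain ⟨s, hs, hsr, hs1, hs2⟩ := hA.exists_mem hr' (a := a) (b := a + D₀) (by omega) (by omega)
      (by omega) (by push_cast; linarith)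
    refine ⟨s, (hmem s).2 ⟨by omega, hs, ?_⟩, hsr, hs1, hs2⟩
    rw [← natCast_mem_cls (m := 4) (by norm_num), hsr]
    exact (hcls r).2 hr
  have hgap : ∀ x ∈ Q, ∀ z ∈ Q, x < z → ∃ x' ∈ Q, x < x' ∧ x' ≤ x + D₀ := by
    intro x hx z hz hxz
    by_cases h : z ≤ x + D₀
    · exact ⟨z, hz, hxz, h⟩
    · have hx1 := ((hmem x).1 hx).1
      have hz1 := ((hmem z).1 hz).1
      obtain ⟨s, hs, -, h1, h2⟩ := hexist r₀ hr₀ hr₀' (x + 1) (by omega) (by omega)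
      exact ⟨s, hs, by omega, by omega⟩
  have htwo : ∃ x ∈ Q, ∃ z ∈ Q, x < z := by
    obtain ⟨s, hs, -, h1, h2⟩ := hexist r₀ hr₀ hr₀' (2 * p + 6 * q) (by omega) (by omega)
    obtain ⟨s', hs', -, h1', h2'⟩ := hexist r₀ hr₀ hr₀' (2 * p + 6 * q + D₀) (by omega) (by omega)
    exact ⟨s, hs, s', hs', by omega⟩
  obtain ⟨g, hg0, hgD, ⟨x, hx, hxg⟩, hcong, hmult⟩ := exists_common_difference hκ hov hgap htwo
  have hg0' : (0 : ℝ) < g := by exact_mod_cast hg0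
  have hgD' : (g : ℝ) ≤ D₀ := by exact_mod_cast hgD
  have hQup : (Q.card : ℝ) ≤ 4 * q / g + 1 := by
    have := cnt_le_of_modEq (S := inClasses A (cls 4 i)) (a := 2 * p + 6 * q)
      (b := 2 * p + 6 * q + 4 * q) (v := x) hg0 (by omega) fun s hs h1 h2 =>
        hcong s ((hmem s).2 ⟨⟨h1, h2⟩, hs.1, (natCast_mem_cls (by norm_num)).1 hs.2⟩) x hx
    rw [hQc]
    push_cast at this
    have h5 : (2 * (p : ℝ) + 6 * q + 4 * q - (2 * p + 6 * q)) / g = 4 * q / g := by ring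
    linarith
  have hgQ : g * (Q.card : ℝ) ≤ 4 * q + g := by
    have := mul_le_mul_of_nonneg_left hQup hg0'.le
    have h5 : (g : ℝ) * (4 * q / g + 1) = 4 * q + g := by field_simp
    linarith
  have hgX : g * X * (4 * q) ≤ 4 * q + g * (7 * E) := by
    have := mul_le_mul_of_nonneg_left hQl hg0'.le
    nlinarith
  have hqpos : (0 : ℝ) < q := by linarith
  have hgε : g * ε ≤ 3 := by
    have h1 : (g : ℝ) ≤ q := hgD'.trans (by exact_mod_cast hD₀q)
    have h2 : g * (7 * E) ≤ q * 1 * (7 * E) := by nlinarith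
    have h3 : g * ε * (4 * q) ≤ g * X * (4 * q) := by gcongr
    have h4 : g * (7 * E) * 10 ^ 24 ≤ g * 7 * (ε * q) := by nlinarith
    by_contra hc
    push Not at hc
    have h5 : 3 * q < g * ε * q := mul_lt_mul_of_pos_right hc hqpos
    nlinarith
  refine ⟨g, hg0, ?_, ?_, ?_, ?_⟩
  · have h1 := ((hmem x).1 hx).2.2
    have h2 := ((hmem _).1 hxg).2.2
    omega
  · -- average the overlaps over the multiples of `g`
    set N := D₀ / g with hN
    have hsum : (N : ℝ) * (κ * Q.card) ≤
        ∑ j ∈ Finset.Icc 1 N, ((Q.filter fun v => v + j * g ∈ Q).card : ℝ) := by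
      have := Finset.card_nsmul_le_sum (Finset.Icc 1 N)
        (fun j => ((Q.filter fun v => v + j * g ∈ Q).card : ℝ)) (κ * Q.card) (fun j hj => by
          rw [Finset.mem_Icc] at hj
          exact hmult j hj.1 ((Nat.mul_le_mul_right g hj.2).trans (Nat.div_mul_le_self D₀ g)))
      rwa [Nat.card_Icc, Nat.add_sub_cancel, nsmul_eq_mul] at this
    have hswap : ∑ j ∈ Finset.Icc 1 N, (Q.filter fun v => v + j * g ∈ Q).card =
        ∑ v ∈ Q, ((Finset.Icc 1 N).filter fun j => v + j * g ∈ Q).card := by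
      simp only [Finset.card_filter]
      exact Finset.sum_comm
    have hpt : ∀ v ∈ Q, (((Finset.Icc 1 N).filter fun j => v + j * g ∈ Q).card : ℝ) ≤
        X * D₀ + 6 * E := by
      intro v hv
      have hv1 := ((hmem v).1 hv).1
      have h1 : ((Finset.Icc 1 N).filter fun j => v + j * g ∈ Q).card ≤
          cnt (inClasses A (cls 4 i)) (v + 1) (v + 1 + D₀) := by
        refine Finset.card_le_card_of_injOn (fun j => v + j * g) (fun j hj => ?_)
          fun j _ j' _ hjj => ?_
        · obtain ⟨h1, h2⟩ := Finset.mem_filter.1 (Finset.mem_coe.1 hj)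
          rw [Finset.mem_Icc] at h1
          have h3 := (Nat.mul_le_mul_right g h1.2).trans (Nat.div_mul_le_self D₀ g)
          have h4 : 0 < j * g := Nat.mul_pos h1.1 hg0
          have h5 := (hmem _).1 h2
          refine Finset.mem_coe.2 (mem_elts.2 ⟨?_, h5.2.1, (natCast_mem_cls (by norm_num)).2 h5.2.2⟩)
          show v + 1 ≤ v + j * g ∧ v + j * g < v + 1 + D₀
          exact ⟨by clear_value N D₀; omega, by clear_value N D₀; omega⟩
        · have hjj : v + j * g = v + j' * g := hjj
          exact Nat.eq_of_mul_eq_mul_right hg0 (by omega)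
      have h2 := (hcnt (v + 1) (v + 1 + D₀) (by omega) (by omega) (by omega)).2
      push_cast at h2
      have h3 : (((Finset.Icc 1 N).filter fun j => v + j * g ∈ Q).card : ℝ) ≤
          cnt (inClasses A (cls 4 i)) (v + 1) (v + 1 + D₀) := by exact_mod_cast h1
      linarith
    have hsum2 : ∑ j ∈ Finset.Icc 1 N, ((Q.filter fun v => v + j * g ∈ Q).card : ℝ) ≤
        Q.card * (X * D₀ + 6 * E) := by
      have h1 : ∑ j ∈ Finset.Icc 1 N, ((Q.filter fun v => v + j * g ∈ Q).card : ℝ) =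
          ∑ v ∈ Q, (((Finset.Icc 1 N).filter fun j => v + j * g ∈ Q).card : ℝ) := by
        exact_mod_cast hswap
      rw [h1]
      have := Finset.sum_le_card_nsmul Q _ _ hpt
      rwa [nsmul_eq_mul] at this
    have hQpos : (0 : ℝ) < Q.card := by exact_mod_cast Finset.card_pos.2 ⟨x, hx⟩
    have hN' : (N : ℝ) * κ ≤ X * D₀ + 6 * E := by
      have : (Q.card : ℝ) * (N * κ) ≤ Q.card * (X * D₀ + 6 * E) := by linarith
      exact le_of_mul_le_mul_left this hQpos
    have hNg : (D₀ : ℝ) ≤ g * (N + 1) := by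
      have : D₀ < g * (N + 1) := Nat.lt_mul_div_succ D₀ hg0
      exact_mod_cast this.le
    have h1 : κ * D₀ ≤ g * X * D₀ + g * (7 * E) := by
      have h2 := mul_le_mul_of_nonneg_left hNg (show 0 ≤ κ by linarith)
      have h3 := mul_le_mul_of_nonneg_left hN' hg0'.le
      nlinarith
    have h2 : g * (7 * E) ≤ 1 / 10 ^ 9 * D₀ := by
      have h3 : (g : ℝ) * (10 ^ 12 * E) ≤ g * (ε * D₀) := mul_le_mul_of_nonneg_left hED hg0'.le
      have h4 : g * ε * D₀ ≤ 3 * D₀ := mul_le_mul_of_nonneg_right hgε hDpos.le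
      linarith
    have h3 : (κ - 1 / 10 ^ 9) * D₀ ≤ g * X * D₀ := by linarith
    exact le_of_mul_le_mul_right h3 hDpos
  · have h1 : g * (7 * E) * 10 ^ 24 ≤ g * 7 * q := by nlinarith
    have h2 : g * X * (4 * q) ≤ (1 + g * (1 / 10 ^ 11)) * (4 * q) := by nlinarith
    exact le_of_mul_le_mul_right h2 (by linarith)
  · intro r r' hr hr' hrX hrX'
    obtain ⟨s, hs, hsr, -⟩ := hexist r hr hrX (2 * p + 6 * q) (by omega) (by omega)
    obtain ⟨s', hs', hsr', -⟩ := hexist r' hr' hrX' (2 * p + 6 * q) (by omega) (by omega)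
    have h1 : s ≡ s' [MOD Nat.gcd g 24] := (hcong s hs s' hs').of_dvd (Nat.gcd_dvd_left g 24)
    rw [← hsr, ← hsr', ZMod.val_natCast, ZMod.val_natCast,
      Nat.mod_mod_of_dvd _ (Nat.gcd_dvd_right g 24), Nat.mod_mod_of_dvd _ (Nat.gcd_dvd_right g 24)]
    exact h1
end

/-! ### From equidistributed cells to local densities -/

section reflect
variable {A D : Set ℕ} {p q : ℕ} {ρ ρ' σ : ZMod 24 → ℝ} {E ε : ℝ}

theorem error_le (hE : 1 ≤ E) (hε1 : ε ≤ 1) (hEq : 10 ^ 24 * E ≤ ε * q) :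
    100 * E / q ≤ 1 / 10 ^ 11 ∧ (0 : ℝ) < q := by
  have h0 := Nat.cast_nonneg (α := ℝ) q
  have hqE : 10 ^ 24 * E ≤ q := by nlinarith
  have hq : (0 : ℝ) < q := by linarith
  refine ⟨?_, hq⟩
  rw [div_le_iff₀ hq]
  linarith

/-- A multiplier of a given class near the centre of the cell. -/
theorem Regular.exists_central (hD : Regular D p (8 * q) σ E ε) (hE : 1 ≤ E)
    (hEq : 10 ^ 24 * E ≤ ε * q) {y : ZMod 24} (hy : σ y ≠ 0) :
    ∃ s ∈ D, (s : ZMod 24) = y ∧ p + 3 * q ≤ s ∧ s < p + 5 * q := by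
  refine hD.exists_mem hy (by omega) (by omega) (by omega) ?_
  push_cast
  nlinarith

/-- For y near the centre of its cell, 4y is near twice the centre of the cell of A, so a window of
length 2q reflects into that cell. -/
theorem Regular.reflect (hA : Regular A (2 * p) (16 * q) ρ E ε) (hD : Regular D p (8 * q) σ E ε)
    (hε1 : ε ≤ 1) (hE : 1 ≤ E) (hEq : 10 ^ 24 * E ≤ ε * q) (hpq : 8 * q ≤ p)
    (hrel : ∀ u ∈ A, ∀ v ∈ A, ∀ y ∈ D, y < u → y < v → ∀ m, u + v ≠ m * y) {y : ZMod 24}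
    (hy : σ y ≠ 0) (r : ZMod 24) : ρ r + ρ (4 * y - r) ≤ 1 / 24 + 1 / 10 ^ 11 := by
  obtain ⟨s, hs, rfl, hs1, hs2⟩ := hD.exists_central hE hEq hy
  obtain ⟨he, hq⟩ := error_le hE hε1 hEq
  have hq' : 0 < q := Nat.cast_pos.1 hq
  have := hA.add_le hA (a := 2 * p + 6 * q) (l := 2 * q) (s := 4 * s) (by omega) (by omega)
    (by omega) (by omega) (by omega) (fun u hu v hv h1 h2 hc =>
      hrel u hu v hv s hs (by omega) (by omega) 4 hc) r
  push_cast at this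
  have h2 : (1 + 2 * E) / (2 * q) ≤ 100 * E / q := by
    rw [div_le_div_iff₀ (by linarith) hq]
    nlinarith
  linarith

theorem Regular.reflect_lower {k : ℕ} (hk : 1 ≤ k)
    (hX : Regular A (2 ^ k * p) (2 ^ k * (8 * q)) ρ' E ε)
    (hB : Regular A p (8 * q) ρ E ε) (hD : Regular D p (8 * q) σ E ε)
    (hε1 : ε ≤ 1) (hE : 1 ≤ E) (hEq : 10 ^ 24 * E ≤ ε * q)
    (hrel : ∀ u ∈ A, ∀ v ∈ A, ∀ y ∈ D, y < u → y < v → ∀ m, u + v ≠ m * y) {y : ZMod 24}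
    (hy : σ y ≠ 0) (r : ZMod 24) : ρ r + ρ' ((2 ^ k + 1) * y - r) ≤ 1 / 24 + 1 / 10 ^ 11 := by
  obtain ⟨s, hs, rfl, hs1, hs2⟩ := hD.exists_central hE hEq hy
  obtain ⟨he, hq⟩ := error_le hE hε1 hEq
  have hq' : 0 < q := Nat.cast_pos.1 hq
  have hk2 : 2 ≤ 2 ^ k := by
    calc 2 = 2 ^ 1 := rfl
      _ ≤ 2 ^ k := Nat.pow_le_pow_right (by norm_num) hk
  have e1 : (2 ^ k + 1) * s = 2 ^ k * s + s := by ring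
  have l1 : 2 ^ k * (p + 3 * q) ≤ 2 ^ k * s := Nat.mul_le_mul_left _ hs1
  have l2 : 2 ^ k * (s + 1) ≤ 2 ^ k * (p + 5 * q) := Nat.mul_le_mul_left _ hs2
  have l3 : 2 * q ≤ 2 ^ k * q := Nat.mul_le_mul_right q hk2
  have l4 : 2 * s ≤ 2 ^ k * s := Nat.mul_le_mul_right s hk2
  have d1 : 2 ^ k * (p + 3 * q) = 2 ^ k * p + 3 * (2 ^ k * q) := by ring
  have d2 : 2 ^ k * (p + 5 * q) = 2 ^ k * p + 5 * (2 ^ k * q) := by ring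
  have d3 : 2 ^ k * (8 * q) = 8 * (2 ^ k * q) := by ring
  have d4 : 2 ^ k * (s + 1) = 2 ^ k * s + 2 ^ k := by ring
  have := hB.add_le hX (a := p + 5 * q) (l := q) (s := (2 ^ k + 1) * s) hq' (by omega)
    (by omega) (by rw [e1]; omega) (by rw [e1, d3]; omega) (fun u hu v hv h1 h2 hc =>
      hrel u hu v hv s hs (by omega) (by rw [e1] at hc; omega) _ hc) r
  push_cast at this
  have h2 : (1 + 2 * E) / q ≤ 100 * E / q := by
    gcongr
    linarith
  linarith

end reflect

/-- A cell `[8P, 8(P + 8q))` together with its halvings, on which `A` is equidistributed at all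
levels, and so is the set `D` of multipliers. -/
structure Place (A D : Set ℕ) (P q : ℕ) (ρ σ : ℕ → ZMod 24 → ℝ) (E ε : ℝ) : Prop where
  regA : ∀ k ≤ 3, Regular A (2 ^ (3 - k) * P) (2 ^ (3 - k) * (8 * q)) (ρ k) E ε
  regD : ∀ k, 1 ≤ k → k ≤ 3 → Regular D (2 ^ (3 - k) * P) (2 ^ (3 - k) * (8 * q)) (σ k) E ε
  ρ_nonneg : ∀ k r, 0 ≤ ρ k r
  σ_nonneg : ∀ k r, 0 ≤ σ k r
  σ_eq : ∀ k r, 1 ≤ k → σ k r = ρ k r + 1 / 2 * ∑ r', (if 2 * r' = r then σ (k + 1) r' else 0)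
  one_le : 1 ≤ E
  pos : 0 < ε
  le_one : ε ≤ 1
  le : 10 ^ 24 * E ≤ ε * q
  width : 8 * q ≤ P
  rel : ∀ u ∈ A, ∀ v ∈ A, ∀ y ∈ D, y < u → y < v → ∀ m, u + v ≠ m * y

namespace Place
variable {A D : Set ℕ} {P q : ℕ} {ρ σ : ℕ → ZMod 24 → ℝ} {E ε : ℝ}

theorem scaled_le (d : Place A D P q ρ σ E ε) {c : ℕ} (hc : 1 ≤ c) :
    10 ^ 24 * E ≤ ε * ((c * q : ℕ) : ℝ) := by
  refine d.le.trans (mul_le_mul_of_nonneg_left ?_ d.pos.le)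
  exact_mod_cast Nat.le_mul_of_pos_left q hc

theorem regA0 (d : Place A D P q ρ σ E ε) : Regular A (2 * (4 * P)) (16 * (4 * q)) (ρ 0) E ε := by
  have := d.regA 0 (by norm_num)
  rwa [show 2 ^ (3 - 0) * P = 2 * (4 * P) by ring,
    show 2 ^ (3 - 0) * (8 * q) = 16 * (4 * q) by ring] at this

theorem regD1 (d : Place A D P q ρ σ E ε) : Regular D (4 * P) (8 * (4 * q)) (σ 1) E ε := by
  have := d.regD 1 le_rfl (by norm_num)
  rwa [show 2 ^ (3 - 1) * P = 4 * P by ring,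
    show 2 ^ (3 - 1) * (8 * q) = 8 * (4 * q) by ring] at this

theorem σ_le (d : Place A D P q ρ σ E ε) {k : ℕ} (hk : 1 ≤ k) (hk3 : k ≤ 3) (r : ZMod 24) :
    σ k r ≤ 1 / 24 + 1 / 10 ^ 11 := by
  have h1 := d.regD k hk hk3
  obtain ⟨he, hq⟩ := error_le d.one_le d.le_one d.le
  have hq' : 0 < q := Nat.cast_pos.1 hq
  have h2 := h1.le_inv (by positivity) r
  have h3 : (1 + E) / ((2 ^ (3 - k) * (8 * q) : ℕ) : ℝ) ≤ 100 * E / q := by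
    have h4 := d.one_le
    have h5 : (q : ℝ) ≤ ((2 ^ (3 - k) * (8 * q) : ℕ) : ℝ) := by
      have : q ≤ 2 ^ (3 - k) * (8 * q) := by
        have : 1 ≤ 2 ^ (3 - k) := Nat.one_le_two_pow
        nlinarith
      exact_mod_cast this
    calc (1 + E) / ((2 ^ (3 - k) * (8 * q) : ℕ) : ℝ) ≤ (1 + E) / q := by gcongr
      _ ≤ 100 * E / q := by gcongr; linarith
  linarith

theorem XY (d : Place A D P q ρ σ E ε) {x : ZMod 24} (hx : ρ 0 x ≠ 0) (r : ZMod 24) :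
    ρ 0 r + 1 / 4 * ∑ y, (if 4 * y = r + x then σ 1 y else 0) ≤ 1 / 24 + 1 / 10 ^ 11 := by
  have hw := d.width
  have hle := d.scaled_le (c := 4) (by norm_num)
  obtain ⟨he, hq⟩ := error_le d.one_le d.le_one hle
  have hbig : E < ε * ((4 * q : ℕ) : ℝ) := by
    have := d.one_le
    linarith
  obtain ⟨s, hs, rfl, hs1, hs2⟩ := d.regA0.exists_mem hx (a := 2 * (4 * P) + 6 * (4 * q))
    (b := 2 * (4 * P) + 10 * (4 * q)) (by omega) (by omega) (by omega) (by
      push_cast at hbig ⊢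
      nlinarith [d.one_le])
  have hEq : E ≤ ((4 * q : ℕ) : ℝ) := hbig.le.trans (mul_le_of_le_one_left hq.le d.le_one)
  have := d.regA0.add_quarter_le d.regD1 d.one_le d.pos.le hEq
    (fun r => (d.σ_le le_rfl (by norm_num) r).trans (by norm_num)) hs1 hs2
    (fun u hu y hy hu1 hy1 hc => d.rel u hu s hs y hy (by omega) (by omega) 4 hc) r
  have h2 : 16 * E / ((4 * q : ℕ) : ℝ) ≤ 100 * E / ((4 * q : ℕ) : ℝ) := by
    gcongr
    · linarith [d.one_le]
    · norm_num
  linarith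

theorem overlap (d : Place A D P q ρ σ E ε) {i j : ℕ} (hi : i < 4) (hij : (i + j) % 4 = 0)
    {Q Q' : Finset ℕ}
    (hQ : Q = elts (inClasses A (cls 4 i)) (2 * (4 * P) + 6 * (4 * q))
      (2 * (4 * P) + 6 * (4 * q) + 4 * (4 * q)))
    (hQ' : Q' = elts (inClasses A (cls 4 j)) (2 * (4 * P) + 6 * (4 * q))
      (2 * (4 * P) + 6 * (4 * q) + 4 * (4 * q)))
    {x e : ℕ} (hx : x ∈ Q') (hxe : x + e ∈ Q') (he : e ≤ (4 * q) / 10 ^ 10) :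
    2 * (Q.card : ℝ) - 1 / 10 ^ 9 * q - (1 - ∑ r, σ 1 r) * (4 * q) ≤
      (Q.filter fun v => v + e ∈ Q).card := by
  have hw := d.width
  have hmem : ∀ v ∈ Q', (2 * (4 * P) + 6 * (4 * q) ≤ v ∧
      v < 2 * (4 * P) + 6 * (4 * q) + 4 * (4 * q)) ∧ v ∈ A ∧ v % 4 = j := fun v hv => by
    rwa [hQ', mem_elts, inClasses, Set.mem_ofPred_eq, natCast_mem_cls (by norm_num)] at hv
  have h1 := hmem x hx
  have h2 := hmem _ hxe
  have hη : ∑ r, σ 1 r ≤ 2 := by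
    have := Finset.sum_le_card_nsmul Finset.univ (σ 1) _ fun r _ => d.σ_le le_rfl (by norm_num) r
    rw [Finset.card_univ, ZMod.card, nsmul_eq_mul] at this
    norm_num at this
    linarith
  have := d.regD1.overlap_ge (A := A) d.one_le hi hij (Finset.sum_nonneg fun r _ => d.σ_nonneg 1 r)
    hη hQ h1.2.2 h2.2.2 h1.1.1 (by omega)
    (fun u hu y hy hu1 hy1 hc => d.rel u hu x h1.2.1 y hy (by omega) (by omega) 4 hc)
    (fun u hu y hy hu1 hy1 hc => d.rel u hu _ h2.2.1 y hy (by omega) (by omega) 4 hc)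
  have he' : (e : ℝ) ≤ 4 * q / 10 ^ 10 := by
    have h3 : e * 10 ^ 10 ≤ 4 * q := (Nat.mul_le_mul_right _ he).trans (Nat.div_mul_le_self _ _)
    have h4 : (e : ℝ) * 10 ^ 10 ≤ 4 * q := by exact_mod_cast h3
    rw [le_div_iff₀ (by norm_num)]
    exact h4
  obtain ⟨hE, hq⟩ := error_le d.one_le d.le_one d.le
  have hqE : 10 ^ 24 * E ≤ q := by nlinarith [d.le, d.le_one]
  push_cast at this
  linarith

theorem card_ge (d : Place A D P q ρ σ E ε) {i : ℕ} (hi : i < 4) :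
    csum (ρ 0) 4 i * (16 * q) - 6 * E ≤
      (elts (inClasses A (cls 4 i)) (2 * (4 * P) + 6 * (4 * q))
        (2 * (4 * P) + 6 * (4 * q) + 4 * (4 * q))).card := by
  have := d.regA0.le_cnt_inClasses (cls 4 i) (a := 2 * (4 * P) + 6 * (4 * q))
    (b := 2 * (4 * P) + 6 * (4 * q) + 4 * (4 * q)) (by omega) (by omega) (by omega)
  rw [card_cls (by decide) hi, cnt] at this
  push_cast at this
  norm_num at this
  rw [csum]
  linarith

theorem localDensities (d : Place A D P q ρ σ E ε) :
    LocalDensities (1 / 10 ^ 11) (ρ 0) ρ σ := by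
  have hw := d.width
  obtain ⟨hE, hq⟩ := error_le d.one_le d.le_one d.le
  have hqE : 10 ^ 24 * E ≤ q := by nlinarith [d.le, d.le_one]
  have hE1 := d.one_le
  have h4 := d.scaled_le (c := 4) (by norm_num)
  have hXX : ∀ y, σ 1 y ≠ 0 → ∀ r, ρ 0 r + ρ 0 (4 * y - r) ≤ 1 / 24 + 1 / 10 ^ 11 := fun y hy r =>
    d.regA0.reflect d.regD1 d.le_one d.one_le h4 (by omega) d.rel hy r
  have hXle : ∀ i < 4, csum (ρ 0) 4 i ≤ 1 := by
    intro i hi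
    have h1 : ∀ r, ρ 0 r ≤ 1 / 24 + 1 / 10 ^ 11 := fun r => by
      have h1 := d.regA0.le_inv (by have : 0 < q := Nat.cast_pos.1 hq; omega) r
      have h2 : (1 + E) / ((16 * (4 * q) : ℕ) : ℝ) ≤ 100 * E / q := by
        push_cast
        rw [div_le_div_iff₀ (by linarith) hq]
        nlinarith
      linarith
    have := sum_csum_le (m := 4) (i := i) (by decide) hi h1
    norm_num at this
    linarith
  refine
    { X_nonneg := d.ρ_nonneg 0
      B_nonneg := d.ρ_nonneg
      Y_nonneg := d.σ_nonneg
      Y_eq := d.σ_eq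
      Y_le := fun k r hk hk3 => d.σ_le hk hk3 r
      XX := hXX
      BX := ?_
      BB := ?_
      XY := fun x hx r => d.XY hx r
      even_concentrated := ?_
      odd_concentrated := ?_ }
  · intro k hk hk3 y hy r
    have hA0 := d.regA 0 (by norm_num)
    have hpow : 2 ^ (3 - 0) = 2 ^ k * 2 ^ (3 - k) := by rw [← pow_add]; congr 1; omega
    have hB := d.regA k hk3
    have hD := d.regD k hk hk3
    have e1 : 2 ^ (3 - k) * (8 * q) = 8 * (2 ^ (3 - k) * q) := by ring
    have e2 : 2 ^ (3 - 0) * (8 * q) = 2 ^ k * (8 * (2 ^ (3 - k) * q)) := by rw [hpow]; ring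
    have e3 : 2 ^ (3 - 0) * P = 2 ^ k * (2 ^ (3 - k) * P) := by rw [hpow]; ring
    rw [e1] at hB hD
    rw [e2, e3] at hA0
    exact hA0.reflect_lower hk hB hD d.le_one d.one_le (d.scaled_le Nat.one_le_two_pow)
      d.rel hy r
  · intro y hy r
    have hB := d.regA 1 (by norm_num)
    have hD := d.regD 2 (by norm_num) (by norm_num)
    rw [show 2 ^ (3 - 1) * P = 2 * (2 * P) by ring,
      show 2 ^ (3 - 1) * (8 * q) = 16 * (2 * q) by ring] at hB
    rw [show 2 ^ (3 - 2) * P = 2 * P by ring,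
      show 2 ^ (3 - 2) * (8 * q) = 8 * (2 * q) by ring] at hD
    exact hB.reflect hD d.le_one d.one_le (d.scaled_le (by norm_num)) (by omega) d.rel hy r
  · intro c hc
    have hc4 : c < 4 := by omega
    by_cases hsmall : csum (ρ 0) 4 c ≤ (1 - ∑ r, σ 1 r) / 6 + 1 / 10 ^ 8
    · exact Or.inl hsmall
    right
    push Not at hsmall
    have hη : ∑ r, σ 1 r ≤ 1 + 1 / 10 ^ 9 := by
      have := Finset.sum_le_card_nsmul Finset.univ (σ 1) _ fun r _ => d.σ_le le_rfl (by norm_num) r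
      rw [Finset.card_univ, ZMod.card, nsmul_eq_mul] at this
      norm_num at this
      linarith
    have hne : csum (ρ 0) 4 c ≠ 0 := fun h0 => by rw [h0] at hsmall; linarith
    set Q := elts (inClasses A (cls 4 c)) (2 * (4 * P) + 6 * (4 * q))
      (2 * (4 * P) + 6 * (4 * q) + 4 * (4 * q)) with hQ
    have hcard := d.card_ge hc4
    rw [← hQ] at hcard
    -- An even class is its own complement modulo 4: a difference in Q makes the overlap at least
    -- about 2|Q| − 4(1 − η)q, where |Q| is about 16q times the density. Density above (1 − η)/6 is
    -- just what makes this exceed |Q|/2.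
    have := d.regA0.concentrated d.one_le d.pos d.le_one h4 hc4 hne hQ
      (κ := 1 / 2 + 1 / 10 ^ 8) (by norm_num) (by norm_num) (fun x hx e he0 he hxe => by
        have h1 := d.overlap hc4 (i := c) (j := c) (by omega) hQ hQ hx hxe he
        have h2 := mul_le_mul_of_nonneg_right hsmall.le hq.le
        have h3 := mul_le_mul_of_nonneg_right (hXle c hc4) hq.le
        linarith)
    obtain ⟨g, g1, g2, g3, g4, g5⟩ := this
    exact ⟨g, g1, g2, by norm_num at g3 ⊢; linarith, g4, g5⟩
  · intro h1 h3 hη hsum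
    obtain ⟨x1, hx1, hx1'⟩ := exists_ne_zero_of_csum h1
    obtain ⟨x3, hx3, hx3'⟩ := exists_ne_zero_of_csum h3
    have b3 := csum_add_quarter_le 4 3 (fun r => d.XY hx1' r) (by decide) (by norm_num)
      (fun y _ => by
        have h2 := (LocalDensities.val_four_mul_sub y x1).1
        omega)
    have b1 := csum_add_quarter_le 4 1 (fun r => d.XY hx3' r) (by decide) (by norm_num)
      (fun y _ => by
        have h2 := (LocalDensities.val_four_mul_sub y x3).1
        omega)
    norm_num at b1 b3
    have key : ∀ i j : ℕ, i < 4 → j < 4 → (i + j) % 4 = 0 → csum (ρ 0) 4 i ≠ 0 →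
        (1 - ∑ r, σ 1 r) / 4 - 201 / 100000 ≤ csum (ρ 0) 4 i →
        (1 - ∑ r, σ 1 r) / 4 - 201 / 100000 ≤ csum (ρ 0) 4 j →
        Concentrated (ρ 0) i (97 / 100) (1 / 10 ^ 11) := by
      intro i j hi hj hij hne hli hlj
      set Q := elts (inClasses A (cls 4 i)) (2 * (4 * P) + 6 * (4 * q))
        (2 * (4 * P) + 6 * (4 * q) + 4 * (4 * q)) with hQ
      set Q' := elts (inClasses A (cls 4 j)) (2 * (4 * P) + 6 * (4 * q))
        (2 * (4 * P) + 6 * (4 * q) + 4 * (4 * q)) with hQ'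
      have hcard := d.card_ge hi
      rw [← hQ] at hcard
      have hcard' := d.card_ge hj
      rw [← hQ'] at hcard'
      have hli' := mul_le_mul_of_nonneg_right hli hq.le
      have hlj' := mul_le_mul_of_nonneg_right hlj hq.le
      have hη' := mul_le_mul_of_nonneg_right hη hq.le
      -- A difference in one odd class forces an overlap in the other, which realises the same
      -- difference there and so forces an overlap in the first. Densities near (1 − η)/4 make it
      -- nearly full.
      have := d.regA0.concentrated d.one_le d.pos d.le_one h4 hi hne hQ
        (κ := 975 / 1000) (by norm_num) (by norm_num) (fun x hx e he0 he hxe => by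
          have o1 := d.overlap hj (i := j) (j := i) (by omega) hQ' hQ hx hxe he
          have hpos : (0 : ℝ) < (Q'.filter fun v => v + e ∈ Q').card := by linarith
          obtain ⟨z, hz⟩ := Finset.card_pos.1 (Nat.cast_pos.1 hpos)
          obtain ⟨hz1, hz2⟩ := Finset.mem_filter.1 hz
          have o2 := d.overlap hi (i := i) (j := j) hij hQ hQ' hz1 hz2 he
          linarith)
      obtain ⟨g, g1, g2, g3, g4, g5⟩ := this
      exact ⟨g, g1, g2, by norm_num at g3 ⊢; linarith, g4, g5⟩
    exact ⟨key 1 3 (by norm_num) (by norm_num) rfl h1 (by linarith) (by linarith),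
      key 3 1 (by norm_num) (by norm_num) rfl h3 (by linarith) (by linarith)⟩

end Place

/-! ### The upper half in the presence of a smaller element -/

theorem two_mul_card_window_le {X : Finset ℕ} {s a b : ℕ} (hab : a + b = s)
    (h : ∀ u ∈ X, ∀ v ∈ X, a ≤ u → a ≤ v → u + v ≠ s) :
    2 * (X ∩ Finset.Icc a b).card ≤ b + 1 - a := by
  rcases Nat.lt_or_ge b a with hlt | hle
  · rw [Finset.Icc_eq_empty (by omega)]; simp
  have := card_window_add_card_reflected_le (X := X ∩ Finset.Icc a b) (s := s) (x := a)
    (d := b + 1 - a) (by omega) fun u hu v hv => by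
      have h1 := Finset.mem_inter.1 hu
      have h2 := Finset.mem_inter.1 hv
      exact h u h1.1 v h2.1 (Finset.mem_Icc.1 h1.2).1 (Finset.mem_Icc.1 h2.2).1
  have e1 : X ∩ Finset.Icc a b ∩ Finset.Ico a (a + (b + 1 - a)) = X ∩ Finset.Icc a b := by
    ext x
    simp only [Finset.mem_inter, Finset.mem_Icc, Finset.mem_Ico]
    constructor
    · exact fun h => h.1
    · exact fun h => ⟨h, by omega⟩
  have e2 : X ∩ Finset.Icc a b ∩ Finset.Ico (s + 1 - (a + (b + 1 - a))) (s + 1 - a) =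
      X ∩ Finset.Icc a b := by
    ext x
    simp only [Finset.mem_inter, Finset.mem_Icc, Finset.mem_Ico]
    constructor
    · exact fun h => h.1
    · exact fun h => ⟨h, by omega⟩
  rw [e1, e2] at this
  omega

theorem card_inter_Icc_le (X : Finset ℕ) (a b : ℕ) : (X ∩ Finset.Icc a b).card ≤ b + 1 - a := by
  rw [← Nat.card_Icc]
  exact Finset.card_le_card Finset.inter_subset_right

theorem card_inter_Icc_split (X : Finset ℕ) (a b c : ℕ) :
    (X ∩ Finset.Icc a c).card ≤ (X ∩ Finset.Icc a b).card + (X ∩ Finset.Icc (b + 1) c).card := by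
  refine (Finset.card_le_card fun x hx => ?_).trans (Finset.card_union_le _ _)
  simp only [Finset.mem_union, Finset.mem_inter, Finset.mem_Icc] at hx ⊢
  by_cases h : x ≤ b
  · exact Or.inl ⟨hx.1, hx.2.1, h⟩
  · exact Or.inr ⟨hx.1, by omega, hx.2.2⟩

/-- A single multiplier forces the upper half to be smaller than a third. -/
theorem card_upper_half_le {n y : ℕ} {X : Finset ℕ} (hX : ∀ x ∈ X, n < 2 * x ∧ x ≤ n)
    (hy : n < 4 * y) (hy2 : 2 * y ≤ n) (h : ∀ k, ∀ u ∈ X, ∀ v ∈ X, u + v ≠ k * y)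
    (hown : ∀ x ∈ X, ∀ u ∈ X, ∀ v ∈ X, x < u → x < v → u + v ≠ 3 * x) :
    10000 * X.card ≤ 3235 * n + 1000000 := by
  set l := n / 2 + 1 with hl
  have hXl : X = X ∩ Finset.Icc l n := by
    ext x
    simp only [Finset.mem_inter, Finset.mem_Icc]
    exact ⟨fun hx => ⟨hx, by have := hX x hx; omega, (hX x hx).2⟩, fun hx => hx.1⟩
  have hXc : X.card = (X ∩ Finset.Icc l n).card := by rw [← hXl]
  have win : ∀ k a b, a + b = k * y → 2 * (X ∩ Finset.Icc a b).card ≤ b + 1 - a :=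
    fun k a b hab => two_mul_card_window_le hab fun u hu v hv _ _ => h k u hu v hv
  -- Reflection in ky: `above` halves the top window [ky − n, n], `below` the bottom window [l, ky −
  -- l]; the rest is counted in full.
  have above : ∀ k, 3 * n ≤ 2 * (k * y) → k * y ≤ 2 * n → 2 * X.card ≤ k * y - n + 4 := by
    intro k h1 h2
    have a1 := card_inter_Icc_split X l (k * y - n - 1) n
    have a2 := win k (k * y - n) n (by omega)
    have a3 := card_inter_Icc_le X l (k * y - n - 1)
    rw [show k * y - n - 1 + 1 = k * y - n by omega] at a1
    omega
  have below : ∀ k, 2 * (k * y) ≤ 3 * n → n + 2 ≤ k * y → 2 * X.card ≤ 2 * n - k * y + 4 := by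
    intro k h1 h2
    have a1 := card_inter_Icc_split X l (k * y - l) n
    have a2 := win k l (k * y - l) (by omega)
    have a3 := card_inter_Icc_le X (k * y - l + 1) n
    omega
  rcases Nat.lt_or_ge n 100 with hn | hn
  · have := card_inter_Icc_le X l n
    omega
  -- The useful factor k is 6, 5 or 4 according to y/n. Between 0.3293 and 0.3384 a single
  -- reflection does not give 0.3235n.
  by_cases c1 : 10000 * y < 2735 * n
  · have := above 6 (by omega) (by omega)
    omega
  by_cases c2 : 10000 * y ≤ 3293 * n
  · rcases le_total (2 * (5 * y)) (3 * n) with h1 | h1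
    · have := below 5 h1 (by omega)
      omega
    · have := above 5 h1 (by omega)
      omega
  by_cases c4 : 4 * n ≤ 10 * y
  · -- chains `x`, `3y - x`, `x + y`
    have a1 := card_inter_Icc_split X l (n - y) n
    have a2 := card_inter_Icc_split X (n - y + 1) (4 * y - n - 1) n
    have a3 := card_inter_Icc_split X (4 * y - n - 1 + 1) (3 * y - l) n
    have a4 := card_inter_Icc_split X (3 * y - l + 1) (l + y - 1) n
    have b1 := win 3 (n - y + 1) (4 * y - n - 1) (by omega)
    have b2 := win 4 (3 * y - l + 1) (l + y - 1) (by omega)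
    have b3 := card_inter_Icc_le X (l + y - 1 + 1) n
    have b4 := card_window_add_card_reflected_le (X := X) (s := 3 * y) (x := l)
      (d := n - y + 1 - l) (by omega) (h 3)
    have e1 : Finset.Ico l (l + (n - y + 1 - l)) = Finset.Icc l (n - y) := by
      ext x; simp only [Finset.mem_Ico, Finset.mem_Icc]; omega
    have e2 : Finset.Ico (3 * y + 1 - (l + (n - y + 1 - l))) (3 * y + 1 - l) =
        Finset.Icc (4 * y - n - 1 + 1) (3 * y - l) := by
      ext x; simp only [Finset.mem_Ico, Finset.mem_Icc]; omega
    rw [e1, e2] at b4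
    omega
  by_cases c3 : 3384 * n ≤ 10000 * y
  · rcases le_total (2 * (4 * y)) (3 * n) with h1 | h1
    · have := below 4 h1 (by omega)
      omega
    · have := above 4 h1 (by omega)
      omega
  -- In the remaining range an element x near 0.6n supplies its own reflection in 3x for the top; if
  -- there is none, a gap of 0.04n is saved.
  by_cases hx : ∃ x ∈ X, 58 * n ≤ 100 * x ∧ 100 * x ≤ 62 * n
  · obtain ⟨x, hx, hx1, hx2⟩ := hx
    have a1 := card_inter_Icc_split X l (4 * y - l) n
    have a2 := win 4 l (4 * y - l) (by omega)
    have a3 : 2 * (X ∩ Finset.Icc (3 * x - n) n).card ≤ n + 1 - (3 * x - n) :=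
      two_mul_card_window_le (s := 3 * x) (by omega) fun u hu v hv h1 h2 =>
        hown x hx u hu v hv (by have := hX x hx; omega) (by have := hX x hx; omega)
    rcases le_total (3 * x - n) (4 * y - l + 1) with h1 | h1
    · have a4 : (X ∩ Finset.Icc (4 * y - l + 1) n).card ≤ (X ∩ Finset.Icc (3 * x - n) n).card :=
        Finset.card_le_card (Finset.inter_subset_inter_left (Finset.Icc_subset_Icc_left h1))
      omega
    · have a4 := card_inter_Icc_split X (4 * y - l + 1) (3 * x - n - 1) n
      have a5 := card_inter_Icc_le X (4 * y - l + 1) (3 * x - n - 1)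
      rw [show 3 * x - n - 1 + 1 = 3 * x - n by omega] at a4
      omega
  · push Not at hx
    have a1 := card_inter_Icc_split X l (5 * y - n - 1) n
    have a2 := win 5 (5 * y - n) n (by omega)
    rw [show 5 * y - n - 1 + 1 = 5 * y - n by omega] at a1
    have a3 := card_inter_Icc_split X l (58 * n / 100) (5 * y - n - 1)
    have a4 := card_inter_Icc_split X (58 * n / 100 + 1) (62 * n / 100) (5 * y - n - 1)
    have a5 : X ∩ Finset.Icc (58 * n / 100 + 1) (62 * n / 100) = ∅ := by
      refine Finset.eq_empty_of_forall_notMem fun x hx' => ?_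
      obtain ⟨h1, h2⟩ := Finset.mem_inter.1 hx'
      rw [Finset.mem_Icc] at h2
      have := hx x h1 (by omega)
      omega
    rw [a5, Finset.card_empty] at a4
    have a6 := card_inter_Icc_le X l (58 * n / 100)
    have a7 := card_inter_Icc_le X (62 * n / 100 + 1) (5 * y - n - 1)
    omega

/-! ### Energy increments and the regularity lemma -/

theorem cnt_add_cnt {S : Set ℕ} {a b c : ℕ} (hab : a ≤ b) (hbc : b ≤ c) :
    cnt S a b + cnt S b c = cnt S a c := by
  classical
  rw [cnt, cnt, cnt, ← Finset.card_union_of_disjoint]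
  · congr 1
    ext x
    simp only [Finset.mem_union, mem_elts]
    constructor
    · rintro (⟨h, hx⟩ | ⟨h, hx⟩) <;> exact ⟨by omega, hx⟩
    · rintro ⟨h, hx⟩
      rcases lt_or_ge x b with h' | h'
      · exact Or.inl ⟨by omega, hx⟩
      · exact Or.inr ⟨by omega, hx⟩
  · rw [Finset.disjoint_left]
    intro x hx hx'
    have := (mem_elts.1 hx).1
    have := (mem_elts.1 hx').1
    omega

theorem cnt_grid (S : Set ℕ) (p l : ℕ) {i j : ℕ} (hij : i ≤ j) :
    cnt S (p + i * l) (p + j * l) = ∑ x ∈ Finset.Ico i j, cnt S (p + x * l) (p + (x + 1) * l) := by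
  induction j, hij using Nat.le_induction with
  | base => simp [cnt, elts]
  | succ j hij ih =>
    rw [Finset.sum_Ico_succ_top hij, ← ih, cnt_add_cnt]
    · gcongr
    · gcongr; omega

/-- Deviations on a grid control deviations on all intervals. -/
theorem abs_cnt_sub_le {S : Set ℕ} {p l R a b : ℕ} {d V : ℝ} (hd : 0 ≤ d) (hd' : d ≤ 1)
    (hl : 0 < l)
    (hV : ∑ i ∈ Finset.range R, |(cnt S (p + i * l) (p + (i + 1) * l) : ℝ) - d * l| ≤ V)
    (ha : p ≤ a) (hab : a ≤ b) (hb : b ≤ p + R * l) :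
    |(cnt S a b : ℝ) - d * (b - a)| ≤ V + 2 * l := by
  set i := (a - p) / l with hi
  set j := (b - p) / l with hj
  have hij : i ≤ j := Nat.div_le_div_right (by omega)
  have hjR : j ≤ R := by
    rw [hj, Nat.div_le_iff_le_mul_add_pred hl]
    rw [mul_comm]; omega
  have key : ∀ x, p ≤ x → p + (x - p) / l * l ≤ x ∧ x ≤ p + (x - p) / l * l + l ∧
      |(cnt S (p + (x - p) / l * l) x : ℝ) - d * (x - (p + (x - p) / l * l : ℕ))| ≤ l := by
    intro x hx
    have h1 := Nat.div_add_mod (x - p) l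
    have h2 := Nat.mod_lt (x - p) hl
    have h3 : (x - p) / l * l = l * ((x - p) / l) := mul_comm _ _
    have h4 : p + (x - p) / l * l ≤ x := by omega
    have h5 : x ≤ p + (x - p) / l * l + l := by omega
    refine ⟨h4, h5, ?_⟩
    have h6 := cnt_le (S := S) (a := p + (x - p) / l * l) (b := x)
    generalize p + (x - p) / l * l = y at *
    have h7 : (cnt S y x : ℝ) + y ≤ x := by exact_mod_cast (by omega)
    have h8 : (x : ℝ) ≤ y + l := by exact_mod_cast h5
    have h9 : (0 : ℝ) ≤ cnt S y x := Nat.cast_nonneg _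
    have h10 : (y : ℝ) ≤ x := by exact_mod_cast h4
    rw [abs_le]
    constructor <;> nlinarith
  obtain ⟨a1, a2, a3⟩ := key a ha
  obtain ⟨b1, b2, b3⟩ := key b (ha.trans hab)
  rw [← hi] at a1 a2 a3
  rw [← hj] at b1 b2 b3
  have hg : p + i * l ≤ p + j * l := by gcongr
  have e1 := cnt_add_cnt (S := S) hg b1
  have e2 := cnt_add_cnt (S := S) a1 hab
  have hgrid : |(cnt S (p + i * l) (p + j * l) : ℝ) - d * ((p + j * l : ℕ) - (p + i * l : ℕ))| ≤
      V := by
    refine le_trans ?_ hV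
    have : (cnt S (p + i * l) (p + j * l) : ℝ) - d * ((p + j * l : ℕ) - (p + i * l : ℕ)) =
        ∑ x ∈ Finset.Ico i j, ((cnt S (p + x * l) (p + (x + 1) * l) : ℝ) - d * l) := by
      rw [cnt_grid S p l hij, Finset.sum_sub_distrib, Finset.sum_const, Nat.card_Ico, nsmul_eq_mul,
        Nat.cast_sub hij]
      push_cast
      ring
    rw [this]
    refine (Finset.abs_sum_le_sum_abs _ _).trans
      (Finset.sum_le_sum_of_subset_of_nonneg (fun x hx => ?_) fun _ _ _ => abs_nonneg _)
    rw [Finset.mem_Ico] at hx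
    rw [Finset.mem_range]
    omega
  have e1' : (cnt S (p + i * l) (p + j * l) : ℝ) + cnt S (p + j * l) b = cnt S (p + i * l) b := by
    exact_mod_cast e1
  have e2' : (cnt S (p + i * l) a : ℝ) + cnt S a b = cnt S (p + i * l) b := by
    exact_mod_cast e2
  rw [abs_le] at *
  constructor <;> linarith [a3.1, a3.2, b3.1, b3.2, hgrid.1, hgrid.2]

/-- The density of `S` in the cell `[m l, (m + 1) l)`. -/
noncomputable def dens (S : Set ℕ) (l m : ℕ) : ℝ := cnt S (m * l) ((m + 1) * l) / l

theorem dens_nonneg (S : Set ℕ) (l m : ℕ) : 0 ≤ dens S l m := by unfold dens; positivity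

theorem dens_le_one (S : Set ℕ) (l m : ℕ) : dens S l m ≤ 1 := by
  refine div_le_one_of_le₀ ?_ (Nat.cast_nonneg l)
  have := cnt_le (S := S) (a := m * l) (b := (m + 1) * l)
  have h2 : (m + 1) * l - m * l = l := by rw [add_mul, one_mul, Nat.add_sub_cancel_left]
  exact_mod_cast h2 ▸ this

theorem dens_mul (S : Set ℕ) {l : ℕ} (hl : 0 < l) (m : ℕ) :
    dens S l m * l = cnt S (m * l) ((m + 1) * l) := by
  unfold dens
  field_simp

theorem sum_dens (S : Set ℕ) {l R : ℕ} (hl : 0 < l) (m : ℕ) :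
    ∑ i ∈ Finset.range R, dens S l (m * R + i) = R * dens S (R * l) m := by
  rcases Nat.eq_zero_or_pos R with rfl | hR
  · simp
  have hl' : (l : ℝ) ≠ 0 := by positivity
  have h1 := cnt_grid S (m * (R * l)) l (Nat.zero_le R)
  rw [zero_mul, add_zero, show m * (R * l) + R * l = (m + 1) * (R * l) by ring] at h1
  have h2 : (R * dens S (R * l) m) * l = (cnt S (m * (R * l)) ((m + 1) * (R * l)) : ℝ) := by
    rw [← dens_mul S (Nat.mul_pos hR hl) m]
    push_cast
    ring
  refine mul_right_cancel₀ hl' ?_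
  rw [h2, h1, Finset.sum_mul, Nat.Ico_zero_eq_range]
  push_cast
  refine Finset.sum_congr rfl fun i _ => ?_
  rw [dens_mul S hl]
  congr 2 <;> ring

theorem sum_sq_dens_sub (S : Set ℕ) {l R : ℕ} (hl : 0 < l) (m : ℕ) :
    ∑ i ∈ Finset.range R, (dens S l (m * R + i) - dens S (R * l) m) ^ 2 =
      ∑ i ∈ Finset.range R, dens S l (m * R + i) ^ 2 - R * dens S (R * l) m ^ 2 := by
  have h1 : ∀ i, (dens S l (m * R + i) - dens S (R * l) m) ^ 2 =
      dens S l (m * R + i) ^ 2 - 2 * dens S (R * l) m * dens S l (m * R + i) +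
        dens S (R * l) m ^ 2 := fun i => by ring
  simp_rw [h1]
  rw [Finset.sum_add_distrib, Finset.sum_sub_distrib, ← Finset.mul_sum, sum_dens S hl]
  simp
  ring

/-- The mean square density over the cells with `H ≤ m < 2 H`. -/
noncomputable def energy (S : Set ℕ) (H l : ℕ) : ℝ :=
  (∑ m ∈ Finset.Ico H (2 * H), dens S l m ^ 2) / H

theorem energy_nonneg (S : Set ℕ) (H l : ℕ) : 0 ≤ energy S H l := by
  unfold energy; positivity

theorem energy_le_one (S : Set ℕ) (H l : ℕ) : energy S H l ≤ 1 := by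
  refine div_le_one_of_le₀ ?_ (Nat.cast_nonneg H)
  have := Finset.sum_le_card_nsmul (Finset.Ico H (2 * H)) (fun m => dens S l m ^ 2) 1
    fun m _ => pow_le_one₀ (dens_nonneg S l m) (dens_le_one S l m)
  rw [Nat.card_Ico, show 2 * H - H = H by omega] at this
  simpa using this

theorem sum_Ico_mul (g : ℕ → ℝ) (R : ℕ) {a b : ℕ} (hab : a ≤ b) :
    ∑ x ∈ Finset.Ico (a * R) (b * R), g x =
      ∑ m ∈ Finset.Ico a b, ∑ i ∈ Finset.range R, g (m * R + i) := by
  induction b, hab using Nat.le_induction with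
  | base => simp
  | succ b hab ih =>
    rw [Finset.sum_Ico_succ_top hab, ← ih, ← Finset.sum_Ico_consecutive _
      (Nat.mul_le_mul_right R hab) (Nat.mul_le_mul_right R (Nat.le_succ b)),
      Finset.sum_Ico_eq_sum_range (m := b * R)]
    rw [show b.succ * R - b * R = R by rw [Nat.succ_mul]; omega]

/-- Refining the cells R times raises the mean square by the variance inside the cells. -/
theorem energy_sub (S : Set ℕ) {H l R : ℕ} (hH : 0 < H) (hR : 0 < R) (hl : 0 < l) :
    (H * R) * (energy S (H * R) l - energy S H (R * l)) =
      ∑ m ∈ Finset.Ico H (2 * H), ∑ i ∈ Finset.range R,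
        (dens S l (m * R + i) - dens S (R * l) m) ^ 2 := by
  simp_rw [sum_sq_dens_sub S hl]
  rw [Finset.sum_sub_distrib, ← sum_Ico_mul (fun x => dens S l x ^ 2) R (by omega),
    ← Finset.mul_sum, energy, energy, ← mul_assoc]
  push_cast
  field_simp

/-- The bound |x| ≤ x²/(2s) + s/2 turns mean-square into mean deviation; 2/R accounts for the two
incomplete cells at the ends. -/
theorem abs_cnt_sub_dens_le {S : Set ℕ} {l R m a b : ℕ} {s : ℝ} (hl : 0 < l) (hR : 0 < R)
    (hs : 0 < s)
    (h : ∑ i ∈ Finset.range R, (dens S l (m * R + i) - dens S (R * l) m) ^ 2 ≤ s ^ 2 * R)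
    (ha : m * (R * l) ≤ a) (hab : a ≤ b) (hb : b ≤ m * (R * l) + R * l) :
    |(cnt S a b : ℝ) - dens S (R * l) m * (b - a)| ≤ (s + 2 / R) * ((R * l : ℕ) : ℝ) := by
  have hl' : (0 : ℝ) < l := by exact_mod_cast hl
  have hR' : (0 : ℝ) < R := by exact_mod_cast hR
  have h1 : ∑ i ∈ Finset.range R, |dens S l (m * R + i) - dens S (R * l) m| ≤ s * R := by
    have : ∀ x : ℝ, |x| ≤ 1 / (2 * s) * x ^ 2 + s / 2 := fun x => by
      rw [← sq_abs, div_mul_eq_mul_div, one_mul, div_add_div _ _ (by positivity) (by norm_num),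
        le_div_iff₀ (by positivity)]
      nlinarith [sq_nonneg (|x| - s)]
    refine (Finset.sum_le_sum fun i _ => this _).trans ?_
    rw [Finset.sum_add_distrib, ← Finset.mul_sum, Finset.sum_const, Finset.card_range, nsmul_eq_mul]
    calc _ ≤ 1 / (2 * s) * (s ^ 2 * R) + R * (s / 2) := by gcongr
      _ = s * R := by field_simp; ring
  have h2 := abs_cnt_sub_le (S := S) (p := m * (R * l)) (R := R) (V := s * R * l)
    (dens_nonneg S (R * l) m) (dens_le_one S (R * l) m) hl (by
      rw [Finset.sum_congr rfl
        (g := fun i => |dens S l (m * R + i) - dens S (R * l) m| * l) fun i _ => ?_,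
        ← Finset.sum_mul]
      · gcongr
      · rw [← abs_of_pos hl', ← abs_mul, abs_of_pos hl', sub_mul, dens_mul S hl]
        congr 4 <;> ring) ha hab hb
  refine h2.trans (le_of_eq ?_)
  push_cast
  field_simp

theorem exists_increment_le {F : ℕ → ℝ} {B : ℝ} (h0 : ∀ i, 0 ≤ F i) (hB : ∀ i, F i ≤ B) {I : ℕ}
    (hI : 0 < I) : ∃ s < I, F (s + 1) - F s ≤ B / I := by
  by_contra hc
  push Not at hc
  have h1 := Finset.sum_lt_sum_of_nonempty (s := Finset.range I) (Finset.nonempty_range_iff.2 hI.ne')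
    fun i hi => hc i (Finset.mem_range.1 hi)
  rw [Finset.sum_range_sub, Finset.sum_const, Finset.card_range, nsmul_eq_mul] at h1
  have hI' : (0 : ℝ) < I := by exact_mod_cast hI
  rw [mul_div_cancel₀ _ hI'.ne'] at h1
  linarith [h0 0, hB I]

/-- The width of the cells at level `k`. -/
def cellWidth (K u k : ℕ) : ℕ := 2 ^ (K + 6 - k) * u

theorem cellWidth_eq_two_mul {K u k : ℕ} (hk : k < K + 6) :
    cellWidth K u k = 2 * cellWidth K u (k + 1) := by
  rw [cellWidth, cellWidth, ← mul_assoc, ← pow_succ']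
  congr 2
  omega

theorem cellWidth_mul (K R u k : ℕ) : cellWidth K (R * u) k = R * cellWidth K u k := by
  rw [cellWidth, cellWidth, Nat.mul_left_comm]

theorem cellWidth_pos {K u k : ℕ} (hu : 0 < u) : 0 < cellWidth K u k := by
  unfold cellWidth; positivity

theorem two_pow_mul_cellWidth {K u k : ℕ} (hk : k ≤ K + 6) :
    2 ^ k * cellWidth K u k = cellWidth K u 0 := by
  rw [cellWidth, cellWidth, ← mul_assoc, ← pow_add]
  congr 2
  omega

theorem cellWidth_le {K u k k' : ℕ} (h : k ≤ k') : cellWidth K u k' ≤ cellWidth K u k :=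
  Nat.mul_le_mul_right u (Nat.pow_le_pow_right (by norm_num) (by omega))

/-- The cell of level `k` with number `m`, for `H ≤ m < 2 H`. -/
structure InCell (H u K k m a : ℕ) : Prop where
  ge : H ≤ m
  lt : m < 2 * H
  le : m * cellWidth K u k ≤ a
  lt_succ : a < (m + 1) * cellWidth K u k

namespace InCell
variable {H u K k m k' m' a : ℕ}

/-- Level k fills [Hw, 2Hw), with w its width, and w halves from level to level. -/
theorem level_unique (h : InCell H u K k m a) (h' : InCell H u K k' m' a) (hk : k ≤ K) (hk' : k' ≤ K) :
    k = k' := by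
  have key : ∀ {k m k' m'}, InCell H u K k m a → InCell H u K k' m' a → k' ≤ K → ¬ k < k' := by
    intro k m k' m' h h' hk' hlt
    have h1 : 2 * cellWidth K u k' ≤ cellWidth K u k := by
      rw [cellWidth_eq_two_mul (show k < K + 6 by omega)]
      exact Nat.mul_le_mul_left 2 (cellWidth_le hlt)
    have h2 := h.le
    have h3 := h'.lt_succ
    have h4 : H * cellWidth K u k ≤ m * cellWidth K u k := Nat.mul_le_mul_right _ h.ge
    have h5 : (m' + 1) * cellWidth K u k' ≤ 2 * H * cellWidth K u k' :=
      Nat.mul_le_mul_right _ h'.lt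
    have h6 := Nat.mul_le_mul_left H h1
    have h7 : H * (2 * cellWidth K u k') = 2 * H * cellWidth K u k' := by ring
    omega
  have h1 := key h h' hk'
  have h2 := key h' h hk
  omega

theorem place_unique (h : InCell H u K k m a) (h' : InCell H u K k m' a) : m = m' := by
  have h1 : ∀ {m}, InCell H u K k m a → a / cellWidth K u k = m := fun h =>
    Nat.div_eq_of_lt_le h.le h.lt_succ
  rw [← h1 h, h1 h']

theorem exists_of_le (hu : 0 < u) (h1 : H * cellWidth K u 0 ≤ 2 ^ K * a)
    (h2 : a < 2 * H * cellWidth K u 0) : ∃ k ≤ K, ∃ m, InCell H u K k m a := by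
  classical
  have hex : ∃ k, H * cellWidth K u 0 ≤ 2 ^ k * a := ⟨K, h1⟩
  have hk := Nat.find_spec hex
  have hkK : Nat.find hex ≤ K := Nat.find_min' hex h1
  have hlt : 2 ^ Nat.find hex * a < 2 * H * cellWidth K u 0 := by
    rcases Nat.eq_zero_or_pos (Nat.find hex) with h0 | h0
    · rw [h0]; simpa using h2
    · have := Nat.find_min hex (Nat.sub_lt h0 one_pos)
      have hs : 2 ^ Nat.find hex = 2 * 2 ^ (Nat.find hex - 1) := by
        rw [← pow_succ']; congr 1; omega
      rw [hs]
      push Not at this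
      nlinarith
  generalize Nat.find hex = k at *
  have hw := two_pow_mul_cellWidth (u := u) (show k ≤ K + 6 by omega)
  have hwp := cellWidth_pos (K := K) (k := k) hu
  rw [← hw] at hk hlt
  have hk' : H * cellWidth K u k ≤ a := by
    refine le_of_mul_le_mul_left ?_ (show 0 < 2 ^ k by positivity)
    linarith
  have hlt' : a < 2 * H * cellWidth K u k := by
    refine lt_of_mul_lt_mul_left ?_ (Nat.zero_le (2 ^ k))
    linarith
  refine ⟨k, hkK, a / cellWidth K u k, ?_, ?_, Nat.div_mul_le_self _ _, ?_⟩
  · exact (Nat.le_div_iff_mul_le hwp).2 hk'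
  · exact (Nat.div_lt_iff_lt_mul hwp).2 hlt'
  · exact Nat.lt_mul_of_div_lt (Nat.lt_succ_self _) hwp

end InCell

/-- Every cell of `A` is equidistributed in residue classes, at all levels up to `K`. -/
structure Regularized (A : Set ℕ) (H u K : ℕ) (ρ : ℕ → ℕ → ZMod 24 → ℝ) (E ε : ℝ) : Prop where
  reg : ∀ k ≤ K, ∀ m, H ≤ m → m < 2 * H →
    Regular A (m * cellWidth K u k) (cellWidth K u k) (ρ m k) E ε
  nonneg : ∀ m k r, 0 ≤ ρ m k r
  zero : ∀ m k r, K < k → ρ m k r = 0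
  cover : ∀ a ∈ A, ∃ k ≤ K, ∃ m, InCell H u K k m a

/-- The part of `A` in good places and non-negligible residue classes. -/
def cleaned (A : Set ℕ) (H u K : ℕ) (bad : Finset ℕ) (ε : ℝ) : Set ℕ :=
  {a | a ∈ A ∧ ∃ k ≤ K, ∃ m, InCell H u K k m a ∧ m ∉ bad ∧
    ε ≤ dens (resCls A a) (cellWidth K u k) m}

/-- The places at which some density varies. -/
noncomputable def badPlaces (A : Set ℕ) (H u K R : ℕ) (s : ℝ) : Finset ℕ := by
  classical
  exact (Finset.Ico H (2 * H)).filter fun m => ∃ k ≤ K, ∃ r,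
    s ^ 2 * R < ∑ i ∈ Finset.range R, (dens (resCls A r) (cellWidth K u k) (m * R + i) -
      dens (resCls A r) (R * cellWidth K u k) m) ^ 2

theorem mem_badPlaces {A : Set ℕ} {H u K R m : ℕ} {s : ℝ} : m ∈ badPlaces A H u K R s ↔
    (H ≤ m ∧ m < 2 * H) ∧ ∃ k ≤ K, ∃ r,
    s ^ 2 * R < ∑ i ∈ Finset.range R, (dens (resCls A r) (cellWidth K u k) (m * R + i) -
      dens (resCls A r) (R * cellWidth K u k) m) ^ 2 := by
  classical
  rw [badPlaces, Finset.mem_filter, Finset.mem_Ico]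

/-- The energy of all residue classes and levels. -/
noncomputable def totalEnergy (A : Set ℕ) (H u K : ℕ) : ℝ :=
  ∑ k ∈ Finset.range (K + 1), ∑ r : ZMod 24, energy (resCls A r) H (cellWidth K u k)

theorem totalEnergy_nonneg (A : Set ℕ) (H u K : ℕ) : 0 ≤ totalEnergy A H u K :=
  Finset.sum_nonneg fun _ _ => Finset.sum_nonneg fun _ _ => energy_nonneg _ _ _

theorem totalEnergy_le (A : Set ℕ) (H u K : ℕ) : totalEnergy A H u K ≤ 24 * (K + 1) := by
  have h1 : ∀ k ∈ Finset.range (K + 1), ∑ r : ZMod 24, energy (resCls A r) H (cellWidth K u k) ≤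
      24 := fun k _ => by
    have := Finset.sum_le_card_nsmul Finset.univ
      (fun r : ZMod 24 => energy (resCls A r) H (cellWidth K u k)) 1 fun r _ => energy_le_one _ _ _
    rw [Finset.card_univ, ZMod.card, nsmul_eq_mul] at this
    norm_num at this
    exact this
  have := Finset.sum_le_card_nsmul _ _ _ h1
  rw [Finset.card_range, nsmul_eq_mul] at this
  push_cast at this
  unfold totalEnergy
  linarith

/-- A bad place contributes at least s²R to the total variance, which is HR times the energy
increment. -/
theorem card_badPlaces_le (A : Set ℕ) {H u K R : ℕ} (s : ℝ) (hH : 0 < H) (hu : 0 < u) (hR : 0 < R) :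
    (badPlaces A H u K R s).card * s ^ 2 ≤
      H * (totalEnergy A (H * R) u K - totalEnergy A H (R * u) K) := by
  have hR' : (0 : ℝ) < R := by exact_mod_cast hR
  set G : ℕ → ℕ → ZMod 24 → ℝ := fun m k r =>
    ∑ i ∈ Finset.range R, (dens (resCls A r) (cellWidth K u k) (m * R + i) -
      dens (resCls A r) (R * cellWidth K u k) m) ^ 2 with hG
  have hG0 : ∀ m k r, 0 ≤ G m k r := fun m k r => Finset.sum_nonneg fun i _ => sq_nonneg _
  have h1 : (H * R : ℝ) * (totalEnergy A (H * R) u K - totalEnergy A H (R * u) K) =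
      ∑ m ∈ Finset.Ico H (2 * H), ∑ k ∈ Finset.range (K + 1), ∑ r, G m k r := by
    rw [Finset.sum_comm, totalEnergy, totalEnergy, ← Finset.sum_sub_distrib, Finset.mul_sum]
    refine Finset.sum_congr rfl fun k _ => ?_
    rw [Finset.sum_comm, ← Finset.sum_sub_distrib, Finset.mul_sum]
    refine Finset.sum_congr rfl fun r _ => ?_
    rw [cellWidth_mul, energy_sub _ hH hR (cellWidth_pos hu)]
  have hsub : badPlaces A H u K R s ⊆ Finset.Ico H (2 * H) := fun m hm =>
    Finset.mem_Ico.2 (mem_badPlaces.1 hm).1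
  have h2 : (badPlaces A H u K R s).card * (s ^ 2 * R) ≤
      ∑ m ∈ badPlaces A H u K R s, ∑ k ∈ Finset.range (K + 1), ∑ r, G m k r := by
    rw [← nsmul_eq_mul]
    refine Finset.card_nsmul_le_sum _ _ _ fun m hm => ?_
    obtain ⟨-, k, hk, r, hr⟩ := mem_badPlaces.1 hm
    calc s ^ 2 * R ≤ G m k r := hr.le
      _ ≤ ∑ r, G m k r := Finset.single_le_sum (fun r _ => hG0 m k r) (Finset.mem_univ r)
      _ ≤ _ := Finset.single_le_sum (f := fun k => ∑ r, G m k r)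
        (fun k _ => Finset.sum_nonneg fun r _ => hG0 m k r) (Finset.mem_range.2 (by omega))
  have h3 := Finset.sum_le_sum_of_subset_of_nonneg hsub
    (f := fun m => ∑ k ∈ Finset.range (K + 1), ∑ r, G m k r)
    fun m _ _ => Finset.sum_nonneg fun k _ => Finset.sum_nonneg fun r _ => hG0 m k r
  have h4 := h2.trans (h3.trans h1.symm.le)
  refine le_of_mul_le_mul_right ?_ hR'
  linarith

open Classical in
/-- The densities of the cleaned set. -/
noncomputable def cleanedDens (A : Set ℕ) (u K : ℕ) (bad : Finset ℕ) (ε : ℝ) (m k : ℕ)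
    (r : ZMod 24) : ℝ :=
  if k ≤ K ∧ m ∉ bad ∧ ε ≤ dens (resCls A r) (cellWidth K u k) m then
    dens (resCls A r) (cellWidth K u k) m else 0

/-- In a kept cell and class the cleaned set agrees with A, elsewhere it is empty and its density is
set to 0. The factor 2^(K + 6) is the width of the largest cell in units of R * u. -/
theorem regularized_cleaned (A : Set ℕ) {H u K R : ℕ} {s ε δ : ℝ} (hu : 0 < u) (hR : 0 < R)
    (hs : 0 < s) (hε : 0 < ε) (hδ : 2 ^ (K + 6) * (s + 2 / R) ≤ δ) :
    Regularized (cleaned A H (R * u) K (badPlaces A H u K R s) ε) H (R * u) K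
      (cleanedDens A (R * u) K (badPlaces A H u K R s) ε) (δ * (R * u : ℕ)) ε := by
  classical
  set bad := badPlaces A H u K R s with hbad
  have hδ0 : 0 ≤ δ := le_trans (by positivity) hδ
  refine
    { reg := fun k hk m hm1 hm2 => ⟨?_, ?_, ?_⟩
      nonneg := ?_
      zero := ?_
      cover := ?_ }
  · intro r a b ha hab hb
    by_cases hc : k ≤ K ∧ m ∉ bad ∧ ε ≤ dens (resCls A r) (cellWidth K (R * u) k) m
    · rw [cleanedDens, if_pos hc]
      have h1 : cnt (resCls (cleaned A H (R * u) K bad ε) r) a b = cnt (resCls A r) a b := by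
        rw [cnt, cnt]
        congr 1
        ext x
        simp only [mem_elts]
        refine and_congr_right fun hx => ⟨fun h => ⟨h.1.1, h.2⟩, fun h => ⟨⟨h.1, k, hk, m, ?_, hc.2.1,
          by rw [h.2]; exact hc.2.2⟩, h.2⟩⟩
        exact ⟨hm1, hm2, by omega, by rw [add_mul, one_mul]; omega⟩
      rw [h1]
      rw [cellWidth_mul] at *
      refine (abs_cnt_sub_dens_le (cellWidth_pos hu) hR hs ?_ ha hab hb).trans ?_
      · by_contra hlt
        push Not at hlt
        exact hc.2.1 (mem_badPlaces.2 ⟨⟨hm1, hm2⟩, k, hk, r, hlt⟩)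
      · have h2 : ((R * cellWidth K u k : ℕ) : ℝ) ≤ 2 ^ (K + 6) * ((R * u : ℕ) : ℝ) := by
          have := cellWidth_le (K := K) (u := R * u) (Nat.zero_le k)
          rw [cellWidth_mul] at this
          have h3 : cellWidth K (R * u) 0 = 2 ^ (K + 6) * (R * u) := rfl
          rw [h3] at this
          exact_mod_cast this
        calc (s + 2 / R) * ((R * cellWidth K u k : ℕ) : ℝ)
            ≤ (s + 2 / R) * (2 ^ (K + 6) * ((R * u : ℕ) : ℝ)) := by gcongr
          _ = (2 ^ (K + 6) * (s + 2 / R)) * ((R * u : ℕ) : ℝ) := by ring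
          _ ≤ _ := by gcongr
    · rw [cleanedDens, if_neg hc]
      have h1 : cnt (resCls (cleaned A H (R * u) K bad ε) r) a b = 0 := by
        rw [cnt, Finset.card_eq_zero, Finset.eq_empty_iff_forall_notMem]
        intro x hx
        obtain ⟨hx1, ⟨-, k', hk', m', hc', hb', hd'⟩, hx3⟩ := mem_elts.1 hx
        have hcell : InCell H (R * u) K k m x :=
          ⟨hm1, hm2, by omega, by rw [add_mul, one_mul]; omega⟩
        obtain rfl := hcell.level_unique hc' hk hk'
        obtain rfl := hcell.place_unique hc'
        exact hc ⟨hk, hb', by rwa [hx3] at hd'⟩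
      rw [h1]
      simp
      positivity
  · intro r
    unfold cleanedDens
    split_ifs with h
    · exact Or.inr h.2.2
    · exact Or.inl rfl
  · intro r x h0 hx hx1 hx2 hr
    obtain ⟨-, k', hk', m', hc', hb', hd'⟩ := hx
    have hcell : InCell H (R * u) K k m x := ⟨hm1, hm2, hx1, by rw [add_mul, one_mul]; omega⟩
    obtain rfl := hcell.level_unique hc' hk hk'
    obtain rfl := hcell.place_unique hc'
    rw [hr] at hd'
    rw [cleanedDens, if_pos ⟨hk, hb', hd'⟩] at h0
    linarith
  · intro m k r
    unfold cleanedDens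
    split_ifs
    · exact dens_nonneg _ _ _
    · exact le_rfl
  · intro m k r hk
    rw [cleanedDens, if_neg fun h => by omega]
  · rintro a ⟨-, k, hk, m, hm, -⟩
    exact ⟨k, hk, m, hm⟩

/-- Lost are the elements below all cells, those at bad places, and those in classes of density
below ε. No level loses more than the bound for level 0, hence the factor K + 1. -/
theorem card_le_card_cleaned_add {A A' : Finset ℕ} {H u K : ℕ} {bad : Finset ℕ} {ε : ℝ} (hu : 0 < u)
    (hε : 0 ≤ ε) (hA : ∀ a ∈ A, a < 2 * H * cellWidth K u 0)
    (hA' : ∀ a, a ∈ A' ↔ a ∈ cleaned (A : Set ℕ) H u K bad ε) :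
    (A.card : ℝ) ≤ A'.card + (H * cellWidth K u K + (K + 1) * (bad.card * cellWidth K u 0 +
      24 * H * (ε * cellWidth K u 0))) := by
  classical
  have hcell : ∀ k m, (Finset.Ico (m * cellWidth K u k) ((m + 1) * cellWidth K u k)).card ≤
      cellWidth K u 0 := fun k m => by
    rw [Nat.card_Ico, add_mul, one_mul, Nat.add_sub_cancel_left]
    exact cellWidth_le (Nat.zero_le k)
  set U : ℕ → Finset ℕ := fun k =>
    (bad.biUnion fun m => Finset.Ico (m * cellWidth K u k) ((m + 1) * cellWidth K u k)) with hU
  set V : ℕ → ℕ → ZMod 24 → Finset ℕ := fun k m r =>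
    if dens (resCls A r) (cellWidth K u k) m < ε then
      elts (resCls A r) (m * cellWidth K u k) ((m + 1) * cellWidth K u k) else ∅ with hV
  set V' : ℕ → Finset ℕ := fun k =>
    ((Finset.Ico H (2 * H)).biUnion fun m => Finset.univ.biUnion fun r => V k m r) with hV'
  have hsub : A ⊆ A' ∪ (Finset.range (H * cellWidth K u K) ∪
      (Finset.range (K + 1)).biUnion fun k => U k ∪ V' k) := by
    intro a ha
    by_cases hlow : a < H * cellWidth K u K
    · exact Finset.mem_union_right _ (Finset.mem_union_left _ (Finset.mem_range.2 hlow))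
    push Not at hlow
    obtain ⟨k, hk, m, hm⟩ := InCell.exists_of_le (K := K) hu (by
      have := Nat.mul_le_mul_left (2 ^ K) hlow
      rw [Nat.mul_left_comm, two_pow_mul_cellWidth (by omega)] at this
      exact this) (hA a ha)
    have hmIco : a ∈ Finset.Ico (m * cellWidth K u k) ((m + 1) * cellWidth K u k) :=
      Finset.mem_Ico.2 ⟨hm.le, hm.lt_succ⟩
    by_cases hb : m ∈ bad
    · refine Finset.mem_union_right _ (Finset.mem_union_right _ (Finset.mem_biUnion.2
        ⟨k, Finset.mem_range.2 (by omega), Finset.mem_union_left _ (Finset.mem_biUnion.2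
        ⟨m, hb, hmIco⟩)⟩))
    by_cases hd : ε ≤ dens (resCls A a) (cellWidth K u k) m
    · exact Finset.mem_union_left _ ((hA' a).2 ⟨ha, k, hk, m, hm, hb, hd⟩)
    · push Not at hd
      refine Finset.mem_union_right _ (Finset.mem_union_right _ (Finset.mem_biUnion.2
        ⟨k, Finset.mem_range.2 (by omega), Finset.mem_union_right _ (Finset.mem_biUnion.2
        ⟨m, Finset.mem_Ico.2 ⟨hm.ge, hm.lt⟩, Finset.mem_biUnion.2 ⟨a, Finset.mem_univ _, ?_⟩⟩)⟩))
      rw [hV]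
      simp only [if_pos hd]
      exact mem_elts.2 ⟨⟨hm.le, hm.lt_succ⟩, ha, rfl⟩
  have hUc : ∀ k, ((U k).card : ℝ) ≤ bad.card * cellWidth K u 0 := fun k => by
    exact_mod_cast Finset.card_biUnion_le_card_mul _ _ _ fun m _ => hcell k m
  have hVc : ∀ k m r, ((V k m r).card : ℝ) ≤ ε * cellWidth K u 0 := fun k m r => by
    simp only [hV]
    split_ifs with h
    · have h1 := dens_mul (resCls A r) (cellWidth_pos (K := K) (k := k) hu) m
      rw [show (elts (resCls A r) (m * cellWidth K u k) ((m + 1) * cellWidth K u k)).card =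
        cnt (resCls A r) (m * cellWidth K u k) ((m + 1) * cellWidth K u k) from rfl, ← h1]
      have h2 : (cellWidth K u k : ℝ) ≤ cellWidth K u 0 := by
        exact_mod_cast cellWidth_le (Nat.zero_le k)
      gcongr
    · simp
      positivity
  have hVc' : ∀ k, ((V' k).card : ℝ) ≤ 24 * H * (ε * cellWidth K u 0) := fun k => by
    have h1 : ((V' k).card : ℝ) ≤ ∑ m ∈ Finset.Ico H (2 * H), ∑ r, ((V k m r).card : ℝ) := by
      exact_mod_cast Finset.card_biUnion_le.trans (Finset.sum_le_sum fun m _ =>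
        Finset.card_biUnion_le)
    refine h1.trans ((Finset.sum_le_sum fun m _ => Finset.sum_le_sum fun r _ => hVc k m r).trans ?_)
    rw [Finset.sum_const, Finset.sum_const, Finset.card_univ, ZMod.card, Nat.card_Ico,
      show 2 * H - H = H by omega, nsmul_eq_mul, nsmul_eq_mul]
    push_cast
    linarith
  have h1 : (A.card : ℝ) ≤ A'.card + (H * cellWidth K u K +
      ∑ k ∈ Finset.range (K + 1), (((U k).card : ℝ) + (V' k).card)) := by
    have := (Finset.card_le_card hsub).trans ((Finset.card_union_le _ _).trans
      (Nat.add_le_add_left ((Finset.card_union_le _ _).trans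
      (Nat.add_le_add (Finset.card_range _).le (Finset.card_biUnion_le.trans
        (Finset.sum_le_sum fun k _ => Finset.card_union_le _ _)))) _))
    exact_mod_cast this
  have h2 := Finset.sum_le_card_nsmul (Finset.range (K + 1))
    (fun k => ((U k).card : ℝ) + (V' k).card) _ fun k _ => add_le_add (hUc k) (hVc' k)
  rw [Finset.card_range, nsmul_eq_mul] at h2
  push_cast at h2
  linarith

/-- A regularity lemma: up to few elements, every set is equidistributed in the cells of one of
boundedly many scales. -/
theorem exists_regularized (K : ℕ) {H₀ : ℕ} (hH₀ : 0 < H₀) {ε δ c : ℝ} (hε : 0 < ε) (hδ : 0 < δ)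
    (hc : 0 < c) : ∃ M, 0 < M ∧ ∀ v, 0 < v → ∀ A : Finset ℕ,
      (∀ a ∈ A, a < 2 * (H₀ * M) * cellWidth K v 0) →
      ∃ g u ρ, 0 < g ∧ v ≤ u ∧ g * u = M * v ∧ ∃ A' ⊆ A,
        Regularized (A' : Set ℕ) (H₀ * g) u K ρ (δ * u) ε ∧
        (A.card : ℝ) ≤ A'.card + (1 / 2 ^ K + (K + 1) * (c + 24 * ε)) *
          ((H₀ * g : ℕ) * cellWidth K u 0) := by
  classical
  obtain ⟨s, hs, hs'⟩ : ∃ s : ℝ, 0 < s ∧ 2 ^ (K + 6) * (s + s) ≤ δ :=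
    ⟨δ / (2 * 2 ^ (K + 6)), by positivity, le_of_eq (by field_simp; norm_num)⟩
  obtain ⟨R, hR⟩ := exists_nat_gt (2 / s)
  have hR0 : (0 : ℝ) < R := lt_trans (by positivity) hR
  have hRpos : 0 < R := by exact_mod_cast hR0
  have hRs : 2 / (R : ℝ) ≤ s := by
    rw [div_le_iff₀ hR0]
    rw [div_lt_iff₀ hs] at hR
    linarith
  obtain ⟨I, hI⟩ := exists_nat_gt (24 * (K + 1) / (c * s ^ 2))
  have hI0 : (0 : ℝ) < I := lt_trans (by positivity) hI
  have hIpos : 0 < I := by exact_mod_cast hI0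
  have hIc : 24 * (K + 1) / (I : ℝ) ≤ c * s ^ 2 := by
    rw [div_le_iff₀ hI0]
    rw [div_lt_iff₀ (by positivity)] at hI
    linarith
  -- The scales have H = H₀Rⁱ and unit R^(I−i) v. Their product is constant, so all of them cover
  -- the same range, and pigeonhole on the energy chooses i.
  refine ⟨R ^ I, by positivity, fun v hv A hA => ?_⟩
  obtain ⟨i, hi, hE⟩ := exists_increment_le
    (F := fun i => totalEnergy A (H₀ * R ^ i) (R ^ (I - i) * v) K)
    (fun i => totalEnergy_nonneg _ _ _ _) (fun i => totalEnergy_le _ _ _ _) hIpos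
  set u := R ^ (I - (i + 1)) * v with hu
  have hupos : 0 < u := by positivity
  have hRu : R ^ (I - i) * v = R * u := by
    rw [hu, ← mul_assoc, ← pow_succ']
    congr 2
    omega
  have hgu : R ^ i * (R * u) = R ^ I * v := by
    rw [← hRu, ← mul_assoc, ← pow_add]
    congr 2
    omega
  simp only [hRu] at hE
  set H := H₀ * R ^ i with hH
  have hHpos : 0 < H := by positivity
  have hbad := card_badPlaces_le (A : Set ℕ) (K := K) s hHpos hupos hRpos
  rw [show H₀ * R ^ (i + 1) = H * R by rw [pow_succ, hH, mul_assoc]] at hE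
  have hbad' : ((badPlaces A H u K R s).card : ℝ) ≤ c * H := by
    have h1 : (0 : ℝ) < s ^ 2 := by positivity
    have h2 : (0 : ℝ) ≤ H := Nat.cast_nonneg _
    refine le_of_mul_le_mul_right ?_ h1
    have := mul_le_mul_of_nonneg_left (hE.trans hIc) h2
    linarith
  set A' := A.filter (· ∈ cleaned (A : Set ℕ) H (R * u) K (badPlaces A H u K R s) ε) with hA'
  have hmem : ∀ a, a ∈ A' ↔ a ∈ cleaned (A : Set ℕ) H (R * u) K (badPlaces A H u K R s) ε :=
    fun a => by
      rw [hA', Finset.mem_filter]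
      exact ⟨fun h => h.2, fun h => ⟨h.1, h⟩⟩
  refine ⟨R ^ i, R * u, cleanedDens A (R * u) K (badPlaces (A : Set ℕ) H u K R s) ε, by positivity, ?_, hgu, A', Finset.filter_subset _ _, ?_, ?_⟩
  · rw [← hRu]
    exact Nat.le_mul_of_pos_left v (by positivity)
  · rw [show (A' : Set ℕ) = cleaned (A : Set ℕ) H (R * u) K (badPlaces A H u K R s) ε from
      Set.ext hmem]
    exact regularized_cleaned _ hupos hRpos hs hε (le_trans (by gcongr) hs')
  · have hw0 : (0 : ℝ) ≤ cellWidth K (R * u) 0 := Nat.cast_nonneg _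
    have h1 := card_le_card_cleaned_add (by positivity) hε.le (fun a ha => ?_) hmem
    · have h2 : ((cellWidth K (R * u) K : ℕ) : ℝ) = 1 / 2 ^ K * cellWidth K (R * u) 0 := by
        rw [← two_pow_mul_cellWidth (u := R * u) (show K ≤ K + 6 by omega)]
        push_cast
        field_simp
      rw [h2] at h1
      have h3 := mul_le_mul_of_nonneg_right hbad' hw0
      have h4 : (0 : ℝ) ≤ K + 1 := by positivity
      have h5 := mul_le_mul_of_nonneg_left h3 h4
      linarith
    · have h3 := hA a ha
      have h4 : 2 * (H₀ * R ^ I) * cellWidth K v 0 = 2 * H * cellWidth K (R * u) 0 := by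
        rw [cellWidth, cellWidth, hH]
        calc _ = 2 * H₀ * 2 ^ (K + 6 - 0) * (R ^ I * v) := by ring
          _ = _ := by rw [← hgu]; ring
      rwa [h4] at h3

/-! ### Multipliers and their densities -/

/-- The multiples of elements of `A` by powers of two. -/
def multipliers (A : Set ℕ) : Set ℕ := {y | ∃ i, ∃ a ∈ A, y = 2 ^ i * a}

theorem mem_multipliers_iff {A : Set ℕ} {y : ℕ} :
    y ∈ multipliers A ↔ y ∈ A ∨ ∃ z ∈ multipliers A, y = 2 * z := by
  constructor
  · rintro ⟨i, a, ha, rfl⟩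
    rcases i with _ | i
    · exact Or.inl (by simpa using ha)
    · exact Or.inr ⟨2 ^ i * a, ⟨i, a, ha, rfl⟩, by ring⟩
  · rintro (hy | ⟨z, ⟨i, a, ha, rfl⟩, rfl⟩)
    · exact ⟨0, y, hy, by simp⟩
    · exact ⟨i + 1, a, ha, by ring⟩

/-- Such a double is a proper multiple of an element of A. This keeps A disjoint from the doubled
multipliers, so that no multiplier is counted twice. -/
theorem HasPropertyP.two_mul_not_mem {A : Set ℕ} (h : HasPropertyP A) (hpos : ∀ a ∈ A, 0 < a)
    {z : ℕ} (hz : z ∈ multipliers A) : 2 * z ∉ A := by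
  obtain ⟨i, a, ha, rfl⟩ := hz
  intro hc
  have h0 := hpos a ha
  have h1 : 0 < 2 ^ i := by positivity
  refine h.not_dvd_of_lt hc ha ?_ (Dvd.intro_left (2 * 2 ^ i) (by ring))
  nlinarith

theorem HasPropertyP.add_ne_mul_multiplier {A : Set ℕ} (h : HasPropertyP A) {u v y : ℕ} (hu : u ∈ A)
    (hv : v ∈ A) (hy : y ∈ multipliers A) (hyu : y < u) (hyv : y < v) (m : ℕ) : u + v ≠ m * y := by
  obtain ⟨i, a, ha, rfl⟩ := hy
  have h1 : a ≤ 2 ^ i * a := Nat.le_mul_of_pos_left a (by positivity)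
  rw [← mul_assoc]
  exact h.add_ne_mul hu hv ha (h1.trans_lt hyu) (h1.trans_lt hyv)

/-- The residue classes whose double is `r`. -/
def halves (r : ZMod 24) : Finset (ZMod 24) := Finset.univ.filter fun r' => 2 * r' = r

theorem mem_halves {r r' : ZMod 24} : r' ∈ halves r ↔ 2 * r' = r := by simp [halves]

theorem card_halves_le (r : ZMod 24) : (halves r).card ≤ 2 := by
  revert r
  decide

theorem HasPropertyP.cnt_multipliers {A : Set ℕ} (h : HasPropertyP A) (hpos : ∀ a ∈ A, 0 < a)
    (r : ZMod 24) (a b : ℕ) : cnt (resCls (multipliers A) r) a b = cnt (resCls A r) a b +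
      cnt (inClasses (multipliers A) (halves r)) ((a + 1) / 2) ((b + 1) / 2) := by
  classical
  have h1 : (elts (inClasses (multipliers A) (halves r)) ((a + 1) / 2) ((b + 1) / 2)).card =
      ((elts (inClasses (multipliers A) (halves r)) ((a + 1) / 2) ((b + 1) / 2)).image
        (2 * ·)).card := (Finset.card_image_of_injective _ fun x y hxy => by simpa using hxy).symm
  rw [cnt, cnt, cnt, h1, ← Finset.card_union_of_disjoint]
  · congr 1
    ext y
    simp only [Finset.mem_union, Finset.mem_image, mem_elts, resCls, inClasses, Set.mem_ofPred_eq,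
      mem_halves]
    constructor
    · rintro ⟨hy, hyD, hr⟩
      rcases mem_multipliers_iff.1 hyD with hyA | ⟨z, hz, rfl⟩
      · exact Or.inl ⟨hy, hyA, hr⟩
      · exact Or.inr ⟨z, ⟨by omega, hz, by rw [← hr]; push_cast; rfl⟩, rfl⟩
    · rintro (⟨hy, hyA, hr⟩ | ⟨z, ⟨hz, hzD, hr⟩, rfl⟩)
      · exact ⟨hy, mem_multipliers_iff.2 (Or.inl hyA), hr⟩
      · exact ⟨by omega, mem_multipliers_iff.2 (Or.inr ⟨z, hzD, rfl⟩), by rw [← hr]; push_cast; rfl⟩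
  · rw [Finset.disjoint_left]
    intro y hy hy'
    obtain ⟨z, hz, rfl⟩ := Finset.mem_image.1 hy'
    exact h.two_mul_not_mem hpos (mem_elts.1 hz).2.1 (mem_elts.1 hy).2.1

/-- The density of the multipliers at a level, from the level below. -/
noncomputable def stepDens (ρ σ : ZMod 24 → ℝ) (r : ZMod 24) : ℝ :=
  ρ r + 1 / 2 * ∑ r', (if 2 * r' = r then σ r' else 0)

theorem stepDens_eq (ρ σ : ZMod 24 → ℝ) (r : ZMod 24) :
    stepDens ρ σ r = ρ r + 1 / 2 * ∑ r' ∈ halves r, σ r' := by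
  rw [stepDens, halves, Finset.sum_filter]

theorem Regular.mono {S : Set ℕ} {p L : ℕ} {ρ : ZMod 24 → ℝ} {E ε E' ε' : ℝ}
    (h : Regular S p L ρ E ε) (hE : E ≤ E') (hε : ε' ≤ ε) : Regular S p L ρ E' ε' :=
  ⟨fun r a b h1 h2 h3 => (h.count r a b h1 h2 h3).trans hE,
    fun r => (h.dich r).imp id fun h => hε.trans h, h.empty⟩

theorem Regular.of_empty {S : Set ℕ} {p L : ℕ} {E ε : ℝ} (hE : 0 ≤ E)
    (h : ∀ s ∈ S, p + L ≤ s) : Regular S p L 0 E ε := by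
  refine ⟨fun r a b _ _ hb => ?_, fun r => Or.inl rfl, fun r s _ hs _ h2 => ?_⟩
  · have : cnt (resCls S r) a b = 0 := by
      rw [cnt, Finset.card_eq_zero, Finset.eq_empty_iff_forall_notMem]
      intro x hx
      obtain ⟨h1, h2, -⟩ := mem_elts.1 hx
      have := h x h2
      omega
    rw [this]
    simpa using hE
  · have := h s hs
    omega

/-- A multiplier is an element of A or the double of a multiplier one level down. A class modulo 24
has at most two halves, hence the error 2E'; doubling halves densities, hence ε'/2. -/
theorem Regular.multipliers {A : Set ℕ} {p L : ℕ} {ρ σ : ZMod 24 → ℝ} {E ε E' ε' ε'' : ℝ}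
    (h : HasPropertyP A) (hpos : ∀ a ∈ A, 0 < a) (hA : Regular A (2 * p) (2 * L) ρ E ε)
    (hD : Regular (multipliers A) p L σ E' ε') (hρ : ∀ r, 0 ≤ ρ r) (hσ : ∀ r, 0 ≤ σ r)
    (hσ1 : ∀ r, σ r ≤ 1) (hE' : 0 ≤ E') (hε : ε'' ≤ ε) (hε' : ε'' ≤ ε' / 2) :
    Regular (_root_.multipliers A) (2 * p) (2 * L) (stepDens ρ σ) (E + 2 * E' + 1) ε'' := by
  have hs0 : ∀ r, 0 ≤ ∑ r' ∈ halves r, σ r' := fun r => Finset.sum_nonneg fun r' _ => hσ r'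
  refine ⟨fun r a b ha hab hb => ?_, fun r => ?_, fun r s h0 hs h1 h2 hr => ?_⟩
  · rw [h.cnt_multipliers hpos, stepDens_eq]
    have h1 := hA.count r a b ha hab hb
    have h2 := hD.le_cnt_inClasses (halves r) (a := (a + 1) / 2) (b := (b + 1) / 2) (by omega)
      (by omega) (by omega)
    have h3 := hD.cnt_inClasses_le (halves r) (a := (a + 1) / 2) (b := (b + 1) / 2) (by omega)
      (by omega) (by omega)
    have h4 : ((halves r).card : ℝ) * E' ≤ 2 * E' := by
      gcongr
      exact_mod_cast card_halves_le r
    have h5 : ∑ r' ∈ halves r, σ r' ≤ 2 := by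
      refine (Finset.sum_le_card_nsmul _ _ _ fun r' _ => hσ1 r').trans ?_
      rw [nsmul_eq_mul, mul_one]
      exact_mod_cast card_halves_le r
    have h6 := hs0 r
    generalize ∑ r' ∈ halves r, σ r' = t at *
    have half : ∀ x : ℕ, (x : ℝ) / 2 ≤ ((x + 1) / 2 : ℕ) ∧ (((x + 1) / 2 : ℕ) : ℝ) ≤ x / 2 + 1 / 2 := by
      intro x
      have h1 : (x : ℝ) ≤ 2 * ((x + 1) / 2 : ℕ) := by exact_mod_cast (by omega)
      have h2 : 2 * (((x + 1) / 2 : ℕ) : ℝ) ≤ x + 1 := by exact_mod_cast (by omega)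
      constructor <;> linarith
    obtain ⟨a1, a2⟩ := half a
    obtain ⟨b1, b2⟩ := half b
    generalize (((a + 1) / 2 : ℕ) : ℝ) = a' at *
    generalize (((b + 1) / 2 : ℕ) : ℝ) = b' at *
    push_cast
    have u1 : t * (b' - a') ≤ t * ((b - a) / 2) + 1 := by nlinarith
    have u2 : t * ((b - a) / 2) - 1 ≤ t * (b' - a') := by nlinarith
    rw [abs_le] at h1 ⊢
    constructor <;> linarith [h1.1, h1.2]
  · by_cases h0 : ρ r = 0
    · by_cases h1 : ∀ r' ∈ halves r, σ r' = 0
      · left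
        rw [stepDens_eq, h0, Finset.sum_eq_zero h1]
        simp
      · right
        push Not at h1
        obtain ⟨r', hr', h2⟩ := h1
        have h3 := hD.ge h2
        have h4 := Finset.single_le_sum (f := σ) (fun r' _ => hσ r') hr'
        rw [stepDens_eq, h0]
        linarith
    · right
      have h3 := hA.ge h0
      have h4 := hs0 r
      rw [stepDens_eq]
      linarith
  · have h3 := hρ r
    have h4 := hs0 r
    rw [stepDens_eq] at h0
    rcases mem_multipliers_iff.1 hs with hsA | ⟨z, hz, rfl⟩
    · exact hA.empty r s (by linarith) hsA h1 h2 hr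
    · have h5 := hD.ne_zero_of_mem hz (by omega) (by omega)
      have h6 : (z : ZMod 24) ∈ halves r := mem_halves.2 (by rw [← hr]; push_cast; rfl)
      have h7 := Finset.single_le_sum (f := σ) (fun r' _ => hσ r') h6
      have h8 := hσ z
      exact h5 (by linarith)

/-- The density of the multipliers at level `k`, where `n` levels from `k` on are non-empty. -/
noncomputable def multDensAux (ρ : ℕ → ZMod 24 → ℝ) : ℕ → ℕ → ZMod 24 → ℝ
  | 0, _ => 0
  | n + 1, k => stepDens (ρ k) (multDensAux ρ n (k + 1))

/-- The density of the multipliers at level `k`, where the levels above `K` are empty. -/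
noncomputable def multDens (ρ : ℕ → ZMod 24 → ℝ) (K k : ℕ) : ZMod 24 → ℝ :=
  multDensAux ρ (K + 1 - k) k

theorem multDens_of_lt (ρ : ℕ → ZMod 24 → ℝ) {K k : ℕ} (hk : K < k) : multDens ρ K k = 0 := by
  rw [multDens, show K + 1 - k = 0 by omega, multDensAux]

theorem multDens_of_le (ρ : ℕ → ZMod 24 → ℝ) {K k : ℕ} (hk : k ≤ K) :
    multDens ρ K k = stepDens (ρ k) (multDens ρ K (k + 1)) := by
  rw [multDens, multDens, show K + 1 - k = (K + 1 - (k + 1)) + 1 by omega, multDensAux]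

theorem multDens_nonneg {ρ : ℕ → ZMod 24 → ℝ} (hρ : ∀ k r, 0 ≤ ρ k r) (K k : ℕ) (r : ZMod 24) :
    0 ≤ multDens ρ K k r := by
  have : ∀ n k r, 0 ≤ multDensAux ρ n k r := by
    intro n
    induction n with
    | zero => intro k r; exact le_rfl
    | succ n ih =>
      intro k r
      rw [multDensAux, stepDens_eq]
      have := Finset.sum_nonneg fun r' (_ : r' ∈ halves r) => ih (k + 1) r'
      have := hρ k r
      linarith
  exact this _ _ _

namespace Regularized
variable {A : Set ℕ} {H u K : ℕ} {ρ : ℕ → ℕ → ZMod 24 → ℝ} {E ε : ℝ}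

theorem le_of_mem (R : Regularized A H u K ρ E ε) {a : ℕ} (ha : a ∈ A) : H * cellWidth K u K ≤ a := by
  obtain ⟨k, hk, m, hm⟩ := R.cover a ha
  exact (Nat.mul_le_mul hm.ge (cellWidth_le hk)).trans hm.le

theorem pos_of_mem (R : Regularized A H u K ρ E ε) (hH : 0 < H) (hu : 0 < u) {a : ℕ} (ha : a ∈ A) :
    0 < a := (Nat.mul_pos hH (cellWidth_pos hu)).trans_le (R.le_of_mem ha)

theorem le_of_mem_multipliers (R : Regularized A H u K ρ E ε) {a : ℕ} (ha : a ∈ multipliers A) :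
    H * cellWidth K u K ≤ a := by
  obtain ⟨i, a, ha, rfl⟩ := ha
  exact (R.le_of_mem ha).trans (Nat.le_mul_of_pos_left a (by positivity))

/-- Levels beyond K lie below all of A, so they are trivially regular and local arguments may look
past K. -/
theorem cell_end_le (u : ℕ) {K k m : ℕ} (hk : K < k) (hm : m < 2 * H) :
    m * cellWidth K u k + cellWidth K u k ≤ H * cellWidth K u K := by
  have h1 := cellWidth_eq_two_mul (u := u) (show K < K + 6 by omega)
  have h2 := cellWidth_le (K := K) (u := u) (show K + 1 ≤ k from hk)
  calc m * cellWidth K u k + cellWidth K u k = (m + 1) * cellWidth K u k := by ring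
    _ ≤ (2 * H) * cellWidth K u (K + 1) := Nat.mul_le_mul hm h2
    _ = _ := by rw [h1]; ring

theorem regular (R : Regularized A H u K ρ E ε) (hE : 0 ≤ E) {m : ℕ} (hm : H ≤ m) (hm' : m < 2 * H)
    (k : ℕ) : Regular A (m * cellWidth K u k) (cellWidth K u k) (ρ m k) E ε := by
  rcases le_or_gt k K with hk | hk
  · exact R.reg k hk m hm hm'
  · rw [show ρ m k = 0 from funext fun r => R.zero m k r hk]
    exact Regular.of_empty hE fun s hs => (cell_end_le u hk hm').trans (R.le_of_mem hs)

/-- Induction upwards from level K + 1, which has no multipliers: per level the error grows at most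
fourfold and the threshold halves. -/
theorem regular_multipliers (R : Regularized A H u K ρ E ε) (h : HasPropertyP A) (hH : 0 < H)
    (hu : 0 < u) (hE : 1 ≤ E) (hε : 0 < ε) (hbig : 4 * (4 ^ (K + 1) * E) ≤ u)
    {m : ℕ} (hm : H ≤ m) (hm' : m < 2 * H) (k : ℕ) :
    Regular (multipliers A) (m * cellWidth K u k) (cellWidth K u k) (multDens (ρ m) K k)
      (4 ^ (K + 1) * E) (ε / 2 ^ (K + 1)) := by
  rcases le_or_gt k K with hk | hk
  swap
  · rw [multDens_of_lt _ hk]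
    exact Regular.of_empty (by positivity) fun s hs =>
      (cell_end_le u hk hm').trans (R.le_of_mem_multipliers hs)
  have key : ∀ n ≤ K + 1, Regular (multipliers A) (m * cellWidth K u (K + 1 - n))
      (cellWidth K u (K + 1 - n)) (multDens (ρ m) K (K + 1 - n)) (4 ^ n * E) (ε / 2 ^ n) := by
    intro n
    induction n with
    | zero =>
      intro _
      rw [multDens_of_lt _ (by omega)]
      exact Regular.of_empty (by positivity) fun s hs =>
        (cell_end_le u (by omega) hm').trans (R.le_of_mem_multipliers hs)
    | succ n ih =>
      intro hn
      have h1 := ih (by omega)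
      have hk : K + 1 - n = (K + 1 - (n + 1)) + 1 := by omega
      have hw := cellWidth_eq_two_mul (u := u) (show K + 1 - (n + 1) < K + 6 by omega)
      rw [← hk] at hw
      rw [multDens_of_le _ (show K + 1 - (n + 1) ≤ K by omega), ← hk]
      have h2 := R.regular (by linarith) hm hm' (K + 1 - (n + 1))
      rw [hw, Nat.mul_left_comm] at h2 ⊢
      have hL : (u : ℝ) ≤ cellWidth K u (K + 1 - n) := by
        exact_mod_cast Nat.le_mul_of_pos_left u (by positivity)
      have h4n : (1 : ℝ) ≤ 4 ^ n := one_le_pow₀ (by norm_num)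
      have h4n' : (4 : ℝ) ^ n ≤ 4 ^ (K + 1) := pow_le_pow_right₀ (by norm_num) (by omega)
      refine (Regular.multipliers h (fun a ha => R.pos_of_mem hH hu ha) h2 h1 (R.nonneg m _)
        (multDens_nonneg (R.nonneg m) K _) (fun r => ?_) (by positivity) (ε'' := ε / 2 ^ (n + 1))
        (div_le_self hε.le (one_le_pow₀ (by norm_num))) (le_of_eq (by
          rw [pow_succ]; field_simp))).mono ?_ le_rfl
      · have h3 := h1.le_inv (cellWidth_pos hu) r
        have hu' : (0 : ℝ) < u := by exact_mod_cast hu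
        have h4 : (1 + 4 ^ n * E) / (cellWidth K u (K + 1 - n) : ℝ) ≤ 2 * (4 ^ (K + 1) * E) / u := by
          gcongr
          nlinarith
        have h5 : 2 * (4 ^ (K + 1) * E) / (u : ℝ) ≤ 1 / 2 := by
          rw [div_le_iff₀ hu']
          linarith
        linarith
      · rw [pow_succ]
        nlinarith
  have h1 := key (K + 1 - k) (by omega)
  rw [show K + 1 - (K + 1 - k) = k by omega] at h1
  refine h1.mono ?_ ?_
  · gcongr
    · norm_num
    · omega
  · gcongr
    · norm_num
    · omega

end Regularized

/-! ### Local bounds at the places of a regularized set -/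

namespace Regularized
variable {A : Set ℕ} {H u K : ℕ} {ρ : ℕ → ℕ → ZMod 24 → ℝ} {E ε : ℝ}

/-- The parameters of a regularized set with property P, with errors small enough for all
purposes. -/
structure Fine (A : Set ℕ) (H u K : ℕ) (ρ : ℕ → ℕ → ZMod 24 → ℝ) (E ε : ℝ) : Prop
    extends Regularized A H u K ρ E ε where
  prop : HasPropertyP A
  H_pos : 0 < H
  u_pos : 0 < u
  one_le : 1 ≤ E
  pos : 0 < ε
  le_one : ε ≤ 1
  big : 10 ^ 24 * (4 ^ (K + 1) * E) ≤ ε / 2 ^ (K + 1) * u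

end Regularized

namespace Regularized.Fine
variable {A : Set ℕ} {H u K : ℕ} {ρ : ℕ → ℕ → ZMod 24 → ℝ} {E ε : ℝ}

theorem div_pow_le_one (R : Fine A H u K ρ E ε) : ε / 2 ^ (K + 1) ≤ 1 :=
  div_le_one_of_le₀ (R.le_one.trans (one_le_pow₀ (by norm_num))) (by positivity)

theorem one_le_mul (R : Fine A H u K ρ E ε) : 1 ≤ 4 ^ (K + 1) * E :=
  one_le_mul_of_one_le_of_one_le (one_le_pow₀ (by norm_num)) R.one_le

theorem le_u (R : Fine A H u K ρ E ε) : 10 ^ 24 * (4 ^ (K + 1) * E) ≤ u :=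
  R.big.trans (mul_le_of_le_one_left (Nat.cast_nonneg u) R.div_pow_le_one)

theorem regA (R : Fine A H u K ρ E ε) {m : ℕ} (hm : H ≤ m) (hm' : m < 2 * H) (k : ℕ) :
    Regular A (m * cellWidth K u k) (cellWidth K u k) (ρ m k) (4 ^ (K + 1) * E)
      (ε / 2 ^ (K + 1)) :=
  (R.regular (by linarith [R.one_le]) hm hm' k).mono
    (le_mul_of_one_le_left (by linarith [R.one_le]) (one_le_pow₀ (by norm_num)))
    (div_le_self R.pos.le (one_le_pow₀ (by norm_num)))

theorem regD (R : Fine A H u K ρ E ε) {m : ℕ} (hm : H ≤ m) (hm' : m < 2 * H) (k : ℕ) :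
    Regular (multipliers A) (m * cellWidth K u k) (cellWidth K u k) (multDens (ρ m) K k)
      (4 ^ (K + 1) * E) (ε / 2 ^ (K + 1)) :=
  R.regular_multipliers R.prop R.H_pos R.u_pos R.one_le R.pos
    (by linarith [R.le_u, R.one_le_mul]) hm hm' k

/-- Levels j to j + 3 of one place. The unit q is the width at level j + 6, and this is why
`cellWidth` starts from 2^(K + 6) u. -/
theorem place (R : Fine A H u K ρ E ε) {m : ℕ} (hm : H ≤ m) (hm' : m < 2 * H) {j : ℕ}
    (hj : j ≤ K) : Place A (multipliers A) (m * cellWidth K u (j + 3)) (cellWidth K u (j + 6))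
      (fun k => ρ m (j + k)) (fun k => multDens (ρ m) K (j + k)) (4 ^ (K + 1) * E)
      (ε / 2 ^ (K + 1)) := by
  have hw : ∀ k ≤ 3, 2 ^ (3 - k) * cellWidth K u (j + 3) = cellWidth K u (j + k) := by
    intro k hk
    rw [cellWidth, cellWidth, ← mul_assoc, ← pow_add]
    congr 2
    omega
  have hq : 8 * cellWidth K u (j + 6) = cellWidth K u (j + 3) := by
    rw [cellWidth, cellWidth, ← mul_assoc, show 8 = 2 ^ 3 by norm_num, ← pow_add]
    congr 2
    omega
  refine
    { regA := fun k hk => ?_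
      regD := fun k _ hk => ?_
      ρ_nonneg := fun k r => R.nonneg m _ r
      σ_nonneg := fun k r => multDens_nonneg (R.nonneg m) K _ r
      σ_eq := fun k r _ => ?_
      one_le := R.one_le_mul
      pos := div_pos R.pos (by positivity)
      le_one := R.div_pow_le_one
      le := R.big.trans (mul_le_mul_of_nonneg_left ?_ (div_pos R.pos (by positivity)).le)
      width := ?_
      rel := fun u hu v hv y hy h1 h2 m => R.prop.add_ne_mul_multiplier hu hv hy h1 h2 m }
  · rw [hq, Nat.mul_left_comm, hw k hk]
    exact R.regA hm hm' _
  · rw [hq, Nat.mul_left_comm, hw k hk]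
    exact R.regD hm hm' _
  · rcases le_or_gt (j + k) K with h | h
    · rw [multDens_of_le _ h]
      rfl
    · rw [multDens_of_lt _ h, R.zero m _ r h, ← add_assoc, multDens_of_lt _ (by omega)]
      simp
  · exact_mod_cast Nat.le_mul_of_pos_left u (by positivity)
  · rw [hq]
    exact Nat.le_mul_of_pos_left _ (R.H_pos.trans_le hm)

theorem localDensities (R : Fine A H u K ρ E ε) {m : ℕ} (hm : H ≤ m) (hm' : m < 2 * H) {j : ℕ}
    (hj : j ≤ K) : LocalDensities (1 / 10 ^ 11) (ρ m j) (fun k => ρ m (j + k))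
      (fun k => multDens (ρ m) K (j + k)) := (R.place hm hm' hj).localDensities

theorem sum_multDens (R : Fine A H u K ρ E ε) {m : ℕ} (hm : H ≤ m) (hm' : m < 2 * H) (k : ℕ)
    (hk : 1 ≤ k) : ∑ r, multDens (ρ m) K k r =
      ∑ r, ρ m k r + 1 / 2 * ∑ r, multDens (ρ m) K (k + 1) r := by
  have := (R.localDensities hm hm' (Nat.zero_le K)).sum_Y_eq hk
  simpa only [Nat.zero_add] using this

/-- Induction from the deepest level. The density of multipliers at level k is half of 2f + η for
the place shifted to level k, and the local bound there needs this statement only at levels k + 1 to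
k + 3. -/
theorem sum_multDens_le (R : Fine A H u K ρ E ε) {m : ℕ} (hm : H ≤ m) (hm' : m < 2 * H) {k : ℕ}
    (hk : 1 ≤ k) (hne : ∃ y, multDens (ρ m) K (k + 1) y ≠ 0) :
    ∑ r, multDens (ρ m) K k r ≤ 2 / 3 + 3 / 10 ^ 8 := by
  have key : ∀ n k, 1 ≤ k → K + 1 ≤ k + n → (∃ y, multDens (ρ m) K (k + 1) y ≠ 0) →
      ∑ r, multDens (ρ m) K k r ≤ 2 / 3 + 3 / 10 ^ 8 := by
    intro n
    induction n with
    | zero =>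
      rintro k - hk ⟨y, hy⟩
      rw [multDens_of_lt _ (by omega)] at hy
      exact absurd rfl hy
    | succ n ih =>
      intro k hk hkn hne
      have hkK : k ≤ K := by
        by_contra hc
        obtain ⟨y, hy⟩ := hne
        rw [multDens_of_lt _ (by omega)] at hy
        exact hy rfl
      have d := R.localDensities hm hm' hkK
      have := (d.two_mul_sum_X_add_sum_Y_le (by norm_num) le_rfl hne
        (ih (k + 1) (by omega) (by omega)) (ih (k + 2) (by omega) (by omega))
        (ih (k + 3) (by omega) (by omega))).1
      rw [R.sum_multDens hm hm' k hk]
      linarith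
  exact key (K + 1) k hk (by omega) hne

/-- The density of the upper half at a place. -/
noncomputable def upperDens (ρ : ℕ → ℕ → ZMod 24 → ℝ) (m : ℕ) : ℝ := ∑ r, ρ m 0 r

/-- The density of the multipliers at a place. -/
noncomputable def lowerDens (ρ : ℕ → ℕ → ZMod 24 → ℝ) (K m : ℕ) : ℝ := ∑ r, multDens (ρ m) K 1 r

/-- The weights are the widths of the levels relative to level 1, so the width at level 1 times this
density counts all of A below the top at this place, up to the error of regularity. -/
theorem lowerDens_eq (R : Fine A H u K ρ E ε) {m : ℕ} (hm : H ≤ m) (hm' : m < 2 * H) :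
    lowerDens ρ K m = ∑ k ∈ Finset.Icc 1 K, (∑ r, ρ m k r) / 2 ^ (k - 1) := by
  have key : ∀ n ≤ K, lowerDens ρ K m = ∑ k ∈ Finset.Icc 1 n, (∑ r, ρ m k r) / 2 ^ (k - 1) +
      (∑ r, multDens (ρ m) K (n + 1) r) / 2 ^ n := by
    intro n
    induction n with
    | zero => intro _; simp [lowerDens]
    | succ n ih =>
      intro hn
      rw [ih (by omega), Finset.sum_Icc_succ_top (by omega), R.sum_multDens hm hm' (n + 1) (by omega),
        Nat.add_sub_cancel, pow_succ]
      ring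
  rw [key K le_rfl, multDens_of_lt _ (Nat.lt_succ_self K)]
  simp

section local_bounds
variable {m : ℕ}

theorem lowerDens_ne_zero_iff (R : Fine A H u K ρ E ε) :
    lowerDens ρ K m ≠ 0 ↔ ∃ y, multDens (ρ m) K 1 y ≠ 0 := by
  rw [lowerDens, Ne, Finset.sum_eq_zero_iff_of_nonneg fun r _ => multDens_nonneg (R.nonneg m) K 1 r]
  simp

theorem two_mul_upperDens_add_le (R : Fine A H u K ρ E ε) (hm : H ≤ m) (hm' : m < 2 * H)
    (h : lowerDens ρ K m ≠ 0) :
    2 * upperDens ρ m + lowerDens ρ K m ≤ 4 / 3 + 5 / 10 ^ 8 ∧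
      ((∃ y, multDens (ρ m) K 2 y ≠ 0) ∨ lowerDens ρ K m ≤ 7 / 12 →
        2 * upperDens ρ m + lowerDens ρ K m ≤ 4 / 3 - 1 / 3900) := by
  have d := R.localDensities hm hm' (Nat.zero_le K)
  simp only [Nat.zero_add] at d
  exact d.two_mul_sum_X_add_sum_Y_le (by norm_num) le_rfl (R.lowerDens_ne_zero_iff.1 h)
    (R.sum_multDens_le hm hm' le_rfl) (R.sum_multDens_le hm hm' (by norm_num))
    (R.sum_multDens_le hm hm' (by norm_num))

/-- With a second level, η ≤ 2/3 and 2f + η ≤ 4/3 average to the claim; without one, reflection in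
3y gives it. -/
theorem upperDens_add_le (R : Fine A H u K ρ E ε) (hm : H ≤ m) (hm' : m < 2 * H)
    (h : lowerDens ρ K m ≠ 0) : upperDens ρ m + lowerDens ρ K m ≤ 1 + 1 / 10 ^ 7 := by
  by_cases h2 : ∃ y, multDens (ρ m) K 2 y ≠ 0
  · have h3 := (R.two_mul_upperDens_add_le hm hm' h).1
    have h4 : lowerDens ρ K m ≤ 2 / 3 + 3 / 10 ^ 8 := R.sum_multDens_le hm hm' le_rfl h2
    linarith
  · have d := R.localDensities hm hm' (Nat.zero_le K)
    simp only [Nat.zero_add] at d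
    obtain ⟨y, hy⟩ := R.lowerDens_ne_zero_iff.1 h
    have := d.sum_X_add_sum_Y_le hy h2
    rw [upperDens, lowerDens]
    linarith

end local_bounds

end Regularized.Fine

/-! ### From densities to the discretised cell data -/

/-- The part of cell m carried into cell c by the factor k has length W/k. As k ≤ 7, a window of
length W/16 suitably placed in it keeps ky in the middle half of cell c. -/
theorem exists_mul_mem_middle {D : Set ℕ} {σ : ZMod 24 → ℝ} {c m k W : ℕ} {E ε : ℝ}
    (hD : Regular D (m * W) W σ E ε) (hσ : ∃ y, σ y ≠ 0) (hk1 : k * m ≤ c) (hk2 : c < k * m + k)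
    (hk7 : k ≤ 7) (hE : 1 ≤ E) (hε : ε ≤ 1) (hbig : 10 ^ 24 * E ≤ ε * W) :
    ∃ y ∈ D, (m * W ≤ y ∧ y < (m + 1) * W) ∧ c * W + W / 4 ≤ k * y ∧
      k * y + 1 ≤ c * W + W - W / 4 := by
  obtain ⟨y, hy⟩ := hσ
  have hW0 := Nat.cast_nonneg (α := ℝ) W
  have hW1 : (10 : ℝ) ^ 24 ≤ W := by nlinarith
  have hW2 : 1000 ≤ W := by
    have : ((1000 : ℕ) : ℝ) ≤ W := le_trans (by norm_num) hW1
    exact_mod_cast this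
  have e1 := Nat.mul_le_mul_right W hk1
  have e2 := Nat.mul_le_mul_right W (show c + 1 ≤ k * m + k from hk2)
  rw [mul_assoc] at e1
  rw [add_mul, add_mul, one_mul, mul_assoc] at e2
  rw [add_mul, one_mul]
  have hk0 : 0 < k := by omega
  have hq : (W : ℝ) / 32 ≤ ((W / 16 : ℕ) : ℝ) := by
    have : W ≤ 32 * (W / 16) := by omega
    have : (W : ℝ) ≤ 32 * ((W / 16 : ℕ) : ℝ) := by exact_mod_cast this
    linarith
  set a := (c * W + W / 4) / k + 1 with ha
  have h1 : c * W + W / 4 ≤ k * a ∧ k * a ≤ c * W + W / 4 + k := by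
    have h2 := Nat.div_add_mod (c * W + W / 4) k
    have h3 := Nat.mod_lt (c * W + W / 4) hk0
    have h4 : k * a = k * ((c * W + W / 4) / k) + k := by rw [ha, mul_add, mul_one]
    omega
  have hwin : m * W ≤ a ∧ a + W / 16 ≤ m * W + W ∧ k * (W / 16) ≤ 7 * (W / 16) ∧ k ≤ 7 := by
    refine ⟨?_, ?_, Nat.mul_le_mul_right _ hk7, hk7⟩
    · refine le_of_mul_le_mul_left ?_ hk0
      omega
    · refine le_of_mul_le_mul_left ?_ hk0
      rw [mul_add k a, mul_add k (m * W) W]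
      have := Nat.mul_le_mul_right (W / 16) hk7
      omega
  obtain ⟨s, hs, -, hs1, hs2⟩ := hD.exists_mem hy (a := a) (b := a + W / 16) hwin.1 (by omega)
    hwin.2.1 (by
      push_cast
      have h5 : 0 ≤ ε := by nlinarith
      have := mul_le_mul_of_nonneg_left hq h5
      nlinarith)
  have l1 := Nat.mul_le_mul_left k hs1
  have l2 := Nat.mul_le_mul_left k hs2.le
  rw [mul_add] at l2
  exact ⟨s, hs, ⟨by omega, by omega⟩, by omega, by omega⟩

/-- The densities of two cells add up to at most one, if a multiple of a multiplier cell meets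
their sum. -/
theorem Regular.cells_add_le {A D : Set ℕ} {ρ ρ' σ : ZMod 24 → ℝ} {a b c m k W : ℕ} {E ε : ℝ}
    (hA : Regular A (a * W) W ρ E ε) (hB : Regular A (b * W) W ρ' E ε)
    (hD : Regular D (m * W) W σ E ε) (hσ : ∃ y, σ y ≠ 0) (hk1 : k * m ≤ c) (hk2 : c < k * m + k)
    (hk7 : k ≤ 7) (hc : c = a + b ∨ c = a + b + 1) (hE : 1 ≤ E) (hε : ε ≤ 1)
    (hbig : 10 ^ 24 * E ≤ ε * W)
    (hrel : ∀ x ∈ A, ∀ v ∈ A, ∀ y ∈ D, a * W ≤ x → x < (a + 1) * W → y < (m + 1) * W →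
      x + v = k * y → v < (b + 1) * W → b * W ≤ v → False) :
    ∑ r, ρ r + ∑ r, ρ' r ≤ 1 + 1 / 10 ^ 7 := by
  obtain ⟨y, hy, ⟨-, hy2⟩, hy3, hy4⟩ := exists_mul_mem_middle hD hσ hk1 hk2 hk7 hE hε hbig
  have hW0 := Nat.cast_nonneg (α := ℝ) W
  have hW1 : 10 ^ 24 * E ≤ W := by nlinarith
  have hW2 : 1000 ≤ W := by
    have : ((1000 : ℕ) : ℝ) ≤ W := le_trans (by norm_num) ((by nlinarith : (10 : ℝ) ^ 24 ≤ W))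
    exact_mod_cast this
  have hq : (W : ℝ) / 8 ≤ ((W / 4 : ℕ) : ℝ) := by
    have : W ≤ 8 * (W / 4) := by omega
    have : (W : ℝ) ≤ 8 * ((W / 4 : ℕ) : ℝ) := by exact_mod_cast this
    linarith
  have hl : 0 < W / 4 := by omega
  -- If ky lies in cell a + b, the first quarter of cell a reflects into cell b; if in cell a + b +
  -- 1, the last quarter does.
  obtain ⟨x₀, hx1, hx2, hx3, hx4⟩ : ∃ x₀, a * W ≤ x₀ ∧ x₀ + W / 4 ≤ a * W + W ∧
      b * W + (x₀ + W / 4) ≤ k * y + 1 ∧ k * y + 1 ≤ b * W + W + x₀ := by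
    rcases hc with rfl | rfl
    · rw [add_mul] at hy3 hy4
      exact ⟨a * W, le_rfl, by omega, by omega, by omega⟩
    · rw [add_mul, add_mul, one_mul] at hy3 hy4
      exact ⟨a * W + W - W / 4, by omega, by omega, by omega, by omega⟩
  have hle := hA.add_le hB hl hx1 hx2 hx3 hx4 (fun x hx v hv h1 h2 he => by
    refine hrel x hx v hv y hy (by omega) ?_ hy2 he ?_ (by omega)
    · rw [add_mul, one_mul]; omega
    · rw [add_mul, one_mul]; omega)
  have hsum : ∑ r, ρ' r = ∑ r, ρ' (((k * y : ℕ) : ZMod 24) - r) :=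
    (Equiv.sum_comp (Equiv.subLeft ((k * y : ℕ) : ZMod 24)) ρ').symm
  rw [hsum, ← Finset.sum_add_distrib]
  refine (Finset.sum_le_card_nsmul _ _ _ fun r _ => hle r).trans ?_
  rw [Finset.card_univ, ZMod.card, nsmul_eq_mul]
  have h3 : (1 + 2 * E) / ((W / 4 : ℕ) : ℝ) ≤ 1 / 10 ^ 9 := by
    rw [div_le_iff₀ (by exact_mod_cast hl)]
    nlinarith
  push_cast
  linarith

theorem Regular.sub {S : Set ℕ} {p L p' L' : ℕ} {ρ : ZMod 24 → ℝ} {E ε : ℝ}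
    (h : Regular S p L ρ E ε) (h1 : p ≤ p') (h2 : p' + L' ≤ p + L) : Regular S p' L' ρ E ε :=
  ⟨fun r a b ha hab hb => h.count r a b (by omega) hab (by omega), h.dich,
    fun r s h0 hs hs1 hs2 => h.empty r s h0 hs (by omega) (by omega)⟩

/-- The integer part of a density in units of about `1 / (6t)`. -/
noncomputable def scaled (t : ℕ) (x : ℝ) : ℤ := ⌊6 * t / (1 + 2 / 10 ^ 7) * x⌋

theorem scaled_nonneg (t : ℕ) {x : ℝ} (hx : 0 ≤ x) : 0 ≤ scaled t x :=
  Int.floor_nonneg.2 (by positivity)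

/-- The divisor 1 + 2/10⁷ absorbs the errors of the density inequalities, so that the integer
inequalities of `CellData` hold without error terms. -/
theorem le_of_scaled {t : ℕ} {x y c : ℝ} {a b : ℤ} {p q : ℤ} (hp : 0 ≤ p)
    (hq : 0 ≤ q) (ha : a = scaled t x) (hb : b = scaled t y) (h : p * x + q * y ≤ c) :
    ((p * a + q * b : ℤ) : ℝ) ≤ 6 * t / (1 + 2 / 10 ^ 7) * c := by
  have h1 : (a : ℝ) ≤ 6 * t / (1 + 2 / 10 ^ 7) * x := ha ▸ Int.floor_le _
  have h2 : (b : ℝ) ≤ 6 * t / (1 + 2 / 10 ^ 7) * y := hb ▸ Int.floor_le _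
  have hp' : (0 : ℝ) ≤ p := by exact_mod_cast hp
  have hq' : (0 : ℝ) ≤ q := by exact_mod_cast hq
  push_cast
  have h3 := mul_le_mul_of_nonneg_left h1 hp'
  have h4 := mul_le_mul_of_nonneg_left h2 hq'
  have h5 := mul_le_mul_of_nonneg_left h (show (0 : ℝ) ≤ 6 * t / (1 + 2 / 10 ^ 7) by positivity)
  linarith

namespace Regularized.Fine
variable {A : Set ℕ} {h H u K : ℕ} {ρ : ℕ → ℕ → ZMod 24 → ℝ} {E ε : ℝ}

theorem big_cell (R : Fine A H u K ρ E ε) (k : ℕ) :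
    10 ^ 24 * (4 ^ (K + 1) * E) ≤ ε / 2 ^ (K + 1) * cellWidth K u k :=
  R.big.trans (mul_le_mul_of_nonneg_left (by
    exact_mod_cast Nat.le_mul_of_pos_left u (by positivity)) (div_pos R.pos (by positivity)).le)

theorem upperDens_nonneg (R : Fine A H u K ρ E ε) (m : ℕ) : 0 ≤ upperDens ρ m :=
  Finset.sum_nonneg fun r _ => R.nonneg m 0 r

theorem upperDens_le (R : Fine A H u K ρ E ε) {m : ℕ} (hm : H ≤ m) (hm' : m < 2 * H) :
    upperDens ρ m ≤ 1 + 1 / 10 ^ 7 := by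
  have h1 := R.regA hm hm' 0
  have hw : (0 : ℝ) < cellWidth K u 0 := by exact_mod_cast cellWidth_pos R.u_pos
  have h2 : (1 + 4 ^ (K + 1) * E) / (cellWidth K u 0 : ℝ) ≤ 1 / 10 ^ 9 := by
    rw [div_le_iff₀ hw]
    have h3 := R.big_cell 0
    have h4 := mul_le_of_le_one_left hw.le R.div_pow_le_one
    linarith [R.one_le_mul]
  refine (Finset.sum_le_card_nsmul _ _ _ fun r _ =>
    (h1.le_inv (cellWidth_pos R.u_pos) r).trans (add_le_add_right h2 _)).trans ?_
  rw [Finset.card_univ, ZMod.card, nsmul_eq_mul]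
  norm_num

/-- The two halves of a cell are regular. -/
theorem regX (R : Fine A H u K ρ E ε) {a : ℕ} (ha : 2 * H ≤ a) (ha' : a < 4 * H) :
    Regular A (a * cellWidth K u 1) (cellWidth K u 1) (ρ (a / 2) 0) (4 ^ (K + 1) * E)
      (ε / 2 ^ (K + 1)) := by
  refine (R.regA (m := a / 2) (by omega) (by omega) 0).sub ?_ ?_
  · rw [cellWidth_eq_two_mul (u := u) (show 0 < K + 6 by omega), ← mul_assoc]
    exact Nat.mul_le_mul_right _ (by omega)
  · rw [cellWidth_eq_two_mul (u := u) (show 0 < K + 6 by omega)]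
    calc a * cellWidth K u (0 + 1) + cellWidth K u (0 + 1) = (a + 1) * cellWidth K u (0 + 1) := by
          ring
      _ ≤ (2 * (a / 2) + 2) * cellWidth K u (0 + 1) := Nat.mul_le_mul_right _ (by omega)
      _ = _ := by ring

open Classical in
/-- The places with multipliers. -/
noncomputable def multPlaces (ρ : ℕ → ℕ → ZMod 24 → ℝ) (H K : ℕ) : Finset ℕ :=
  (Finset.Ico H (2 * H)).filter fun m => lowerDens ρ K m ≠ 0

theorem mem_multPlaces {m : ℕ} :
    m ∈ multPlaces ρ H K ↔ (H ≤ m ∧ m < 2 * H) ∧ lowerDens ρ K m ≠ 0 := by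
  classical
  rw [multPlaces, Finset.mem_filter, Finset.mem_Ico]

open Classical in
/-- The places with many multipliers, all of the first level. -/
noncomputable def densePlaces (ρ : ℕ → ℕ → ZMod 24 → ℝ) (H K : ℕ) : Finset ℕ :=
  (multPlaces ρ H K).filter fun m =>
    (¬ ∃ y, multDens (ρ m) K 2 y ≠ 0) ∧ 7 / 12 < lowerDens ρ K m

theorem mem_densePlaces {m : ℕ} : m ∈ densePlaces ρ H K ↔ m ∈ multPlaces ρ H K ∧
    (¬ ∃ y, multDens (ρ m) K 2 y ≠ 0) ∧ 7 / 12 < lowerDens ρ K m := by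
  classical
  rw [densePlaces, Finset.mem_filter]

/-- The discretised density of the upper half. -/
noncomputable def height (ρ : ℕ → ℕ → ZMod 24 → ℝ) (H t m : ℕ) : ℤ :=
  if H ≤ m ∧ m < 2 * H then scaled t (upperDens ρ m) else 0

theorem height_of_mem {t m : ℕ} (hm : H ≤ m) (hm' : m < 2 * H) :
    height ρ H t m = scaled t (upperDens ρ m) := if_pos ⟨hm, hm'⟩

/-- Top cells are halved to have the width of the multiplier cells of level 1, whence the index a /
2. -/
theorem upperDens_add_upperDens_le (R : Fine A H u K ρ E ε) {a b : ℕ} (ha : 2 * H ≤ a)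
    (ha' : a < 4 * H) (hb : 2 * H ≤ b) (hb' : b < 4 * H)
    (hc : a + b ∈ multCells H (multPlaces ρ H K) ∨ a + b + 1 ∈ multCells H (multPlaces ρ H K)) :
    upperDens ρ (a / 2) + upperDens ρ (b / 2) ≤ 1 + 1 / 10 ^ 7 := by
  obtain ⟨c, hc, hcm⟩ : ∃ c, (c = a + b ∨ c = a + b + 1) ∧ c ∈ multCells H (multPlaces ρ H K) := by
    rcases hc with hc | hc
    · exact ⟨_, Or.inl rfl, hc⟩
    · exact ⟨_, Or.inr rfl, hc⟩
  obtain ⟨hc8, m, hm, k, hk1, hk2⟩ := mem_multCells.1 hcm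
  obtain ⟨⟨hm1, hm2⟩, hm3⟩ := mem_multPlaces.1 hm
  have hk7 : k ≤ 7 := by
    by_contra hk
    push Not at hk
    have : 8 * H ≤ k * m := Nat.mul_le_mul hk hm1
    omega
  refine (R.regX ha ha').cells_add_le (R.regX hb hb') (R.regD hm1 hm2 1)
    (R.lowerDens_ne_zero_iff.1 hm3) hk1 hk2 hk7 hc R.one_le_mul R.div_pow_le_one (R.big_cell 1) ?_
  intro x hx v hv y hy h1 _ h3 h4 _ h6
  have e1 : (m + 1) * cellWidth K u 1 ≤ 2 * H * cellWidth K u 1 := Nat.mul_le_mul_right _ hm2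
  have e2 : 2 * H * cellWidth K u 1 ≤ a * cellWidth K u 1 := Nat.mul_le_mul_right _ ha
  have e3 : 2 * H * cellWidth K u 1 ≤ b * cellWidth K u 1 := Nat.mul_le_mul_right _ hb
  exact R.prop.add_ne_mul_multiplier hx hv hy (by omega) (by omega) k h4

/-- At a dense place the multipliers of level 1 all belong to A, which therefore has density above
7/12 there. A triple of a multiplier meeting the doubled cell would limit twice this density to
about 1. -/
theorem densePlaces_avoid (R : Fine A H u K ρ E ε) {m₁ m j : ℕ} (hm₁ : m₁ ∈ densePlaces ρ H K)
    (hm : m ∈ multPlaces ρ H K) (hj : j = 0 ∨ j = 1) :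
    2 * m₁ + j < 3 * m ∨ 3 * m + 3 ≤ 2 * m₁ + j := by
  by_contra hcon
  push Not at hcon
  obtain ⟨hm₁', hno, hdens⟩ := mem_densePlaces.1 hm₁
  obtain ⟨⟨a1, a2⟩, a3⟩ := mem_multPlaces.1 hm₁'
  obtain ⟨⟨b1, b2⟩, b3⟩ := mem_multPlaces.1 hm
  have hH := R.H_pos
  have h1 := (R.regA a1 a2 1).cells_add_le (R.regA a1 a2 1) (R.regD b1 b2 1)
    (R.lowerDens_ne_zero_iff.1 b3) (k := 3) (c := 2 * m₁ + j) hcon.1 hcon.2 (by norm_num)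
    (by omega) R.one_le_mul R.div_pow_le_one (R.big_cell 1) (by
      intro x hx v hv y hy h1 h2 h3 h4 h5 h6
      have e1 : 1 * cellWidth K u 1 ≤ m₁ * cellWidth K u 1 := Nat.mul_le_mul_right _ (by omega)
      rw [add_mul] at h2 h5
      exact R.prop.add_ne_mul_multiplier hx hv hy (by omega) (by omega) 3 h4)
  have h2 : lowerDens ρ K m₁ = ∑ r, ρ m₁ 1 r := by
    rw [lowerDens, R.sum_multDens a1 a2 1 le_rfl, Finset.sum_eq_zero (f := multDens (ρ m₁) K (1 + 1))]
    · simp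
    · intro y _
      by_contra hy
      exact hno ⟨y, hy⟩
  linarith

/-- Density 1 corresponds to 6t, so 4/3 is 8t and 2/3 is 4t, while 4/3 − 1/3900 is below
15997t/2000. -/
theorem cellData (R : Fine A (30 * h) u K ρ E ε) (t : ℕ) :
    CellData h t (multPlaces ρ (30 * h) K) (densePlaces ρ (30 * h) K) (height ρ (30 * h) t)
      fun m => scaled t (lowerDens ρ K m) := by
  have ht : (0 : ℝ) ≤ t := Nat.cast_nonneg t
  refine
    { subset := fun m hm => Finset.mem_Ico.2 (mem_multPlaces.1 hm).1
      sub := fun m hm => (mem_densePlaces.1 hm).1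
      nonneg := fun m => ?_
      le := fun m => ?_
      add_le := fun a ha b hb hc => ?_
      add_mult_le := fun m hm => ?_
      two_mul_add_le := fun m hm => ?_
      gain := fun m hm hmW => ?_
      le_of_not_mem := fun m hm hmW => ?_
      avoids := fun m₁ hm₁ m hm => ⟨by simpa using R.densePlaces_avoid hm₁ hm (Or.inl rfl),
        R.densePlaces_avoid hm₁ hm (Or.inr rfl)⟩ }
  · unfold height
    split_ifs
    · exact scaled_nonneg t (R.upperDens_nonneg m)
    · exact le_rfl
  · unfold height
    split_ifs with hm
    · have := le_of_scaled (t := t) (p := 1) (q := 0) (by norm_num) le_rfl rfl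
        (rfl : scaled t 0 = _) (by simpa using R.upperDens_le hm.1 hm.2)
      have h2 : (scaled t (upperDens ρ m) : ℝ) ≤ 6 * t := by
        push_cast at this
        rw [div_mul_eq_mul_div, le_div_iff₀ (by norm_num)] at this
        linarith
      exact_mod_cast h2
    · positivity
  · rw [Finset.mem_Ico] at ha hb
    rw [height_of_mem (by omega) (by omega), height_of_mem (by omega) (by omega)]
    have h1 := R.upperDens_add_upperDens_le ha.1 ha.2 hb.1 hb.2 hc
    have := le_of_scaled (t := t) (p := 1) (q := 1) (by norm_num) (by norm_num) rfl rfl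
      (by simpa using h1)
    have h2 : (scaled t (upperDens ρ (a / 2)) : ℝ) + scaled t (upperDens ρ (b / 2)) ≤ 6 * t := by
      push_cast at this
      rw [div_mul_eq_mul_div, le_div_iff₀ (by norm_num)] at this
      linarith
    exact_mod_cast h2
  · obtain ⟨⟨h1, h2⟩, h3⟩ := mem_multPlaces.1 hm
    rw [height_of_mem h1 h2]
    have := le_of_scaled (t := t) (p := 1) (q := 1) (by norm_num) (by norm_num) rfl rfl
      (by simpa using R.upperDens_add_le h1 h2 h3)
    have h2 : (scaled t (upperDens ρ m) : ℝ) + scaled t (lowerDens ρ K m) ≤ 6 * t := by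
      push_cast at this
      rw [div_mul_eq_mul_div, le_div_iff₀ (by norm_num)] at this
      linarith
    exact_mod_cast h2
  · obtain ⟨⟨h1, h2⟩, h3⟩ := mem_multPlaces.1 hm
    rw [height_of_mem h1 h2]
    have := le_of_scaled (t := t) (p := 2) (q := 1) (by norm_num) (by norm_num) rfl rfl
      (by simpa using (R.two_mul_upperDens_add_le h1 h2 h3).1)
    have h2 : 2 * (scaled t (upperDens ρ m) : ℝ) + scaled t (lowerDens ρ K m) ≤ 8 * t := by
      push_cast at this
      rw [div_mul_eq_mul_div, le_div_iff₀ (by norm_num)] at this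
      linarith
    exact_mod_cast h2
  · obtain ⟨⟨h1, h2⟩, h3⟩ := mem_multPlaces.1 hm
    rw [height_of_mem h1 h2]
    have h4 : (∃ y, multDens (ρ m) K 2 y ≠ 0) ∨ lowerDens ρ K m ≤ 7 / 12 := by
      by_contra hc
      push Not at hc
      exact hmW (mem_densePlaces.2 ⟨hm, by push Not; exact hc.1, hc.2⟩)
    have := le_of_scaled (t := t) (p := 2) (q := 1) (by norm_num) (by norm_num) rfl rfl
      (by simpa using (R.two_mul_upperDens_add_le h1 h2 h3).2 h4)
    have h2 : 2000 * (2 * (scaled t (upperDens ρ m) : ℝ) + scaled t (lowerDens ρ K m)) ≤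
        15997 * t := by
      push_cast at this
      rw [div_mul_eq_mul_div, le_div_iff₀ (by norm_num)] at this
      linarith
    exact_mod_cast h2
  · obtain ⟨⟨h1, h2⟩, h3⟩ := mem_multPlaces.1 hm
    have h5 : lowerDens ρ K m ≤ 2 / 3 + 3 / 10 ^ 8 := by
      by_cases h4 : ∃ y, multDens (ρ m) K 2 y ≠ 0
      · exact R.sum_multDens_le h1 h2 le_rfl h4
      · by_contra hc
        push Not at hc
        exact hmW (mem_densePlaces.2 ⟨hm, h4, by linarith⟩)
    have := le_of_scaled (t := t) (p := 1) (q := 0) (by norm_num) le_rfl rfl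
        (rfl : scaled t 0 = _) (by simpa using h5)
    have h2 : (scaled t (lowerDens ρ K m) : ℝ) ≤ 4 * t := by
      push_cast at this
      rw [div_mul_eq_mul_div, le_div_iff₀ (by norm_num)] at this
      linarith
    exact_mod_cast h2

end Regularized.Fine

/-! ### Counting the elements, and the conclusion -/

theorem Regular.cnt_cell_le {S : Set ℕ} {p L : ℕ} {ρ : ZMod 24 → ℝ} {E ε : ℝ}
    (h : Regular S p L ρ E ε) : (cnt S p (p + L) : ℝ) ≤ (∑ r, ρ r) * L + 24 * E := by
  have h1 := h.cnt_inClasses_le Finset.univ le_rfl (Nat.le_add_right p L) le_rfl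
  rw [Finset.card_univ, ZMod.card] at h1
  have h2 : inClasses S Finset.univ = S := Set.ext fun x => by simp [inClasses]
  rw [h2] at h1
  push_cast at h1
  linarith

namespace Regularized.Fine
variable {A : Finset ℕ} {h H u K : ℕ} {ρ : ℕ → ℕ → ZMod 24 → ℝ} {E ε : ℝ}

open Classical in
theorem card_cell_le (R : Fine A H u K ρ E ε) {m : ℕ} (hm : m ∈ Finset.Ico H (2 * H)) (k : ℕ) :
    ((A.filter fun a => InCell H u K k m a).card : ℝ) ≤
      (∑ r, ρ m k r) * cellWidth K u k + 24 * (4 ^ (K + 1) * E) := by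
  classical
  rw [Finset.mem_Ico] at hm
  refine le_trans ?_ (R.regA hm.1 hm.2 k).cnt_cell_le
  refine Nat.cast_le.2 (Finset.card_le_card fun a ha => ?_)
  obtain ⟨h1, h2⟩ := Finset.mem_filter.1 ha
  refine mem_elts.2 ⟨⟨h2.le, ?_⟩, h1⟩
  have := h2.lt_succ
  rwa [add_mul, one_mul] at this

theorem level_eq_zero_iff {k m a : ℕ} (hk : k ≤ K) (hc : InCell H u K k m a) :
    k = 0 ↔ H * cellWidth K u 0 ≤ a := by
  constructor
  · rintro rfl
    exact (Nat.mul_le_mul_right _ hc.ge).trans hc.le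
  · intro ha
    by_contra h0
    have h1 := cellWidth_eq_two_mul (u := u) (show 0 < K + 6 by omega)
    have h2 : (m + 1) * cellWidth K u k ≤ 2 * H * cellWidth K u (0 + 1) :=
      Nat.mul_le_mul hc.lt (cellWidth_le (by omega))
    have h3 : 2 * H * cellWidth K u (0 + 1) = H * cellWidth K u 0 := by rw [h1]; ring
    have := hc.lt_succ
    omega

theorem card_upper_le (R : Fine A H u K ρ E ε) :
    ((A.filter fun a => H * cellWidth K u 0 ≤ a).card : ℝ) ≤
      cellWidth K u 0 * ∑ m ∈ Finset.Ico H (2 * H), upperDens ρ m +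
        H * (24 * (4 ^ (K + 1) * E)) := by
  classical
  have h1 : (A.filter fun a => H * cellWidth K u 0 ≤ a) ⊆
      (Finset.Ico H (2 * H)).biUnion fun m => A.filter fun a => InCell H u K 0 m a := by
    intro a ha
    obtain ⟨ha1, ha2⟩ := Finset.mem_filter.1 ha
    obtain ⟨k, hk, m, hm⟩ := R.cover a ha1
    obtain rfl := (level_eq_zero_iff hk hm).2 ha2
    exact Finset.mem_biUnion.2 ⟨m, Finset.mem_Ico.2 ⟨hm.ge, hm.lt⟩, Finset.mem_filter.2 ⟨ha1, hm⟩⟩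
  have h2 : ((A.filter fun a => H * cellWidth K u 0 ≤ a).card : ℝ) ≤
      ∑ m ∈ Finset.Ico H (2 * H), ((A.filter fun a => InCell H u K 0 m a).card : ℝ) := by
    exact_mod_cast (Finset.card_le_card h1).trans Finset.card_biUnion_le
  refine h2.trans ((Finset.sum_le_sum fun m hm => R.card_cell_le hm 0).trans (le_of_eq ?_))
  rw [Finset.sum_add_distrib, ← Finset.sum_mul, Finset.sum_const, Nat.card_Ico,
    show 2 * H - H = H by omega, nsmul_eq_mul, mul_comm (∑ m ∈ _, _)]
  rfl

theorem card_lower_le (R : Fine A H u K ρ E ε) :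
    ((A.filter fun a => ¬ H * cellWidth K u 0 ≤ a).card : ℝ) ≤
      cellWidth K u 0 / 2 * ∑ m ∈ Finset.Ico H (2 * H), lowerDens ρ K m +
        H * (K * (24 * (4 ^ (K + 1) * E))) := by
  classical
  have h1 : (A.filter fun a => ¬ H * cellWidth K u 0 ≤ a) ⊆
      (Finset.Ico H (2 * H)).biUnion fun m => (Finset.Icc 1 K).biUnion fun k =>
        A.filter fun a => InCell H u K k m a := by
    intro a ha
    obtain ⟨ha1, ha2⟩ := Finset.mem_filter.1 ha
    obtain ⟨k, hk, m, hm⟩ := R.cover a ha1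
    have := mt (level_eq_zero_iff hk hm).1 ha2
    exact Finset.mem_biUnion.2 ⟨m, Finset.mem_Ico.2 ⟨hm.ge, hm.lt⟩, Finset.mem_biUnion.2
      ⟨k, Finset.mem_Icc.2 ⟨by omega, hk⟩, Finset.mem_filter.2 ⟨ha1, hm⟩⟩⟩
  have h2 : ((A.filter fun a => ¬ H * cellWidth K u 0 ≤ a).card : ℝ) ≤
      ∑ m ∈ Finset.Ico H (2 * H), ∑ k ∈ Finset.Icc 1 K,
        ((A.filter fun a => InCell H u K k m a).card : ℝ) := by
    exact_mod_cast (Finset.card_le_card h1).trans (Finset.card_biUnion_le.trans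
      (Finset.sum_le_sum fun m _ => Finset.card_biUnion_le))
  have h3 : ∀ m ∈ Finset.Ico H (2 * H), ∑ k ∈ Finset.Icc 1 K,
      ((A.filter fun a => InCell H u K k m a).card : ℝ) ≤
      cellWidth K u 0 / 2 * lowerDens ρ K m + K * (24 * (4 ^ (K + 1) * E)) := by
    intro m hm
    refine (Finset.sum_le_sum fun k _ => R.card_cell_le hm k).trans (le_of_eq ?_)
    rw [Finset.mem_Ico] at hm
    rw [Finset.sum_add_distrib, Finset.sum_const, Nat.card_Icc, Nat.add_sub_cancel, nsmul_eq_mul,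
      R.lowerDens_eq hm.1 hm.2, Finset.mul_sum]
    congr 1
    refine Finset.sum_congr rfl fun k hk => ?_
    rw [Finset.mem_Icc] at hk
    rw [← two_pow_mul_cellWidth (u := u) (show k ≤ K + 6 by omega)]
    obtain ⟨j, rfl⟩ := Nat.exists_eq_add_of_le' hk.1
    rw [Nat.add_sub_cancel]
    push_cast
    rw [pow_succ]
    field_simp
  refine h2.trans ((Finset.sum_le_sum h3).trans (le_of_eq ?_))
  rw [Finset.sum_add_distrib, ← Finset.mul_sum, Finset.sum_const, Nat.card_Ico,
    show 2 * H - H = H by omega, nsmul_eq_mul]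

theorem error_le (R : Fine A H u K ρ E ε) :
    10 ^ 10 * ((K + 1) * (24 * (4 ^ (K + 1) * E))) ≤ (cellWidth K u 0 : ℝ) := by
  have h1 : ((cellWidth K u 0 : ℕ) : ℝ) = 2 ^ (K + 6) * u := by
    rw [cellWidth]; push_cast; rfl
  have h2 : (K + 1 : ℝ) ≤ 2 ^ (K + 6) := by
    have h3 : K + 6 < 2 ^ (K + 6) := Nat.lt_two_pow_self
    have h4 : K + 1 ≤ 2 ^ (K + 6) := by omega
    exact_mod_cast h4
  rw [h1]
  have h5 := mul_le_mul h2 R.le_u (by linarith [R.one_le_mul]) (by positivity)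
  have h6 : 0 ≤ (K + 1) * (4 ^ (K + 1) * E) :=
    mul_nonneg (by positivity) (by linarith [R.one_le_mul])
  linarith

theorem sum_lowerDens_eq : ∑ m ∈ Finset.Ico H (2 * H), lowerDens ρ K m =
    ∑ m ∈ multPlaces ρ H K, lowerDens ρ K m := by
  classical
  rw [multPlaces, Finset.sum_filter_ne_zero]

theorem le_scaled (t : ℕ) (x : ℝ) : 6 * t / (1 + 2 / 10 ^ 7) * x ≤ scaled t x + 1 :=
  (Int.lt_floor_add_one _).le

theorem two_mul_sum_add_sum_le (R : Fine A (30 * h) u K ρ E ε)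
    (hlow : 30 * h ≤ 50 * (multPlaces ρ (30 * h) K).card) :
    2 * ∑ m ∈ Finset.Ico (30 * h) (2 * (30 * h)), upperDens ρ m +
      ∑ m ∈ Finset.Ico (30 * h) (2 * (30 * h)), lowerDens ρ K m ≤
        (4 / 3 - 2 / 10 ^ 6) * (30 * h) := by
  have hh : 0 < h := by have := R.H_pos; omega
  -- Rounding costs 3 units per place, that is 5·10⁻⁸, and the rescaling about 3·10⁻⁷, against a
  -- gain of 2.5·10⁻⁶.
  set t : ℕ := 10 ^ 7 with ht
  have hex := (R.cellData t).excess_le hh hlow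
  rw [CellData.excess] at hex
  set c : ℝ := 6 * t / (1 + 2 / 10 ^ 7) with hc
  have h1 : c * ∑ m ∈ Finset.Ico (30 * h) (2 * (30 * h)), upperDens ρ m ≤
      ∑ m ∈ Finset.Ico (30 * h) (2 * (30 * h)), ((height ρ (30 * h) t m - 3 * t : ℤ) : ℝ) +
        (3 * t + 1) * (30 * h) := by
    rw [Finset.mul_sum]
    have : ((3 * t + 1) * (30 * h) : ℝ) =
        ∑ m ∈ Finset.Ico (30 * h) (2 * (30 * h)), (3 * (t : ℝ) + 1) := by
      rw [Finset.sum_const, Nat.card_Ico, show 2 * (30 * h) - 30 * h = 30 * h by omega,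
        nsmul_eq_mul]
      push_cast
      ring
    rw [this, ← Finset.sum_add_distrib]
    refine Finset.sum_le_sum fun m hm => ?_
    rw [Finset.mem_Ico] at hm
    rw [height_of_mem hm.1 hm.2]
    have : c * upperDens ρ m ≤ scaled t (upperDens ρ m) + 1 := le_scaled t _
    push_cast
    linarith
  have h2 : c * ∑ m ∈ Finset.Ico (30 * h) (2 * (30 * h)), lowerDens ρ K m ≤
      ∑ m ∈ multPlaces ρ (30 * h) K, (scaled t (lowerDens ρ K m) : ℝ) + 30 * h := by
    rw [sum_lowerDens_eq, Finset.mul_sum]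
    have h3 : ((multPlaces ρ (30 * h) K).card : ℝ) ≤ 30 * h := by
      have := Finset.card_le_card (R.cellData t).subset
      rw [Nat.card_Ico, show 2 * (30 * h) - 30 * h = 30 * h by omega] at this
      exact_mod_cast this
    have h4 : ∑ m ∈ multPlaces ρ (30 * h) K, c * lowerDens ρ K m ≤
        ∑ m ∈ multPlaces ρ (30 * h) K, ((scaled t (lowerDens ρ K m) : ℝ) + 1) :=
      Finset.sum_le_sum fun m _ => le_scaled t (lowerDens ρ K m)
    rw [Finset.sum_add_distrib, Finset.sum_const, nsmul_eq_mul, mul_one] at h4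
    linarith
  push_cast at hex h1
  generalize ∑ m ∈ Finset.Ico (30 * h) (2 * (30 * h)), ((height ρ (30 * h) t m : ℝ) - 3 * t) = F at *
  generalize ∑ m ∈ multPlaces ρ (30 * h) K, (scaled t (lowerDens ρ K m) : ℝ) = G at *
  generalize ∑ m ∈ Finset.Ico (30 * h) (2 * (30 * h)), upperDens ρ m = X at *
  generalize ∑ m ∈ Finset.Ico (30 * h) (2 * (30 * h)), lowerDens ρ K m = Y at *
  have hh' : (0 : ℝ) ≤ h := Nat.cast_nonneg h
  rw [ht] at hc hex h1
  push_cast at hc hex h1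
  rw [hc] at h1 h2
  norm_num at h1 h2 hex ⊢
  linarith

theorem card_le_of_many (R : Fine A (30 * h) u K ρ E ε)
    (hlow : 30 * h ≤ 50 * (multPlaces ρ (30 * h) K).card) :
    (A.card : ℝ) ≤ (2 / 3 - 9 / 10 ^ 7) * ((30 * h : ℕ) * cellWidth K u 0) := by
  have h1 := R.two_mul_sum_add_sum_le hlow
  have h2 := R.card_upper_le
  have h3 := R.card_lower_le
  have h4 := R.error_le
  have h5 : (A.card : ℝ) = (A.filter fun a => 30 * h * cellWidth K u 0 ≤ a).card +
      (A.filter fun a => ¬ 30 * h * cellWidth K u 0 ≤ a).card := by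
    exact_mod_cast (Finset.card_filter_add_card_filter_not _).symm
  have hw : (0 : ℝ) ≤ cellWidth K u 0 := Nat.cast_nonneg _
  have hh : (0 : ℝ) ≤ (30 * h : ℕ) := Nat.cast_nonneg _
  have h6 := mul_le_mul_of_nonneg_left h1 hw
  have h7 := mul_le_mul_of_nonneg_left h4 hh
  push_cast at *
  linarith

/-- Each place with multipliers accounts for about half a top cell at most, so H/50 of them give
1/100 of the upper range, up to errors. -/
theorem card_lower_le_of_few (R : Fine A H u K ρ E ε) (hlow : 50 * (multPlaces ρ H K).card ≤ H) :
    ((A.filter fun a => ¬ H * cellWidth K u 0 ≤ a).card : ℝ) ≤ 1 / 99 * (H * cellWidth K u 0) := by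
  have h3 := R.card_lower_le
  have h4 := R.error_le
  have h5 : ∑ m ∈ Finset.Ico H (2 * H), lowerDens ρ K m ≤ (1 + 1 / 10 ^ 7) * (H / 50) := by
    rw [sum_lowerDens_eq]
    refine (Finset.sum_le_card_nsmul _ _ (1 + 1 / 10 ^ 7) fun m hm => ?_).trans ?_
    · obtain ⟨⟨a1, a2⟩, a3⟩ := mem_multPlaces.1 hm
      have := R.upperDens_add_le a1 a2 a3
      linarith [R.upperDens_nonneg m]
    · have : (50 : ℝ) * (multPlaces ρ H K).card ≤ H := by exact_mod_cast hlow
      rw [nsmul_eq_mul, mul_comm]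
      gcongr
      linarith
  have hw : (0 : ℝ) ≤ cellWidth K u 0 := Nat.cast_nonneg _
  have hh : (0 : ℝ) ≤ H := Nat.cast_nonneg _
  have h6 := mul_le_mul_of_nonneg_left h5 hw
  have h7 := mul_le_mul_of_nonneg_left h4 hh
  have h8 : (H : ℝ) * (K * (24 * (4 ^ (K + 1) * E))) ≤
      H * ((K + 1) * (24 * (4 ^ (K + 1) * E))) := by
    gcongr
    · linarith [R.one_le_mul]
    · linarith
  nlinarith [mul_nonneg hh hw]

end Regularized.Fine

/-- The upper half is small as soon as there is an element in the lower half. -/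
theorem HasPropertyP.card_upper_half_le {A : Finset ℕ} {N z : ℕ} (h : HasPropertyP (A : Set ℕ))
    (hpos : ∀ a ∈ A, 0 < a) (hA : ∀ a ∈ A, a ≤ N) (hz : z ∈ A) (hzN : 2 * z ≤ N) :
    10000 * (A.filter fun a => N < 2 * a).card ≤ 3235 * N + 1000000 := by
  obtain ⟨j, hj1, hj2⟩ := exists_two_pow_mul_mem (hpos z hz) hzN
  have hzj : z ≤ 2 ^ j * z := Nat.le_mul_of_pos_left z (by positivity)
  refine _root_.card_upper_half_le (fun x hx => ?_) hj1 hj2 (fun k u hu v hv => ?_)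
    fun x hx u hu v hv => ?_
  · exact ⟨(Finset.mem_filter.1 hx).2, hA x (Finset.mem_filter.1 hx).1⟩
  · rw [Finset.mem_filter] at hu hv
    rw [← mul_assoc]
    exact h.add_ne_mul hu.1 hv.1 hz (by omega) (by omega)
  · exact h.add_ne_mul (Finset.mem_filter.1 hu).1 (Finset.mem_filter.1 hv).1
      (Finset.mem_filter.1 hx).1

/-- An element in the lower half forces a set with property P to be smaller than a third by a
positive proportion. -/
theorem exists_card_le_add_of_lower_half : ∃ M V, 0 < M ∧ ∀ v, V ≤ v → 0 < v → ∀ A : Finset ℕ,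
    HasPropertyP (A : Set ℕ) → (∀ a ∈ A, 0 < a ∧ a < M * v) → (∃ z ∈ A, 2 * z ≤ M * v) →
      (A.card : ℝ) ≤ (1 / 3 - 1 / 10 ^ 7) * (M * v : ℕ) + 102 := by
  -- With K = 27 and c = 10⁻¹⁰ the discarded proportion 2⁻²⁷ + 28(c + 24ε) is below 2·10⁻⁸, against
  -- a gain of 9·10⁻⁷; δ is the value that the field `big` demands.
  set ε : ℝ := 1 / 10 ^ 12 with hε
  set δ : ℝ := ε / 2 ^ 28 / (10 ^ 24 * 4 ^ 28) with hδ
  obtain ⟨M, hM, hreg⟩ := exists_regularized 27 (H₀ := 30) (by norm_num) (ε := ε) (δ := δ)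
    (c := 1 / 10 ^ 10) (by positivity) (by positivity) (by norm_num)
  obtain ⟨V, hV⟩ := exists_nat_ge (1 / δ)
  refine ⟨2 * (30 * M) * 2 ^ 33, V, by positivity, fun v hVv hv A hP hA hz => ?_⟩
  have hN : 2 * (30 * M) * 2 ^ 33 * v = 2 * (30 * M) * cellWidth 27 v 0 := by
    rw [cellWidth]
    ring
  obtain ⟨g, u, ρ, hg, hvu, hgu, A', hA', R, hcard⟩ := hreg v hv A fun a ha => by
    rw [← hN]
    exact (hA a ha).2
  have hN' : 2 * (30 * M) * 2 ^ 33 * v = 2 * (30 * g * cellWidth 27 u 0) := by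
    rw [cellWidth]
    calc _ = 2 * 30 * 2 ^ 33 * (M * v) := by ring
      _ = _ := by rw [← hgu]; ring
  rw [hN'] at hA hz ⊢
  have hδ0 : 0 < δ := by positivity
  have F : Regularized.Fine A' (30 * g) u 27 ρ (δ * u) ε :=
    { R with
      prop := hP.mono hA'
      H_pos := by positivity
      u_pos := by omega
      one_le := by
        have h1 : (V : ℝ) ≤ u := by exact_mod_cast hVv.trans hvu
        rw [div_le_iff₀ hδ0] at hV
        nlinarith
      pos := by positivity
      le_one := by rw [hε]; norm_num
      big := by
        rw [hδ]
        apply le_of_eq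
        field_simp
        ring }
  have hw : (0 : ℝ) ≤ ((30 * g : ℕ) : ℝ) * cellWidth 27 u 0 := by positivity
  have hcard' : (A.card : ℝ) ≤ A'.card + 2 / 10 ^ 8 * ((30 * g : ℕ) * cellWidth 27 u 0) := by
    refine hcard.trans (add_le_add_right (mul_le_mul_of_nonneg_right ?_ hw) _)
    rw [hε]
    norm_num
  have hcast : ((2 * (30 * g * cellWidth 27 u 0) : ℕ) : ℝ) =
      2 * (((30 * g : ℕ) : ℝ) * cellWidth 27 u 0) := by push_cast; ring
  rw [hcast]
  -- With few multiplier places, 2·0.3235 + 1/99 < 2/3 in units of H times the top width. The upper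
  -- half is estimated for A itself, since z may be missing from A'.
  by_cases hlow : 30 * g ≤ 50 * (Regularized.Fine.multPlaces ρ (30 * g) 27).card
  · have := F.card_le_of_many hlow
    linarith
  · have h1 := F.card_lower_le_of_few (by omega)
    obtain ⟨z, hz, hz2⟩ := hz
    have h2 := hP.card_upper_half_le (fun a ha => (hA a ha).1) (fun a ha => (hA a ha).2.le) hz hz2
    have h3 : (A'.filter fun a => 30 * g * cellWidth 27 u 0 ≤ a).card ≤
        (A.filter fun a => 2 * (30 * g * cellWidth 27 u 0) < 2 * a).card + 1 := by
      refine (Finset.card_le_card (t := insert (30 * g * cellWidth 27 u 0)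
        (A.filter fun a => 2 * (30 * g * cellWidth 27 u 0) < 2 * a)) fun a ha => ?_).trans
        (Finset.card_insert_le _ _)
      obtain ⟨ha1, ha2⟩ := Finset.mem_filter.1 ha
      rcases ha2.eq_or_lt with he | hlt
      · exact Finset.mem_insert.2 (Or.inl he.symm)
      · exact Finset.mem_insert_of_mem (Finset.mem_filter.2 ⟨hA' ha1, by omega⟩)
    have h5 : (A'.card : ℝ) = (A'.filter fun a => 30 * g * cellWidth 27 u 0 ≤ a).card +
        (A'.filter fun a => ¬ 30 * g * cellWidth 27 u 0 ≤ a).card := by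
      exact_mod_cast (Finset.card_filter_add_card_filter_not _).symm
    have h2' : (10000 : ℝ) * (A.filter fun a => 2 * (30 * g * cellWidth 27 u 0) < 2 * a).card ≤
        3235 * (2 * (((30 * g : ℕ) : ℝ) * cellWidth 27 u 0)) + 1000000 := by
      rw [← hcast]
      exact_mod_cast h2
    have h3' : ((A'.filter fun a => 30 * g * cellWidth 27 u 0 ≤ a).card : ℝ) ≤
        (A.filter fun a => 2 * (30 * g * cellWidth 27 u 0) < 2 * a).card + 1 := by
      exact_mod_cast h3
    linarith

/-- An element in the lower half makes the bound hold for large `n`. -/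
theorem exists_card_le_of_lower_half :
    ∃ N : ℕ, ∀ n : ℕ, N ≤ n → ∀ A : Finset ℕ, A ⊆ Finset.Icc 1 n → HasPropertyP (A : Set ℕ) →
      (∃ z ∈ A, 2 * z ≤ n) → A.card ≤ (n + 2) / 3 := by
  obtain ⟨M, V, hM, hMV⟩ := exists_card_le_add_of_lower_half
  -- Rounding n up to a multiple of M costs at most M/3, which the gain 10⁻⁷n must cover together
  -- with the constant 102.
  refine ⟨M * V + 10 ^ 7 * M + 10 ^ 10, fun n hn A hA hP ⟨z, hz, hzn⟩ => ?_⟩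
  have h1 := Nat.div_add_mod n M
  have h2 := Nat.mod_lt n hM
  have h3 : M * (n / M + 1) = M * (n / M) + M := by ring
  have hV : V ≤ n / M := by
    rw [Nat.le_div_iff_mul_le hM, mul_comm]
    omega
  have h4 := hMV (n / M + 1) (by omega) (Nat.succ_pos _) A hP
    (fun a ha => by
      have := Finset.mem_Icc.1 (hA ha)
      omega) ⟨z, hz, by omega⟩
  have h5 : ((M * (n / M + 1) : ℕ) : ℝ) ≤ n + M := by exact_mod_cast (by omega)
  have h6 : (10 : ℝ) ^ 7 * M + 10 ^ 10 ≤ n := by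
    have : 10 ^ 7 * M + 10 ^ 10 ≤ n := by
      have := Nat.zero_le (M * V)
      omega
    exact_mod_cast this
  have h7 : (3 : ℝ) * A.card ≤ n := by linarith
  have h8 : 3 * A.card ≤ n := by exact_mod_cast h7
  omega

theorem theorem2 :
    ∃ N : ℕ, ∀ n : ℕ, N ≤ n →
      (∀ A : Finset ℕ, A ⊆ Finset.Icc 1 n → HasPropertyP (A : Set ℕ) →
        A.card ≤ ⌈(n : ℝ) / 3⌉₊) ∧
      (Finset.Icc (⌊2 * (n : ℝ) / 3⌋₊ + 1) n ⊆ Finset.Icc 1 n ∧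
        HasPropertyP (Finset.Icc (⌊2 * (n : ℝ) / 3⌋₊ + 1) n : Set ℕ) ∧
        (Finset.Icc (⌊2 * (n : ℝ) / 3⌋₊ + 1) n).card = ⌈(n : ℝ) / 3⌉₊) := by
  obtain ⟨N, hN⟩ := exists_card_le_of_lower_half
  refine ⟨N, fun n hn => ?_⟩
  rw [ceil_div_three, floor_two_mul_div_three]
  refine ⟨fun A hA hP => ?_, Finset.Icc_subset_Icc_left (by omega),
    hasPropertyP_Icc_upper_third n, by rw [Nat.card_Icc]; omega⟩
  by_cases hlow : ∃ z ∈ A, 2 * z ≤ n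
  · exact hN n hn A hA hP hlow
  · push Not at hlow
    exact card_le_of_upper_half hA hP hlow
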